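/- Let $\mathbb K$ be a field of characteristic $0$, let $(\mathfrak g,\pi=[\cdot,\cdot,\cdot]_{\mathfrak g})$ and $(\mathfrak h,\mu=[\cdot,\cdot,\cdot]_{\mathfrak h})$ be $3$-Lie algebras over $\mathbb K$ (vector spaces of arbitrary dimension with a skew-symmetric trilinear bracket satisfying $[x_1,x_2,[x_3,x_4,x_5]]=[[x_1,x_2,x_3],x_4,x_5]+[x_3,[x_1,x_2,x_4],x_5]+[x_3,x_4,[x_1,x_2,x_5]]$), and let $\lambda\in\mathbb K$. Let $\rho:\wedge^2\mathfrak g\to\mathfrak{gl}(\mathfrak h)$ be an action of $\mathfrak g$ on $\mathfrak h$, i.e. for all $x_i,x,y\in\mathfrak g$ and $u,v,w\in\mathfrak h$, $$\rho(x_1,x_2)\rho(x_3,x_4)=\rho([x_1,x_2,x_3]_{\mathfrak g},x_4)+\rho(x_3,[x_1,x_2,x_4]_{\mathfrak g})+\rho(x_3,x_4)\rho(x_1,x_2),$$ $$\rho(x_1,[x_2,x_3,x_4]_{\mathfrak g})=\rho(x_3,x_4)\rho(x_1,x_2)-\rho(x_2,x_4)\rho(x_1,x_3)+\rho(x_2,x_3)\rho(x_1,x_4),$$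 $\rho(x,y)u$ lies in the center $\{a\in\mathfrak h\mid [a,b,c]_{\mathfrak h}=0\ \forall b,c\in\mathfrak h\}$, and $\rho(x,y)[u,v,w]_{\mathfrak h}=0$. For vector spaces $V,W$ and $n\ge 0$ let $C^n(V,W)=\mathrm{Hom}(\wedge^2V\otimes\cdots\otimes\wedge^2V\wedge V,W)$ ($n$ factors $\wedge^2V$; the maps $f(\mathfrak X_1,\dots,\mathfrak X_n,z)$ that are multilinear in $\mathfrak X_i\in\wedge^2V$ and $z\in V$ and alternating in $x,y,z$ when $\mathfrak X_n=x\wedge y$) and $C^*(V,W)=\bigoplus_{n\ge0}C^n(V,W)$. On $C^*(V,V)$ consider the graded bracket $[P,Q]=P\circ Q-(-1)^{pq}Q\circ P$ for $P\in C^p(V,V)$, $Q\in C^q(V,V)$, where, for $\mathfrak X_i=x_i\wedge y_i$, and with $\mathbb S(i,j)$ the set of $(i,j)$-shuffles, $$\begin{aligned}(P\circ Q)(\mathfrak X_1,\dots,\mathfrak X_{p+q},x)=&\sum_{k=1}^p(-1)^{(k-1)q}\sum_{\sigma\in\mathbb S(k-1,q)}(-1)^\sigma P\big(\mathfrak X_{\sigma(1)},\dots,\mathfrak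 X_{\sigma(k-1)},\mathfrak Y_{k,\sigma},\mathfrak X_{k+q+1},\dots,\mathfrak X_{p+q},x\big)\\&+\sum_{\sigma\in\mathbb S(p,q)}(-1)^{pq}(-1)^\sigma P\big(\mathfrak X_{\sigma(1)},\dots,\mathfrak X_{\sigma(p)},Q(\mathfrak X_{\sigma(p+1)},\dots,\mathfrak X_{\sigma(p+q)},x)\big),\end{aligned}$$ $$\mathfrak Y_{k,\sigma}=Q(\mathfrak X_{\sigma(k)},\dots,\mathfrak X_{\sigma(k+q-1)},x_{k+q})\wedge y_{k+q}+x_{k+q}\wedge Q(\mathfrak X_{\sigma(k)},\dots,\mathfrak X_{\sigma(k+q-1)},y_{k+q}).$$ Take $V=\mathfrak g\oplus\mathfrak h$ and let $\Delta=\pi+\rho+\lambda\mu\in C^1(\mathfrak g\oplus\mathfrak h,\mathfrak g\oplus\mathfrak h)$, $$\Delta(x+u,y+v,z+w)=[x,y,z]_{\mathfrak g}+\rho(x,y)w+\rho(y,z)u+\rho(z,x)v+\lambda[u,v,w]_{\mathfrak h}.$$ Regard $C^*(\mathfrak h,\mathfrak g)$ as a subspace of $C^*(\mathfrak g\oplus\mathfrak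 h,\mathfrak g\oplus\mathfrak h)$ (extension by zero), let $\mathcal P$ be the projection onto it (restriction of the arguments to $\mathfrak h$, $\mathfrak g$-component of the value), and define the higher derived brackets $$l_k(a_1,\dots,a_k)=\mathcal P[\cdots[[\Delta,a_1],a_2],\cdots,a_k],\qquad a_1,\dots,a_k\in C^*(\mathfrak h,\mathfrak g).$$ Then $l_k=0$ for $k\ne1,3$, and $(C^*(\mathfrak h,\mathfrak g),l_1,l_3)$ is an $L_\infty$-algebra (with graded symmetric operations of degree $1$ and the generalized Jacobi identities). Its Maurer-Cartan elements, i.e. the elements $\alpha$ of degree $0$ with $\sum_{k\ge1}\frac1{k!}l_k(\alpha,\dots,\alpha)=0$, are precisely the relative Rota-Baxter operators of weight $\lambda$ from $\mathfrak h$ to $\mathfrak g$ with respect to $\rho$, i.e. the linear maps $T:\mathfrak h\to\mathfrak g$, viewed as elements of $C^0(\mathfrak h,\mathfrak g)=\mathrm{Hom}(\mathfrak h,\mathfrak g)$, such that for all $u,v,w\in\mathfrak h$ $$[Tu,Tv,Tw]_{\mathfrak g}=T\big(\rho(Tu,Tv)w+\rho(Tv,Tw)u+\rho(Tw,Tu)v+\lambda[u,v,w]_{\mathfrak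 h}\big).$$ -/

import Mathlib

open scoped DirectSum

noncomputable section

namespace ThreeLie

variable (K : Type*) [Field K]

/-- A 3-Lie algebra structure on the vector space `g`. -/
structure Bracket (g : Type*) [AddCommGroup g] [Module K g] where
  /-- the skew-symmetric trilinear bracket `[x, y, z] = br ![x, y, z]` -/
  br : g [⋀^Fin 3]→ₗ[K] g
  fundamental_identity : ∀ x₁ x₂ x₃ x₄ x₅ : g,
    br ![x₁, x₂, br ![x₃, x₄, x₅]] =
      br ![br ![x₁, x₂, x₃], x₄, x₅] + br ![x₃, br ![x₁, x₂, x₄], x₅]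
        + br ![x₃, x₄, br ![x₁, x₂, x₅]]

variable {K}

/-- The center of a 3-Lie algebra. -/
def Bracket.center {g : Type*} [AddCommGroup g] [Module K g] (π : Bracket K g) : Set g :=
  {x | ∀ y z, π.br ![x, y, z] = 0}

variable {g h : Type*} [AddCommGroup g] [Module K g] [AddCommGroup h] [Module K h]

/-- `ρ : ∧² g → gl(h)` is a representation of the 3-Lie algebra `(g, π)` on the vector space `h`. -/
structure IsRepresentation (π : Bracket K g) (ρ : g [⋀^Fin 2]→ₗ[K] Module.End K h) : Prop where
  rep₁ : ∀ x₁ x₂ x₃ x₄ : g,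
    ρ ![x₁, x₂] * ρ ![x₃, x₄] =
      ρ ![π.br ![x₁, x₂, x₃], x₄] + ρ ![x₃, π.br ![x₁, x₂, x₄]] + ρ ![x₃, x₄] * ρ ![x₁, x₂]
  rep₂ : ∀ x₁ x₂ x₃ x₄ : g,
    ρ ![x₁, π.br ![x₂, x₃, x₄]] =
      ρ ![x₃, x₄] * ρ ![x₁, x₂] - ρ ![x₂, x₄] * ρ ![x₁, x₃] + ρ ![x₂, x₃] * ρ ![x₁, x₄]

/-- `ρ` is an action of the 3-Lie algebra `(g, π)` on the 3-Lie algebra `(h, μ)`. -/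
structure IsAction (π : Bracket K g) (μ : Bracket K h)
    (ρ : g [⋀^Fin 2]→ₗ[K] Module.End K h) : Prop extends IsRepresentation π ρ where
  mem_center : ∀ (x y : g) (u : h), ρ ![x, y] u ∈ μ.center
  apply_bracket : ∀ (x y : g) (u v w : h), ρ ![x, y] (μ.br ![u, v, w]) = 0

/-- Relative Rota-Baxter operators of weight `lam` from `(h, μ)` to `(g, π)` with respect to `ρ`. -/
def IsRelativeRotaBaxter (π : Bracket K g) (μ : Bracket K h)
    (ρ : g [⋀^Fin 2]→ₗ[K] Module.End K h) (lam : K) (T : h →ₗ[K] g) : Prop :=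
  ∀ u v w : h,
    π.br ![T u, T v, T w] =
      T (ρ ![T u, T v] w + ρ ![T v, T w] u + ρ ![T w, T u] v + lam • μ.br ![u, v, w])

section Cochains

variable {V W : Type*} [AddCommGroup V] [Module K V] [AddCommGroup W] [Module K W]

/-- The decomposable bivector `x ∧ y`. -/
def wedge (x y : V) : ⋀[K]^2 V := exteriorPower.ιMulti K 2 ![x, y]

lemma wedge_add_left (x x' y : V) : wedge (K := K) (x + x') y = wedge x y + wedge x' y := by
  have hu : ∀ z, Function.update ![x, y] 0 z = ![z, y] := fun z => by
    ext i; fin_cases i <;> rfl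
  have := (exteriorPower.ιMulti K 2 (M := V)).map_update_add ![x, y] 0 x x'
  rwa [hu, hu, hu] at this

lemma wedge_smul_left (c : K) (x y : V) : wedge (K := K) (c • x) y = c • wedge x y := by
  have hu : ∀ z, Function.update ![x, y] 0 z = ![z, y] := fun z => by
    ext i; fin_cases i <;> rfl
  have := (exteriorPower.ιMulti K 2 (M := V)).map_update_smul ![x, y] 0 c x
  rwa [hu, hu] at this

lemma wedge_add_right (x y y' : V) : wedge (K := K) x (y + y') = wedge x y + wedge x y' := by
  have hu : ∀ z, Function.update ![x, y] 1 z = ![x, z] := fun z => by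
    ext i; fin_cases i <;> rfl
  have := (exteriorPower.ιMulti K 2 (M := V)).map_update_add ![x, y] 1 y y'
  rwa [hu, hu, hu] at this

lemma wedge_smul_right (c : K) (x y : V) : wedge (K := K) x (c • y) = c • wedge x y := by
  have hu : ∀ z, Function.update ![x, y] 1 z = ![x, z] := fun z => by
    ext i; fin_cases i <;> rfl
  have := (exteriorPower.ιMulti K 2 (M := V)).map_update_smul ![x, y] 1 c y
  rwa [hu, hu] at this

lemma wedge_self (x : V) : wedge (K := K) x x = 0 :=
  (exteriorPower.ιMulti K 2 (M := V)).map_eq_zero_of_eq ![x, x] (i := 0) (j := 1) rfl (by decide)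

lemma wedge_swap (x y : V) : wedge (K := K) x y = - wedge y x := by
  have := wedge_self (K := K) (x + y)
  rw [wedge_add_left, wedge_add_right, wedge_add_right, wedge_self, wedge_self] at this
  rw [eq_neg_iff_add_eq_zero]
  simpa using this

/-- The alternating map `(x, y) ↦ f x ∧ y + x ∧ f y`. -/
def derivAlt (f : V →ₗ[K] V) : V [⋀^Fin 2]→ₗ[K] ⋀[K]^2 V where
  toFun v := wedge (f (v 0)) (v 1) + wedge (v 0) (f (v 1))
  map_update_add' := by
    intro inst v i x y
    obtain rfl : inst = instDecidableEqFin 2 := Subsingleton.elim _ _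
    fin_cases i <;> simp [wedge_add_left, wedge_add_right] <;> abel
  map_update_smul' := by
    intro inst v i c x
    obtain rfl : inst = instDecidableEqFin 2 := Subsingleton.elim _ _
    fin_cases i <;> simp [wedge_smul_left, wedge_smul_right]
  map_eq_zero_of_eq' v i j hv hij := by
    have h01 : v 0 = v 1 := by
      fin_cases i <;> fin_cases j <;> simp_all
    show wedge (f (v 0)) (v 1) + wedge (v 0) (f (v 1)) = 0
    rw [h01, wedge_swap, neg_add_cancel]

/-- The derivation extension of `f : V → V` to `∧² V`, that is,
`x ∧ y ↦ f x ∧ y + x ∧ f y`; it is linear in `f`. -/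
def derivExt : (V →ₗ[K] V) →ₗ[K] (⋀[K]^2 V →ₗ[K] ⋀[K]^2 V) :=
  exteriorPower.alternatingMapLinearEquiv.toLinearMap ∘ₗ
    { toFun := derivAlt
      map_add' := fun f f' => by
        ext v : 1
        simp [derivAlt, wedge_add_left, wedge_add_right]; abel
      map_smul' := fun c f => by
        ext v : 1
        simp [derivAlt, wedge_smul_left, wedge_smul_right] }

lemma derivExt_wedge (f : V →ₗ[K] V) (x y : V) :
    derivExt f (wedge x y) = wedge (f x) y + wedge x (f y) := by
  simp only [derivExt, LinearMap.comp_apply, LinearMap.coe_mk, AddHom.coe_mk,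
    LinearEquiv.coe_coe, wedge, exteriorPower.alternatingMapLinearEquiv_apply_ιMulti]
  simp [derivAlt, wedge]

variable (K V W) in
/-- `Hom((∧² V)^{⊗ n} ⊗ V, W)`. -/
abbrev PreCochain (n : ℕ) : Type _ :=
  MultilinearMap K (fun _ : Fin n => ⋀[K]^2 V) (V →ₗ[K] W)

variable (K V W) in
/-- `Cⁿ(V, W) = Hom(∧² V ⊗ ⋯ ⊗ ∧² V ∧ V, W)`: the maps `f(𝔛₁, …, 𝔛ₙ, z)` that are
alternating in the last three vectors `x, y, z` when `𝔛ₙ = x ∧ y`. Since `f` is a linear map on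
`∧² V` in `𝔛ₙ`, this amounts to the vanishing of `f(𝔛₁, …, 𝔛ₙ₋₁, x ∧ y, y)`.
For `n = 0` there is no condition and `C⁰(V, W) = Hom(V, W)`. -/
def cochains (n : ℕ) : Submodule K (PreCochain K V W n) where
  carrier := {f | ∀ (X : Fin n → ⋀[K]^2 V) (i : Fin n) (x y : V),
    (i : ℕ) + 1 = n → X i = wedge x y → f X y = 0}
  add_mem' hf hf' X i x y hi hX := by
    simp [hf X i x y hi hX, hf' X i x y hi hX]
  zero_mem' X i x y _ _ := by simp
  smul_mem' c f hf X i x y hi hX := by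
    simp [hf X i x y hi hX]

/-- The arguments `(𝔛₁, …, 𝔛ₖ, Q(𝔛ₖ₊₁, …, 𝔛ₖ₊_q, -) ⋆ 𝔛ₖ₊_q₊₁, 𝔛ₖ₊_q₊₂, …, 𝔛ₚ₊_q)`, where for a linear
map `f : V → V` one puts `f ⋆ (x ∧ y) = f x ∧ y + x ∧ f y`. In the code slots are numbered from `0`. -/
def insertArgs {p q : ℕ} (Q : PreCochain K V V q) (k : Fin p) (X : Fin (p + q) → ⋀[K]^2 V) :
    Fin p → ⋀[K]^2 V := fun a =>
  if a < k then X ⟨a, by omega⟩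
  else if a = k then derivExt (Q fun b => X ⟨k + b, by omega⟩) (X ⟨k + q, by omega⟩)
  else X ⟨a + q, by omega⟩

lemma insertArgs_update {p q : ℕ} (Q : PreCochain K V V q) (k : Fin p)
    (X : Fin (p + q) → ⋀[K]^2 V) (i : Fin (p + q)) :
    ∃ (a : Fin p) (L : ⋀[K]^2 V →ₗ[K] ⋀[K]^2 V), ∀ v,
      insertArgs Q k (Function.update X i v) = Function.update (insertArgs Q k X) a (L v) := by
  obtain ⟨i, hi⟩ := i
  obtain ⟨k, hk⟩ := k
  rcases lt_or_ge i k with h1 | h1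
  · refine ⟨⟨i, by omega⟩, LinearMap.id, fun v => funext fun a => ?_⟩
    obtain ⟨a, ha⟩ := a
    simp only [insertArgs, Function.update_apply, Fin.mk.injEq, Fin.mk_lt_mk, LinearMap.id_apply]
    have e1 : ∀ b : Fin q, ¬ (k + (b : ℕ) = i) := fun b => by omega
    have e2 : ¬ (k + q = i) := by omega
    simp only [e1, e2, if_false]
    split_ifs <;> first | rfl | omega
  rcases lt_or_ge i (k + q) with h2 | h2
  · refine ⟨⟨k, hk⟩, (derivExt.flip (X ⟨k + q, by omega⟩)) ∘ₗ
      (Q.toLinearMap (fun b => X ⟨k + b, by omega⟩) ⟨i - k, by omega⟩),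
      fun v => funext fun a => ?_⟩
    obtain ⟨a, ha⟩ := a
    have e1 : (fun b : Fin q => Function.update X ⟨i, hi⟩ v ⟨k + b, by omega⟩) =
        Function.update (fun b : Fin q => X ⟨k + b, by omega⟩) ⟨i - k, by omega⟩ v := by
      funext b
      simp only [Function.update_apply, Fin.ext_iff]
      split_ifs <;> first | rfl | omega
    have e2 : ¬ (k + q = i) := by omega
    simp only [insertArgs, e1]
    simp only [Function.update_apply, Fin.mk.injEq, Fin.mk_lt_mk, e2, if_false,
      LinearMap.comp_apply, LinearMap.flip_apply, MultilinearMap.toLinearMap_apply]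
    split_ifs <;> first | rfl | (exfalso; omega) |
      (simp only [insertArgs, Fin.mk_lt_mk, Fin.mk.injEq]; split_ifs; rfl)
  rcases eq_or_lt_of_le h2 with h3 | h3
  · refine ⟨⟨k, hk⟩, derivExt (Q fun b => X ⟨k + b, by omega⟩), fun v => funext fun a => ?_⟩
    obtain ⟨a, ha⟩ := a
    have e1 : ∀ b : Fin q, ¬ (k + (b : ℕ) = i) := fun b => by omega
    simp only [insertArgs, Function.update_apply, Fin.mk.injEq, Fin.mk_lt_mk, e1, if_false, h3,
      if_true]
    split_ifs <;> first | rfl | omega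
  · refine ⟨⟨i - q, by omega⟩, LinearMap.id, fun v => funext fun a => ?_⟩
    obtain ⟨a, ha⟩ := a
    have e1 : ∀ b : Fin q, ¬ (k + (b : ℕ) = i) := fun b => by omega
    have e2 : ¬ (k + q = i) := by omega
    simp only [insertArgs, Function.update_apply, Fin.mk.injEq, Fin.mk_lt_mk, e1, e2, if_false,
      LinearMap.id_apply]
    split_ifs <;> first | rfl | omega

/-- `𝔛 ↦ P(𝔛₁, …, 𝔛ₖ, Q(𝔛ₖ₊₁, …, 𝔛ₖ₊_q, -) ⋆ 𝔛ₖ₊_q₊₁, 𝔛ₖ₊_q₊₂, …, 𝔛ₚ₊_q, -)`. -/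
def insertAt {p q : ℕ} (P : PreCochain K V W p) (Q : PreCochain K V V q) (k : Fin p) :
    PreCochain K V W (p + q) where
  toFun X := P (insertArgs Q k X)
  map_update_add' := by
    intro inst X i v w
    obtain rfl : inst = instDecidableEqFin _ := Subsingleton.elim _ _
    obtain ⟨a, L, hL⟩ := insertArgs_update Q k X i
    rw [hL, hL, hL, map_add, P.map_update_add]
  map_update_smul' := by
    intro inst X i c v
    obtain rfl : inst = instDecidableEqFin _ := Subsingleton.elim _ _
    obtain ⟨a, L, hL⟩ := insertArgs_update Q k X i
    rw [hL, hL, map_smul, P.map_update_smul]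

/-- `(𝔛, z) ↦ P(𝔛₁, …, 𝔛ₚ, Q(𝔛ₚ₊₁, …, 𝔛ₚ₊_q, z))`. -/
def insertLast {p q : ℕ} (P : PreCochain K V W p) (Q : PreCochain K V V q) :
    PreCochain K V W (p + q) where
  toFun X := P (fun a => X (Fin.castAdd q a)) ∘ₗ Q (fun b => X (Fin.natAdd p b))
  map_update_add' := by
    intro inst X i v w
    obtain rfl : inst = instDecidableEqFin _ := Subsingleton.elim _ _
    induction i using Fin.addCases with
    | left i =>
      have e1 : ∀ v, (fun a => Function.update X (Fin.castAdd q i) v (Fin.castAdd q a)) =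
          Function.update (fun a => X (Fin.castAdd q a)) i v := fun v => by
        funext a; simp [Function.update_apply]
      have e2 : ∀ v, (fun b => Function.update X (Fin.castAdd q i) v (Fin.natAdd p b)) =
          (fun b => X (Fin.natAdd p b)) := fun v => by
        funext b; simp [Function.update_apply, Fin.ext_iff]; omega
      simp only [e1, e2, P.map_update_add, LinearMap.add_comp]
    | right i =>
      have e1 : ∀ v, (fun a => Function.update X (Fin.natAdd p i) v (Fin.castAdd q a)) =
          (fun a => X (Fin.castAdd q a)) := fun v => by
        funext a; simp [Function.update_apply, Fin.ext_iff]; omega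
      have e2 : ∀ v, (fun b => Function.update X (Fin.natAdd p i) v (Fin.natAdd p b)) =
          Function.update (fun b => X (Fin.natAdd p b)) i v := fun v => by
        funext b; simp [Function.update_apply]
      simp only [e1, e2, Q.map_update_add, LinearMap.comp_add]
  map_update_smul' := by
    intro inst X i c v
    obtain rfl : inst = instDecidableEqFin _ := Subsingleton.elim _ _
    induction i using Fin.addCases with
    | left i =>
      have e1 : ∀ v, (fun a => Function.update X (Fin.castAdd q i) v (Fin.castAdd q a)) =
          Function.update (fun a => X (Fin.castAdd q a)) i v := fun v => by
        funext a; simp [Function.update_apply]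
      have e2 : ∀ v, (fun b => Function.update X (Fin.castAdd q i) v (Fin.natAdd p b)) =
          (fun b => X (Fin.natAdd p b)) := fun v => by
        funext b; simp [Function.update_apply, Fin.ext_iff]; omega
      simp only [e1, e2, P.map_update_smul, LinearMap.smul_comp]
    | right i =>
      have e1 : ∀ v, (fun a => Function.update X (Fin.natAdd p i) v (Fin.castAdd q a)) =
          (fun a => X (Fin.castAdd q a)) := fun v => by
        funext a; simp [Function.update_apply, Fin.ext_iff]; omega
      have e2 : ∀ v, (fun b => Function.update X (Fin.natAdd p i) v (Fin.natAdd p b)) =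
          Function.update (fun b => X (Fin.natAdd p b)) i v := fun v => by
        funext b; simp [Function.update_apply]
      simp only [e1, e2, Q.map_update_smul, LinearMap.comp_smul]

lemma insertAt_add_left {p q : ℕ} (P P' : PreCochain K V W p) (Q : PreCochain K V V q)
    (k : Fin p) : insertAt (P + P') Q k = insertAt P Q k + insertAt P' Q k := rfl

lemma insertAt_smul_left {p q : ℕ} (c : K) (P : PreCochain K V W p) (Q : PreCochain K V V q)
    (k : Fin p) : insertAt (c • P) Q k = c • insertAt P Q k := rfl

lemma insertArgs_eq_update {p q : ℕ} (Q Q' : PreCochain K V V q) (k : Fin p)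
    (X : Fin (p + q) → ⋀[K]^2 V) :
    insertArgs Q' k X = Function.update (insertArgs Q k X) k
      (derivExt (Q' fun b => X ⟨k + b, by omega⟩) (X ⟨k + q, by omega⟩)) := by
  funext a
  rcases eq_or_ne a k with rfl | h
  · simp [insertArgs]
  · simp [insertArgs, h]

lemma insertAt_add_right {p q : ℕ} (P : PreCochain K V W p) (Q Q' : PreCochain K V V q)
    (k : Fin p) : insertAt P (Q + Q') k = insertAt P Q k + insertAt P Q' k := by
  refine MultilinearMap.ext fun X => ?_
  show P (insertArgs (Q + Q') k X) = P (insertArgs Q k X) + P (insertArgs Q' k X)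
  rw [insertArgs_eq_update Q (Q + Q'), insertArgs_eq_update Q Q', add_apply,
    map_add, LinearMap.add_apply, P.map_update_add, ← insertArgs_eq_update,
    ← insertArgs_eq_update]

lemma insertAt_smul_right {p q : ℕ} (c : K) (P : PreCochain K V W p) (Q : PreCochain K V V q)
    (k : Fin p) : insertAt P (c • Q) k = c • insertAt P Q k := by
  refine MultilinearMap.ext fun X => ?_
  show P (insertArgs (c • Q) k X) = c • P (insertArgs Q k X)
  rw [insertArgs_eq_update Q (c • Q), smul_apply, map_smul, LinearMap.smul_apply,
    P.map_update_smul, ← insertArgs_eq_update]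

/-- The `(k, q)`-shuffles of the first `k + q` elements of `{0, …, n - 1}`, seen as permutations of
`{0, …, n - 1}` that fix the remaining elements. -/
def shuffles (n k q : ℕ) : Finset (Equiv.Perm (Fin n)) :=
  {σ | (∀ i j : Fin n, i < j → (j : ℕ) < k → σ i < σ j) ∧
    (∀ i j : Fin n, k ≤ (i : ℕ) → i < j → (j : ℕ) < k + q → σ i < σ j) ∧
    (∀ i : Fin n, k + q ≤ (i : ℕ) → σ i = i)}

/-- The circle product `P ∘ Q`. -/
def circ {p q : ℕ} (P : PreCochain K V W p) (Q : PreCochain K V V q) : PreCochain K V W (p + q) :=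
  (∑ k : Fin p, (-1 : ℤˣ) ^ ((k : ℕ) * q) • ∑ σ ∈ shuffles (p + q) k q,
      Equiv.Perm.sign σ • (insertAt P Q k).domDomCongr σ)
    + ∑ σ ∈ shuffles (p + q) p q,
      (-1 : ℤˣ) ^ (p * q) • Equiv.Perm.sign σ • (insertLast P Q).domDomCongr σ

lemma circ_apply {p q : ℕ} (P : PreCochain K V W p) (Q : PreCochain K V V q)
    (X : Fin (p + q) → ⋀[K]^2 V) (z : V) :
    circ P Q X z =
      (∑ k : Fin p, (-1 : ℤˣ) ^ ((k : ℕ) * q) • ∑ σ ∈ shuffles (p + q) k q,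
        Equiv.Perm.sign σ • P (insertArgs Q k (fun i => X (σ i))) z)
      + ∑ σ ∈ shuffles (p + q) p q, (-1 : ℤˣ) ^ (p * q) • Equiv.Perm.sign σ •
        P (fun a => X (σ (Fin.castAdd q a))) (Q (fun b => X (σ (Fin.natAdd p b))) z) := by
  simp only [circ, add_apply, sum_apply, LinearMap.add_apply,
    LinearMap.sum_apply, smul_apply, LinearMap.smul_apply,
    MultilinearMap.domDomCongr_apply]
  rfl

lemma circ_add_left {p q : ℕ} (P P' : PreCochain K V W p) (Q : PreCochain K V V q) :
    circ (P + P') Q = circ P Q + circ P' Q := by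
  refine MultilinearMap.ext fun X => LinearMap.ext fun z => ?_
  simp only [add_apply, LinearMap.add_apply, circ_apply, smul_add,
    Finset.sum_add_distrib]
  abel

lemma circ_smul_left {p q : ℕ} (c : K) (P : PreCochain K V W p) (Q : PreCochain K V V q) :
    circ (c • P) Q = c • circ P Q := by
  refine MultilinearMap.ext fun X => LinearMap.ext fun z => ?_
  simp only [smul_apply, LinearMap.smul_apply, circ_apply, smul_add,
    Finset.smul_sum, smul_comm c]

lemma insertLast_add_right {p q : ℕ} (P : PreCochain K V W p) (Q Q' : PreCochain K V V q) :
    insertLast P (Q + Q') = insertLast P Q + insertLast P Q' := by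
  refine MultilinearMap.ext fun X => LinearMap.ext fun z => ?_
  simp [insertLast]

lemma insertLast_smul_right {p q : ℕ} (c : K) (P : PreCochain K V W p) (Q : PreCochain K V V q) :
    insertLast P (c • Q) = c • insertLast P Q := by
  refine MultilinearMap.ext fun X => LinearMap.ext fun z => ?_
  simp [insertLast]

lemma circ_add_right {p q : ℕ} (P : PreCochain K V W p) (Q Q' : PreCochain K V V q) :
    circ P (Q + Q') = circ P Q + circ P Q' := by
  refine MultilinearMap.ext fun X => LinearMap.ext fun z => ?_
  simp only [circ, insertAt_add_right, insertLast_add_right, add_apply,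
    sum_apply, LinearMap.add_apply,
    LinearMap.sum_apply, smul_apply, LinearMap.smul_apply,
    MultilinearMap.domDomCongr_apply, smul_add, Finset.sum_add_distrib]
  abel

lemma circ_smul_right {p q : ℕ} (c : K) (P : PreCochain K V W p) (Q : PreCochain K V V q) :
    circ P (c • Q) = c • circ P Q := by
  refine MultilinearMap.ext fun X => LinearMap.ext fun z => ?_
  simp only [circ, insertAt_smul_right, insertLast_smul_right, add_apply,
    sum_apply, LinearMap.add_apply,
    LinearMap.sum_apply, smul_apply, LinearMap.smul_apply,
    MultilinearMap.domDomCongr_apply, smul_add, Finset.smul_sum, smul_comm c]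

/-- Cochains are alternating in the last three vectors. -/
lemma cochain_swap {m : ℕ} {P : PreCochain K V W m} (hP : P ∈ cochains K V W m)
    (Y : Fin m → ⋀[K]^2 V) (i : Fin m) (hi : (i : ℕ) + 1 = m) (x y z : V) :
    P (Function.update Y i (wedge x z)) y = - P (Function.update Y i (wedge x y)) z := by
  have h0 : ∀ t, P (Function.update Y i (wedge x t)) t = 0 := fun t =>
    hP _ i x t hi (by simp)
  have h1 := h0 (y + z)
  rw [wedge_add_right, P.map_update_add, map_add, LinearMap.add_apply, LinearMap.add_apply,
    h0, h0, zero_add, add_zero] at h1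
  rw [eq_neg_iff_add_eq_zero]
  exact h1

lemma shuffle_symm_last {p q : ℕ} {σ : Equiv.Perm (Fin (p + q))} (hσ : σ ∈ shuffles (p + q) p q)
    (l : Fin (p + q)) (hl : (l : ℕ) + 1 = p + q) (j : Fin (p + q)) (hj : σ j = l) :
    (j : ℕ) + 1 = p ∨ (p ≤ j ∧ (j : ℕ) + 1 = p + q) := by
  simp only [shuffles, Finset.mem_filter, Finset.mem_univ, true_and] at hσ
  obtain ⟨h1, h2, -⟩ := hσ
  by_contra hcon
  have hlt : ∀ i, ¬ (σ j < σ i) := fun i hi => by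
    rw [hj, Fin.lt_def] at hi; omega
  have hj' := j.isLt
  rcases lt_or_ge (j : ℕ) p with hjp | hjp
  · exact hlt ⟨j + 1, by omega⟩ (h1 j _ (by simp [Fin.lt_def]) (by simp only; omega))
  · exact hlt ⟨j + 1, by omega⟩ (h2 j _ hjp (by simp [Fin.lt_def]) (by simp only; omega))

lemma shuffle_term_eq_zero {p q : ℕ} {Q : PreCochain K V V q} (hQ : Q ∈ cochains K V V q)
    {σ : Equiv.Perm (Fin (p + q))} (hσ : σ ∈ shuffles (p + q) p q) (X : Fin (p + q) → ⋀[K]^2 V)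
    (l : Fin (p + q)) (hl : (l : ℕ) + 1 = p + q) (x y : V) (hX : X l = wedge x y)
    (hne : ∀ j : Fin (p + q), (j : ℕ) + 1 = p → σ j ≠ l) :
    Q (fun b => X (σ (Fin.natAdd p b))) y = 0 := by
  obtain ⟨j, hj⟩ := σ.surjective l
  rcases shuffle_symm_last hσ l hl j hj with h | ⟨h, h'⟩
  · exact absurd hj (hne j h)
  · refine hQ _ ⟨j - p, by omega⟩ x y (by simp only; omega) ?_
    have : Fin.natAdd p (⟨j - p, by omega⟩ : Fin q) = j := by ext; simp; omega
    rw [this, hj, hX]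

/-- The cycle `m ↦ m + 1 ↦ ⋯ ↦ m + q ↦ m`. -/
lemma cycle_val {m q : ℕ} (i : Fin (m + 1 + q)) :
    (Fin.cycleIcc (⟨m, by omega⟩ : Fin (m + 1 + q)) ⟨m + q, by omega⟩ i : ℕ) =
      if (i : ℕ) < m then (i : ℕ) else if (i : ℕ) = m + q then m else (i : ℕ) + 1 := by
  have : NeZero (m + 1 + q) := ⟨by omega⟩
  obtain ⟨i, hi⟩ := i
  split_ifs with h1 h2
  · rw [Fin.cycleIcc_of_lt (by simpa [Fin.lt_def] using h1)]
  · simp only at h2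
    subst h2
    rw [Fin.cycleIcc_of_last (by simp [Fin.le_def])]
  · simp only at h1 h2
    rw [Fin.cycleIcc_of_ge_of_lt (by simp only [Fin.le_def]; omega)
      (by simp only [Fin.lt_def]; omega)]
    rw [Fin.val_add, Fin.val_one', Nat.add_mod_mod, Nat.mod_eq_of_lt (by simp only; omega)]

lemma shuffles_cycle {m q : ℕ} (σ : Equiv.Perm (Fin (m + 1 + q))) :
    (σ * Fin.cycleIcc (⟨m, by omega⟩ : Fin (m + 1 + q)) ⟨m + q, by omega⟩ ∈
        shuffles (m + 1 + q) m q) ↔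
      σ ∈ shuffles (m + 1 + q) (m + 1) q ∧ σ ⟨m, by omega⟩ = ⟨m + q, by omega⟩ := by
  set e := Fin.cycleIcc (⟨m, by omega⟩ : Fin (m + 1 + q)) ⟨m + q, by omega⟩ with he
  have hv : ∀ i, (e i : ℕ) = _ := fun i => cycle_val i
  have e1 : ∀ i : Fin (m + 1 + q), (i : ℕ) < m → e i = i := fun i h => by
    ext; rw [hv, if_pos h]
  have e2 : ∀ (i : ℕ) (h : i < m + q), m ≤ i → e ⟨i, by omega⟩ = ⟨i + 1, by omega⟩ :=
    fun i h h' => by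
      ext; rw [hv, if_neg (by simp only; omega), if_neg (by simp only; omega)]
  have e3 : e ⟨m + q, by omega⟩ = ⟨m, by omega⟩ := by
    ext; rw [hv, if_neg (by simp only; omega), if_pos rfl]
  simp only [shuffles, Finset.mem_filter, Finset.mem_univ, true_and, Equiv.Perm.mul_apply]
  constructor
  · rintro ⟨h1, h2, h3⟩
    have h4 : σ ⟨m, by omega⟩ = ⟨m + q, by omega⟩ := by
      have := h3 ⟨m + q, by omega⟩ le_rfl
      rwa [e3] at this
    refine ⟨⟨fun i j hij hj => ?_, fun i j hi hij hj => ?_, fun i hi => by omega⟩, h4⟩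
    · rcases Nat.lt_succ_iff_lt_or_eq.mp hj with hj | hj
      · have := h1 i j hij hj
        rwa [e1 i (lt_trans hij hj), e1 j hj] at this
      · have hjm : j = ⟨m, by omega⟩ := Fin.ext hj
        rw [hjm] at hij ⊢
        rw [h4, Fin.lt_def]
        have hne : σ i ≠ ⟨m + q, by omega⟩ := by
          rw [← h4]; exact fun h => absurd (σ.injective h) (ne_of_lt hij)
        have := (σ i).isLt
        have h5 : (σ i : ℕ) ≠ m + q := fun h => hne (Fin.ext h)
        simp only; omega
    · obtain ⟨i, hi'⟩ := i
      obtain ⟨j, hj'⟩ := j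
      simp only [Fin.mk_lt_mk] at hi hij hj
      have := h2 ⟨i - 1, by omega⟩ ⟨j - 1, by omega⟩ (by simp only; omega)
        (by simp only [Fin.mk_lt_mk]; omega) (by simp only; omega)
      rw [e2 _ (by omega) (by omega), e2 _ (by omega) (by omega)] at this
      convert this using 3 <;> omega
  · rintro ⟨⟨h1, h2, -⟩, h4⟩
    refine ⟨fun i j hij hj => ?_, fun i j hi hij hj => ?_, fun i hi => ?_⟩
    · rw [e1 i (lt_trans hij hj), e1 j hj]
      exact h1 i j hij (by omega)
    · obtain ⟨i, hi'⟩ := i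
      obtain ⟨j, hj'⟩ := j
      simp only [Fin.mk_lt_mk] at hi hij hj
      rw [e2 _ (by omega) (by omega), e2 _ (by omega) (by omega)]
      exact h2 _ _ (by simp only; omega) (by simp only [Fin.mk_lt_mk]; omega)
        (by simp only; omega)
    · have him : i = ⟨m + q, by omega⟩ := Fin.ext (by have := i.isLt; simp only; omega)
      rw [him, e3, h4]

/-- The circle product of cochains is a cochain. -/
lemma circ_mem {p q : ℕ} {P : PreCochain K V W p} {Q : PreCochain K V V q}
    (hP : P ∈ cochains K V W p) (hQ : Q ∈ cochains K V V q) :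
    circ P Q ∈ cochains K V W (p + q) := by
  intro X l x y hl hX
  rw [circ_apply]
  obtain _ | m := p
  · simp only [Finset.univ_eq_empty, Finset.sum_empty, zero_add]
    refine Finset.sum_eq_zero fun σ hσ => ?_
    rw [shuffle_term_eq_zero hQ hσ X l hl x y hX (fun j hj => by omega)]
    simp
  · have hlm : l = ⟨m + q, by omega⟩ := Fin.ext (by simp only; omega)
    rw [hlm] at hX
    set e := Fin.cycleIcc (⟨m, by omega⟩ : Fin (m + 1 + q)) ⟨m + q, by omega⟩ with he
    have hv : ∀ i, (e i : ℕ) = _ := fun i => cycle_val i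
    have hsign : Equiv.Perm.sign e = (-1) ^ q := by
      rw [he, Fin.sign_cycleIcc_of_le (by simp [Fin.le_def])]
      simp
    rw [Fin.sum_univ_castSucc, Finset.sum_eq_zero, zero_add]
    · rw [← Finset.sum_filter_of_ne (s := shuffles (m + 1 + q) (m + 1) q)
        (p := fun σ => σ ⟨m, by omega⟩ = ⟨m + q, by omega⟩), Finset.smul_sum,
        ← eq_neg_iff_add_eq_zero, ← Finset.sum_neg_distrib]
      · refine Finset.sum_nbij' (fun τ => τ * e⁻¹) (fun σ => σ * e) ?_ ?_ ?_ ?_ ?_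
        · intro τ hτ
          rw [Finset.mem_filter]
          refine (shuffles_cycle (τ * e⁻¹)).mp ?_
          rw [← he, inv_mul_cancel_right]
          exact hτ
        · intro σ hσ
          rw [Finset.mem_filter] at hσ
          exact (shuffles_cycle σ).mpr hσ
        · intro τ _; simp
        · intro σ _; simp
        · intro τ hτ
          obtain ⟨σ, rfl⟩ : ∃ σ, τ = σ * e := ⟨τ * e⁻¹, by simp⟩
          obtain ⟨-, hσm⟩ := (shuffles_cycle σ).mp hτ
          simp only [mul_inv_cancel_right]
          have e1 : ∀ i : Fin (m + 1 + q), (i : ℕ) < m → e i = i := fun i h => by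
            ext; rw [hv, if_pos h]
          have e2 : ∀ (i : ℕ) (h : i < m + q), m ≤ i → e ⟨i, by omega⟩ = ⟨i + 1, by omega⟩ :=
            fun i h h' => by
              ext; rw [hv, if_neg (by simp only; omega), if_neg (by simp only; omega)]
          have e3 : e ⟨m + q, by omega⟩ = ⟨m, by omega⟩ := by
            ext; rw [hv, if_neg (by simp only; omega), if_pos rfl]
          set Y : Fin (m + 1) → ⋀[K]^2 V := fun a => X (σ (Fin.castAdd q a)) with hY
          set f : V →ₗ[K] V := Q (fun b => X (σ (Fin.natAdd (m + 1) b))) with hf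
          have hYl : Y (Fin.last m) = wedge x y := by
            rw [hY, ← hX, ← hσm]; rfl
          have hargs : insertArgs Q (Fin.last m) (fun i => X ((σ * e) i)) =
              Function.update Y (Fin.last m) (derivExt f (wedge x y)) := by
            funext a
            rcases eq_or_ne a (Fin.last m) with rfl | ha
            · have hQf : (Q fun b => X ((σ * e) ⟨(Fin.last m : ℕ) + b, by
                  simp only [Fin.val_last]; omega⟩)) = f := by
                rw [hf]
                congr 1
                funext b
                rw [Equiv.Perm.mul_apply, e2 _ (by simp) (by simp)]
                congr 2
                ext; simp; omega
              simp only [insertArgs, lt_irrefl, if_false, if_true, Function.update_self]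
              rw [hQf]
              congr 1
              rw [Equiv.Perm.mul_apply]
              simp only [Fin.val_last]
              rw [e3, hσm, hX]
            · have ha' : a < Fin.last m := lt_of_le_of_ne (Fin.le_last a) ha
              simp only [insertArgs, if_pos ha', Function.update_of_ne ha, hY,
                Equiv.Perm.mul_apply]
              rw [e1 _ (by simpa [Fin.lt_def] using ha')]
              rfl
          have hval : P (insertArgs Q (Fin.last m) (fun i => X ((σ * e) i))) y = - P Y (f y) := by
            rw [hargs, derivExt_wedge, P.map_update_add, LinearMap.add_apply,
              hP _ (Fin.last m) (f x) y (by simp) (by simp), zero_add,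
              cochain_swap hP Y (Fin.last m) (by simp), ← hYl, Function.update_eq_self]
          rw [hval, map_mul, hsign, smul_neg, smul_neg, smul_smul, smul_smul]
          congr 2
          rw [Fin.val_last, mul_comm (Equiv.Perm.sign σ), ← mul_assoc, ← pow_add]
          congr 2
          ring
      · intro σ hσ
        contrapose!
        intro hne
        rw [shuffle_term_eq_zero hQ hσ X ⟨m + q, by omega⟩ (by simp only; omega) x y hX]
        · simp
        · intro j hj
          have hjm : j = ⟨m, by omega⟩ := Fin.ext (by simp only; omega)
          rw [hjm]
          exact hne
    · intro k _
      rw [Finset.sum_eq_zero, smul_zero]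
      intro σ hσ
      simp only [shuffles, Finset.mem_filter, Finset.mem_univ, true_and] at hσ
      rw [hP _ (Fin.last m) x y (by simp), smul_zero]
      have hk := k.isLt
      have h1 : ¬ (Fin.last m < k.castSucc) := by simp [Fin.lt_def]
      have h2 : Fin.last m ≠ k.castSucc := by simp [Fin.ext_iff]; omega
      simp only [insertArgs, if_neg h1, if_neg h2, Fin.val_last]
      rw [hσ.2.2 _ (by simp), hX]

variable (K V W) in
/-- The vector space `Cⁿ(V, W)`. -/
def Cochain (n : ℕ) : Type _ := cochains K V W n

instance (n : ℕ) : AddCommGroup (Cochain K V W n) :=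
  inferInstanceAs (AddCommGroup (cochains K V W n))

instance (n : ℕ) : Module K (Cochain K V W n) :=
  inferInstanceAs (Module K (cochains K V W n))

/-- The circle product as a bilinear map `Cᵖ(V, V) × C^q(V, V) → Cᵖ⁺^q(V, V)`. -/
def circC (p q : ℕ) : Cochain K V V p →ₗ[K] Cochain K V V q →ₗ[K] Cochain K V V (p + q) :=
  LinearMap.mk₂ K (fun P Q => ⟨circ P.1 Q.1, circ_mem P.2 Q.2⟩)
    (fun P P' Q => Subtype.ext (circ_add_left P.1 P'.1 Q.1))
    (fun c P Q => Subtype.ext (circ_smul_left c P.1 Q.1))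
    (fun P Q Q' => Subtype.ext (circ_add_right P.1 Q.1 Q'.1))
    (fun c P Q => Subtype.ext (circ_smul_right c P.1 Q.1))

variable (K V W) in
/-- The graded vector space `C^*(V, W) = ⨁ₙ Cⁿ(V, W)`. -/
abbrev CochainSpace : Type _ := ⨁ n : ℕ, Cochain K V W n

/-- The graded commutator `[P, Q] = P ∘ Q - (-1)^{pq} Q ∘ P` for `P ∈ Cᵖ(V, V)`, `Q ∈ C^q(V, V)`. -/
def bracketC (p q : ℕ) : Cochain K V V p →ₗ[K] Cochain K V V q →ₗ[K] CochainSpace K V V :=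
  (circC p q).compr₂ (DirectSum.lof K ℕ (Cochain K V V) (p + q))
    - (-1 : K) ^ (p * q) • ((circC q p).compr₂ (DirectSum.lof K ℕ (Cochain K V V) (q + p))).flip

variable (K V) in
/-- The graded Lie bracket on `C^*(V, V)`. -/
def lieBracket : CochainSpace K V V →ₗ[K] CochainSpace K V V →ₗ[K] CochainSpace K V V :=
  DirectSum.toModule K ℕ _ fun p =>
    (DirectSum.toModule K ℕ _ fun q => (bracketC (K := K) (V := V) p q).flip).flip

/-- For `f : ∧³ V → W` the map `(x ∧ y, z) ↦ f(x, y, z)`. -/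
def curryAlt (f : V [⋀^Fin 3]→ₗ[K] W) : ⋀[K]^2 V →ₗ[K] V →ₗ[K] W :=
  exteriorPower.alternatingMapLinearEquiv
    { toFun := fun v =>
        { toFun := fun z => f ![v 0, v 1, z]
          map_add' := fun z z' => by
            have hu : ∀ t, Function.update ![v 0, v 1, z] 2 t = ![v 0, v 1, t] := fun t => by
              ext i; fin_cases i <;> rfl
            have := f.map_update_add ![v 0, v 1, z] 2 z z'
            rwa [hu, hu, hu] at this
          map_smul' := fun c z => by
            have hu : ∀ t, Function.update ![v 0, v 1, z] 2 t = ![v 0, v 1, t] := fun t => by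
              ext i; fin_cases i <;> rfl
            have := f.map_update_smul ![v 0, v 1, z] 2 c z
            rwa [hu, hu] at this }
      map_update_add' := by
        intro inst v i x y
        obtain rfl : inst = instDecidableEqFin 2 := Subsingleton.elim _ _
        ext z
        have hu : ∀ t, ![Function.update v i t 0, Function.update v i t 1, z] =
            Function.update ![v 0, v 1, z] i.castSucc t := fun t => by
          ext j; fin_cases i <;> fin_cases j <;> rfl
        simp only [LinearMap.coe_mk, AddHom.coe_mk, LinearMap.add_apply, hu, f.map_update_add]
      map_update_smul' := by
        intro inst v i c x
        obtain rfl : inst = instDecidableEqFin 2 := Subsingleton.elim _ _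
        ext z
        have hu : ∀ t, ![Function.update v i t 0, Function.update v i t 1, z] =
            Function.update ![v 0, v 1, z] i.castSucc t := fun t => by
          ext j; fin_cases i <;> fin_cases j <;> rfl
        simp only [LinearMap.coe_mk, AddHom.coe_mk, LinearMap.smul_apply, hu, f.map_update_smul]
      map_eq_zero_of_eq' := by
        intro v i j hv hij
        ext z
        exact f.map_eq_zero_of_eq ![v 0, v 1, z] (i := 0) (j := 1)
          (by fin_cases i <;> fin_cases j <;> simp_all) (by decide) }

lemma curryAlt_wedge (f : V [⋀^Fin 3]→ₗ[K] W) (x y z : V) :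
    curryAlt f (wedge x y) z = f ![x, y, z] := by
  simp only [curryAlt, wedge, exteriorPower.alternatingMapLinearEquiv_apply_ιMulti]
  rfl

/-- A map `f : ∧³ V → W` as an element of `C¹(V, W)`. -/
def ofAlternating (f : V [⋀^Fin 3]→ₗ[K] W) : Cochain K V W 1 :=
  ⟨LinearMap.compMultilinearMap (curryAlt f)
      (MultilinearMap.ofSubsingleton K (⋀[K]^2 V) (⋀[K]^2 V) (0 : Fin 1) LinearMap.id), by
    intro X i x y _ hX
    obtain rfl : i = 0 := Subsingleton.elim _ _
    show curryAlt f (X 0) y = 0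
    rw [hX, curryAlt_wedge]
    exact f.map_eq_zero_of_eq ![x, y, y] (i := 1) (j := 2) rfl (by decide)⟩

/-- A linear map `T : V → W` as an element of `C⁰(V, W)`. -/
def ofLinear (T : V →ₗ[K] W) : Cochain K V W 0 :=
  ⟨MultilinearMap.constOfIsEmpty K (fun _ : Fin 0 => ⋀[K]^2 V) T, fun _ i => i.elim0⟩

/-- Pullback along `j : V' → V` and pushforward along `r : W → W'`:
`f ↦ r ∘ f ∘ (j, …, j)`. -/
def transport {V' W' : Type*} [AddCommGroup V'] [Module K V'] [AddCommGroup W'] [Module K W']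
    (j : V' →ₗ[K] V) (r : W →ₗ[K] W') (n : ℕ) : Cochain K V W n →ₗ[K] Cochain K V' W' n where
  toFun f := ⟨((LinearMap.lcomp K W' j) ∘ₗ (LinearMap.llcomp K V W W' r)).compMultilinearMap
      (f.1.compLinearMap fun _ => exteriorPower.map 2 j), by
    intro X i x y hi hX
    have h0 := f.2 (fun a => exteriorPower.map 2 j (X a)) i (j x) (j y) hi (by
      rw [hX, wedge, exteriorPower.map_apply_ιMulti, wedge]
      congr 1
      ext a; fin_cases a <;> rfl)
    show r (f.1 (fun a => exteriorPower.map 2 j (X a)) (j y)) = 0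
    rw [h0, map_zero]⟩
  map_add' f f' := Subtype.ext (MultilinearMap.ext fun X => LinearMap.ext fun z =>
    map_add r (f.1 (fun a => exteriorPower.map 2 j (X a)) (j z))
      (f'.1 (fun a => exteriorPower.map 2 j (X a)) (j z)))
  map_smul' c f := Subtype.ext (MultilinearMap.ext fun X => LinearMap.ext fun z =>
    map_smul r c (f.1 (fun a => exteriorPower.map 2 j (X a)) (j z)))

end Cochains

section Voronov

variable (K g h) in
/-- The inclusion of `F = C^*(h, g)` into `L = C^*(g ⊕ h, g ⊕ h)`: a cochain on `h` is extended by
zero on `g`. -/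
def inclF : CochainSpace K h g →ₗ[K] CochainSpace K (g × h) (g × h) :=
  DirectSum.lmap fun n => transport (LinearMap.snd K g h) (LinearMap.inl K g h) n

variable (K g h) in
/-- The projection of `L = C^*(g ⊕ h, g ⊕ h)` onto `F = C^*(h, g)`: restrict the arguments to `h`
and take the `g`-component of the value. -/
def projF : CochainSpace K (g × h) (g × h) →ₗ[K] CochainSpace K h g :=
  DirectSum.lmap fun n => transport (LinearMap.inr K g h) (LinearMap.fst K g h) n

section

variable {V W : Type*} [AddCommGroup V] [Module K V] [AddCommGroup W] [Module K W]

lemma alt₂_swap (f : V [⋀^Fin 2]→ₗ[K] W) (x y : V) : f ![x, y] = - f ![y, x] := by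
  have := f.map_swap ![y, x] (i := 0) (j := 1) (by decide)
  rw [← this]
  congr 1
  ext i; fin_cases i <;> rfl

lemma alt₂_self (f : V [⋀^Fin 2]→ₗ[K] W) (x : V) : f ![x, x] = 0 :=
  f.map_eq_zero_of_eq ![x, x] (i := 0) (j := 1) rfl (by decide)

lemma alt₂_add_left (f : V [⋀^Fin 2]→ₗ[K] W) (x x' y : V) :
    f ![x + x', y] = f ![x, y] + f ![x', y] := by
  have hu : ∀ z, Function.update ![x, y] 0 z = ![z, y] := fun z => by
    ext i; fin_cases i <;> rfl
  have := f.map_update_add ![x, y] 0 x x'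
  rwa [hu, hu, hu] at this

lemma alt₂_smul_left (f : V [⋀^Fin 2]→ₗ[K] W) (c : K) (x y : V) :
    f ![c • x, y] = c • f ![x, y] := by
  have hu : ∀ z, Function.update ![x, y] 0 z = ![z, y] := fun z => by
    ext i; fin_cases i <;> rfl
  have := f.map_update_smul ![x, y] 0 c x
  rwa [hu, hu] at this

lemma alt₂_add_right (f : V [⋀^Fin 2]→ₗ[K] W) (x y y' : V) :
    f ![x, y + y'] = f ![x, y] + f ![x, y'] := by
  rw [alt₂_swap, alt₂_add_left, alt₂_swap f y, alt₂_swap f y']; abel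

lemma alt₂_smul_right (f : V [⋀^Fin 2]→ₗ[K] W) (c : K) (x y : V) :
    f ![x, c • y] = c • f ![x, y] := by
  rw [alt₂_swap, alt₂_smul_left, alt₂_swap f y, smul_neg, neg_neg]

lemma alt₃_update (a : Fin 3 → g × h) (i : Fin 3) (t : g × h) :
    ![(Function.update a i t 0).1, (Function.update a i t 1).1, (Function.update a i t 2).1] =
        Function.update ![(a 0).1, (a 1).1, (a 2).1] i t.1 ∧
    ![(Function.update a i t 0).2, (Function.update a i t 1).2, (Function.update a i t 2).2] =
        Function.update ![(a 0).2, (a 1).2, (a 2).2] i t.2 := by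
  constructor <;> (ext j; fin_cases i <;> fin_cases j <;> rfl)

end

/-- The semidirect product bracket `π + ρ + λ μ` on `g ⊕ h`:
`(x + u, y + v, z + w) ↦ [x, y, z] + ρ(x, y) w + ρ(y, z) u + ρ(z, x) v + λ [u, v, w]`. -/
def semidirect (π : Bracket K g) (μ : Bracket K h) (ρ : g [⋀^Fin 2]→ₗ[K] Module.End K h)
    (lam : K) : (g × h) [⋀^Fin 3]→ₗ[K] (g × h) where
  toFun a :=
    (π.br ![(a 0).1, (a 1).1, (a 2).1],
      ρ ![(a 0).1, (a 1).1] (a 2).2 + ρ ![(a 1).1, (a 2).1] (a 0).2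
        + ρ ![(a 2).1, (a 0).1] (a 1).2 + lam • μ.br ![(a 0).2, (a 1).2, (a 2).2])
  map_update_add' := by
    intro inst a i s t
    obtain rfl : inst = instDecidableEqFin 3 := Subsingleton.elim _ _
    simp only [(alt₃_update a i _).1, (alt₃_update a i _).2, Prod.fst_add, Prod.snd_add,
      AlternatingMap.map_update_add, Prod.mk_add_mk, smul_add]
    congr 1
    fin_cases i <;>
      simp [alt₂_add_left, alt₂_add_right] <;> abel
  map_update_smul' := by
    intro inst a i c t
    obtain rfl : inst = instDecidableEqFin 3 := Subsingleton.elim _ _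
    simp only [(alt₃_update a i _).1, (alt₃_update a i _).2, Prod.smul_fst, Prod.smul_snd,
      AlternatingMap.map_update_smul, Prod.smul_mk, smul_add, smul_comm c lam]
    congr 1
    fin_cases i <;>
      simp [alt₂_smul_left, alt₂_smul_right]
  map_eq_zero_of_eq' := by
    intro a i j hij hne
    have h1 : π.br ![(a 0).1, (a 1).1, (a 2).1] = 0 :=
      π.br.map_eq_zero_of_eq _ (i := i) (j := j)
        (by fin_cases i <;> fin_cases j <;> simp_all) hne
    have h2 : μ.br ![(a 0).2, (a 1).2, (a 2).2] = 0 :=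
      μ.br.map_eq_zero_of_eq _ (i := i) (j := j)
        (by fin_cases i <;> fin_cases j <;> simp_all) hne
    have h3 : ρ ![(a 0).1, (a 1).1] (a 2).2 + ρ ![(a 1).1, (a 2).1] (a 0).2
        + ρ ![(a 2).1, (a 0).1] (a 1).2 = 0 := by
      have h01 : a 0 = a 1 ∨ a 0 = a 2 ∨ a 1 = a 2 := by
        fin_cases i <;> fin_cases j <;> simp_all
      rcases h01 with h | h | h
      · rw [h, alt₂_self, alt₂_swap ρ (a 2).1]; simp
      · rw [h, alt₂_self, alt₂_swap ρ (a 2).1]; simp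
      · rw [h, alt₂_self, alt₂_swap ρ (a 2).1]; simp
    rw [h1, h2, h3]
    simp

/-- The iterated brackets `[⋯[[Δ, a₁], a₂], ⋯, aₖ]` for `a₁, …, aₖ ∈ F`. -/
def iteratedBracket (Δ : CochainSpace K (g × h) (g × h)) :
    ∀ k : ℕ, MultilinearMap K (fun _ : Fin k => CochainSpace K h g) (CochainSpace K (g × h) (g × h))
  | 0 => MultilinearMap.constOfIsEmpty K _ Δ
  | k + 1 => MultilinearMap.uncurryRight
      (((lieBracket K (g × h)).compl₂ (inclF K g h)).compMultilinearMap (iteratedBracket Δ k))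

/-- The higher derived brackets `lₖ(a₁, …, aₖ) = 𝒫[⋯[[Δ, a₁], a₂], ⋯, aₖ]` on `F = C^*(h, g)`, with
`Δ = π + ρ + λ μ`. -/
def derivedBracket (π : Bracket K g) (μ : Bracket K h) (ρ : g [⋀^Fin 2]→ₗ[K] Module.End K h)
    (lam : K) (k : ℕ) : MultilinearMap K (fun _ : Fin k => CochainSpace K h g) (CochainSpace K h g) :=
  (projF K g h).compMultilinearMap (iteratedBracket
    (DirectSum.lof K ℕ (Cochain K (g × h) (g × h)) 1 (ofAlternating (semidirect π μ ρ lam))) k)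

end Voronov

section LInfinity

variable {E : Type*} [AddCommGroup E] [Module K E]

/-- The Koszul sign `ε(σ)` of a permutation of homogeneous elements of degrees `d₁, …, dₙ`, so that
`x₁ ⋯ xₙ = ε(σ) x_σ(1) ⋯ x_σ(n)` in the free graded commutative algebra: each inversion `i < j`,
`σ(j) < σ(i)` contributes the sign `(-1)^{d_σ(i) d_σ(j)}`. -/
def koszulSign {n : ℕ} (d : Fin n → ℤ) (σ : Equiv.Perm (Fin n)) : ℤˣ :=
  ∏ i : Fin n, ∏ j : Fin n,
    if i < j ∧ σ j < σ i then Int.negOnePow (d (σ i) * d (σ j)) else 1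

/-- The `(i, n - i)`-unshuffles. -/
def unshuffles (n i : ℕ) : Finset (Equiv.Perm (Fin n)) :=
  {σ | (∀ a b : Fin n, a < b → (b : ℕ) < i → σ a < σ b) ∧
    (∀ a b : Fin n, i ≤ (a : ℕ) → a < b → σ a < σ b)}

/-- An `L_∞`-algebra: a `ℤ`-graded vector space `E = ⨁_d 𝒢 d` with graded symmetric multilinear maps
`l k`, `k ≥ 1`, of degree `1` that satisfy the generalized Jacobi identities. The value of the
family `l` at `k = 0` is irrelevant. -/
structure IsLInfinityAlgebra (𝒢 : ℤ → Submodule K E)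
    (l : ∀ k : ℕ, MultilinearMap K (fun _ : Fin k => E) E) : Prop where
  isInternal : DirectSum.IsInternal 𝒢
  degree_one : ∀ (k : ℕ), 1 ≤ k → ∀ (d : Fin k → ℤ) (x : Fin k → E), (∀ i, x i ∈ 𝒢 (d i)) →
    l k x ∈ 𝒢 ((∑ i, d i) + 1)
  graded_symm : ∀ (k : ℕ), 1 ≤ k → ∀ (d : Fin k → ℤ) (x : Fin k → E), (∀ i, x i ∈ 𝒢 (d i)) →
    ∀ σ : Equiv.Perm (Fin k), l k (fun i => x (σ i)) = koszulSign d σ • l k x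
  generalized_jacobi : ∀ (n : ℕ), 1 ≤ n → ∀ (d : Fin n → ℤ) (x : Fin n → E),
    (∀ i, x i ∈ 𝒢 (d i)) →
    ∑ i : Fin n, ∑ σ ∈ unshuffles n (i + 1), koszulSign d σ •
      l (n - (i + 1) + 1) (Fin.cons
        (l (i + 1) fun a => x (σ ⟨a, by omega⟩))
        (fun b : Fin (n - (i + 1)) => x (σ ⟨(i + 1) + b, by omega⟩))) = 0

/-- Maurer-Cartan elements: `α ∈ 𝒢 0` with `∑_{k ≥ 1} (1 / k!) lₖ(α, …, α) = 0`, where only finitely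
many terms of the sum are allowed to be nonzero. -/
def IsMaurerCartan (𝒢 : ℤ → Submodule K E)
    (l : ∀ k : ℕ, MultilinearMap K (fun _ : Fin k => E) E) (α : E) : Prop :=
  α ∈ 𝒢 0 ∧
    (Function.support fun n : ℕ => ((n + 1).factorial : K)⁻¹ • l (n + 1) fun _ => α).Finite ∧
    ∑ᶠ n : ℕ, ((n + 1).factorial : K)⁻¹ • l (n + 1) (fun _ => α) = 0

end LInfinity

variable (K g h) in
/-- The `ℤ`-grading of `C^*(h, g) = ⨁_{n ≥ 0} Cⁿ(h, g)`, which is zero in negative degrees. -/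
def gradingF : ℤ → Submodule K (CochainSpace K h g)
  | Int.ofNat n => LinearMap.range (DirectSum.lof K ℕ (Cochain K h g) n)
  | Int.negSucc _ => ⊥

end ThreeLie

end

/-! The theorem is an instance of Voronov's higher derived brackets. The data are the graded Lie
algebra L = C^*(g ⊕ h, g ⊕ h), its abelian subalgebra F = C^*(h, g), the projection 𝒫 : L → F, whose
kernel is a subalgebra, and an element Δ ∈ ker 𝒫 of degree 1 with [Δ, Δ] = 0.

L is a graded Lie algebra because the circle product is graded right pre-Lie: its associator is
graded symmetric in the last two arguments (`assocT_comm`). Instead of composing shuffles, the proof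
inserts a bivector x into the first slot, an operation i_x. Pascal's rule for shuffles gives i_x(P ∘
Q) = (-1)^q (i_x P) ∘ Q + P ∘ (i_x Q) if Q has degree q ≥ 1, and i_x(P ∘ T) = (i_x P) ∘ T + i_{T ⋆
x} P if T has degree 0. A cochain of positive degree vanishes once all its contractions do, so
induction on the total degree applies.

The equation [Δ, Δ] = 0 becomes, after two contractions, the fundamental identity of the semidirect
product bracket on g ⊕ h (`lieBracket_self_ofAlternating`, `semidirectBracket`); this is where the
axioms of an action enter.

Voronov's theorem (`IsVData.isLInfinityAlgebra`) comes from bracketing [Δ, Δ] = 0 with x₁, …, xₙ ∈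
F, expanding by the Leibniz rule and applying 𝒫[a, b] = 𝒫[𝒫a, b] + 𝒫[a, 𝒫b]. The two resulting sums
agree after the two blocks of each splitting are exchanged, so twice the generalized Jacobi sum is
zero.

For the vanishing of l_k, an automorphism of L scales F by 2, π + ρ by 1/4 and λμ by 1, while 𝒫
takes it to multiplication by 2. A contribution to l_k can survive only if 2^k · 1/4 = 2 or 2^k · 1
= 2. Hence l₃ comes from π + ρ alone and l₁ from λμ alone.

For the Maurer-Cartan equation, let S be the extension of T to g ⊕ h. Since S² = 0, the sum of the
[⋯[Δ, S], ⋯, S] / k! is the conjugate (1 - S) Δ ((1 + S)·, (1 + S)·, (1 + S)·). The g-component of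
its restriction to h vanishes exactly when the graph of T is closed under the semidirect bracket,
which is the Rota-Baxter identity. -/

noncomputable section

namespace ThreeLie

variable {K : Type*} [Field K]

/-! ### Pascal's rule for shuffles -/

section Shuffles

/-- The permutation of `{0, …, n}` that maps `j` to `0` and agrees with `τ` on the other elements,
after the order preserving identifications with `{0, …, n - 1}`. -/
def insertZero {n : ℕ} (j : Fin (n + 1)) (τ : Equiv.Perm (Fin n)) : Equiv.Perm (Fin (n + 1)) :=
  Equiv.Perm.decomposeFin.symm (0, τ) * Fin.cycleRange j

lemma insertZero_self {n : ℕ} (j : Fin (n + 1)) (τ : Equiv.Perm (Fin n)) :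
    insertZero j τ j = 0 := by
  simp [insertZero]

lemma insertZero_succAbove {n : ℕ} (j : Fin (n + 1)) (τ : Equiv.Perm (Fin n)) (i : Fin n) :
    insertZero j τ (j.succAbove i) = (τ i).succ := by
  simp [insertZero]

lemma sign_insertZero {n : ℕ} (j : Fin (n + 1)) (τ : Equiv.Perm (Fin n)) :
    Equiv.Perm.sign (insertZero j τ) = (-1) ^ (j : ℕ) * Equiv.Perm.sign τ := by
  simp [insertZero, mul_comm]

lemma insertZero_injective {n : ℕ} (j : Fin (n + 1)) : Function.Injective (insertZero j) := by
  intro τ τ' h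
  simpa [insertZero] using h

lemma exists_eq_insertZero {n : ℕ} {j : Fin (n + 1)} {σ : Equiv.Perm (Fin (n + 1))}
    (h : σ j = 0) : ∃ τ, σ = insertZero j τ := by
  obtain ⟨⟨p, τ⟩, hτ⟩ := Equiv.Perm.decomposeFin.symm.surjective (σ * (Fin.cycleRange j)⁻¹)
  have h0 : p = 0 := by
    have := congrArg (fun e : Equiv.Perm (Fin (n + 1)) => e 0) hτ
    simpa [Equiv.Perm.inv_def, h] using this
  subst h0
  exact ⟨τ, by rw [insertZero, hτ, inv_mul_cancel_right]⟩

lemma val_succAbove {n : ℕ} (j : Fin (n + 1)) (i : Fin n) :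
    (j.succAbove i : ℕ) = if (i : ℕ) < j then (i : ℕ) else i + 1 := by
  rw [Fin.succAbove]
  split_ifs with h1 h2 h2 <;> simp_all [Fin.lt_def]

/-- Position 0 is the start of the first block. Putting the smallest value there never disturbs
monotonicity, so the block just gains one entry. -/
lemma insertZero_zero_mem_shuffles {n k q : ℕ} (τ : Equiv.Perm (Fin n)) :
    insertZero 0 τ ∈ shuffles (n + 1) (k + 1) q ↔ τ ∈ shuffles n k q := by
  have e0 := insertZero_self 0 τ
  have e1 : ∀ i : Fin n, insertZero 0 τ i.succ = (τ i).succ := fun i => by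
    simpa using insertZero_succAbove 0 τ i
  simp only [shuffles, Finset.mem_filter, Finset.mem_univ, true_and, Fin.forall_fin_succ, e0, e1,
    Fin.succ_lt_succ_iff, Fin.val_succ, Fin.val_zero, Fin.succ_pos, Fin.succ_inj,
    Fin.not_lt_zero, false_imp_iff, imp_true_iff, forall_const]
  constructor
  · rintro ⟨h1, h2, h3⟩
    exact ⟨fun i j hij hj => h1 i j hij (by omega),
      fun i j hi hij hj => h2 i j (by omega) hij (by omega), fun i hi => h3 i (by omega)⟩
  · rintro ⟨h1, h2, h3⟩
    exact ⟨fun i j hij hj => h1 i j hij (by omega),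
      fun i j hi hij hj => h2 i j (by omega) hij (by omega), fun i hi => h3 i (by omega)⟩

/-- The counterpart for position k, where the second block starts. -/
lemma insertZero_mem_shuffles {n k q : ℕ} (hk : k < n + 1) (τ : Equiv.Perm (Fin n)) :
    insertZero ⟨k, hk⟩ τ ∈ shuffles (n + 1) k (q + 1) ↔ τ ∈ shuffles n k q := by
  set j : Fin (n + 1) := ⟨k, hk⟩ with hj
  have e0 := insertZero_self j τ
  have e1 := insertZero_succAbove j τ
  have ev : ∀ i : Fin n, (j.succAbove i : ℕ) = if (i : ℕ) < k then (i : ℕ) else i + 1 :=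
    fun i => val_succAbove j i
  simp only [shuffles, Finset.mem_filter, Finset.mem_univ, true_and]
  constructor
  · rintro ⟨h1, h2, h3⟩
    refine ⟨fun a b hab hb => ?_, fun a b ha hab hb => ?_, fun a ha => ?_⟩
    · have := h1 (j.succAbove a) (j.succAbove b) (by simpa using hab) (by rw [ev]; simp [hb])
      simpa [e1] using this
    · have := h2 (j.succAbove a) (j.succAbove b) (by rw [ev]; split_ifs <;> omega)
        (by simpa using hab) (by rw [ev]; split_ifs <;> omega)
      simpa [e1] using this
    · have h : j.succAbove a = a.succ := by
        ext; rw [ev, if_neg (by omega), Fin.val_succ]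
      have := h3 (j.succAbove a) (by rw [ev]; split_ifs <;> omega)
      rw [e1, h] at this
      exact Fin.succ_injective _ this
  · rintro ⟨h1, h2, h3⟩
    refine ⟨fun a b hab hb => ?_, fun a b ha hab hb => ?_, fun a ha => ?_⟩
    · rcases Fin.eq_self_or_eq_succAbove j a with rfl | ⟨a, rfl⟩
      · simp only [hj, Fin.lt_def] at hab; omega
      rcases Fin.eq_self_or_eq_succAbove j b with rfl | ⟨b, rfl⟩
      · simp [hj] at hb
      rw [e1, e1, Fin.succ_lt_succ_iff]
      refine h1 a b (by simpa using hab) ?_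
      rw [ev] at hb; split_ifs at hb <;> omega
    · rcases Fin.eq_self_or_eq_succAbove j b with rfl | ⟨b, rfl⟩
      · simp only [hj, Fin.lt_def] at hab; omega
      rcases Fin.eq_self_or_eq_succAbove j a with rfl | ⟨a, rfl⟩
      · rw [e0, e1]; exact Fin.succ_pos _
      rw [e1, e1, Fin.succ_lt_succ_iff]
      refine h2 a b ?_ (by simpa using hab) ?_
      · rw [ev] at ha; split_ifs at ha <;> omega
      · rw [ev] at hb; split_ifs at hb <;> omega
    · rcases Fin.eq_self_or_eq_succAbove j a with rfl | ⟨a, rfl⟩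
      · simp only [hj] at ha; omega
      rw [ev] at ha
      have hak : ¬ (a : ℕ) < k := by split_ifs at ha <;> omega
      rw [if_neg hak] at ha
      have h : j.succAbove a = a.succ := by
        ext; rw [ev, if_neg hak, Fin.val_succ]
      rw [e1, h3 a (by omega), h]

/-- Each block is increasing, so the smallest value can only stand at the start of a nonempty block.
Beyond the blocks σ is the identity, and `0 < k + q` keeps the value 0 from occurring there. -/
lemma shuffle_eq_zero_iff {n k q : ℕ} (hkq : 0 < k + q) {σ : Equiv.Perm (Fin (n + 1))}
    (hσ : σ ∈ shuffles (n + 1) k q) {j : Fin (n + 1)} (hj : σ j = 0) :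
    ((j : ℕ) = 0 ∧ 0 < k) ∨ ((j : ℕ) = k ∧ 0 < q) := by
  simp only [shuffles, Finset.mem_filter, Finset.mem_univ, true_and] at hσ
  obtain ⟨h1, h2, h3⟩ := hσ
  have hn : ∀ i : Fin (n + 1), ¬ σ i < σ j := fun i => by rw [hj]; exact Fin.not_lt_zero _
  rcases lt_or_ge (j : ℕ) k with h | h
  · left
    refine ⟨?_, by omega⟩
    by_contra h0
    exact hn _ (h1 ⟨0, by omega⟩ j (by simp only [Fin.lt_def]; omega) h)
  rcases lt_or_ge (j : ℕ) (k + q) with h' | h'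
  · right
    refine ⟨?_, by omega⟩
    by_contra h0
    exact hn _ (h2 ⟨k, by omega⟩ j le_rfl (by simp only [Fin.lt_def]; omega) h')
  · have := h3 j h'
    rw [hj] at this
    have : (j : ℕ) = 0 := by rw [← this]; rfl
    omega

variable {M : Type*} [AddCommMonoid M]

lemma sum_filter_insertZero {n : ℕ} (j : Fin (n + 1)) (S : Finset (Equiv.Perm (Fin (n + 1))))
    (S' : Finset (Equiv.Perm (Fin n))) (h : ∀ τ, insertZero j τ ∈ S ↔ τ ∈ S')
    (f : Equiv.Perm (Fin (n + 1)) → M) :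
    ∑ σ ∈ S with σ j = 0, f σ = ∑ τ ∈ S', f (insertZero j τ) := by
  symm
  refine Finset.sum_bij (fun τ _ => insertZero j τ) ?_ ?_ ?_ ?_
  · intro τ hτ
    rw [Finset.mem_filter]
    exact ⟨(h τ).mpr hτ, insertZero_self j τ⟩
  · intro τ _ τ' _ he
    exact insertZero_injective j he
  · intro σ hσ
    rw [Finset.mem_filter] at hσ
    obtain ⟨τ, rfl⟩ := exists_eq_insertZero hσ.2
    exact ⟨τ, (h τ).mp hσ.1, rfl⟩
  · intro τ _; rfl

/-- Both blocks are nonempty, so the value 0 starts exactly one of them: this is Pascal's rule. The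
cases of an empty block, which follow, have only one summand. -/
lemma sum_shuffles_succ_succ {n k q : ℕ} (hn : k + 1 < n + 1)
    (f : Equiv.Perm (Fin (n + 1)) → M) :
    ∑ σ ∈ shuffles (n + 1) (k + 1) (q + 1), f σ =
      ∑ τ ∈ shuffles n k (q + 1), f (insertZero 0 τ)
        + ∑ τ ∈ shuffles n (k + 1) q, f (insertZero ⟨k + 1, hn⟩ τ) := by
  rw [← sum_filter_insertZero 0 _ _ fun τ => insertZero_zero_mem_shuffles τ,
    ← sum_filter_insertZero ⟨k + 1, hn⟩ _ _ fun τ => insertZero_mem_shuffles hn τ,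
    ← Finset.sum_filter_add_sum_filter_not _ fun σ => σ 0 = 0]
  congr 1
  refine Finset.sum_congr (Finset.filter_congr fun σ hσ => ?_) fun _ _ => rfl
  constructor
  · intro h0
    obtain ⟨j, hj⟩ := σ.surjective 0
    rcases shuffle_eq_zero_iff (by omega) hσ hj with ⟨h, -⟩ | ⟨h, -⟩
    · exact absurd ((congrArg σ (Fin.ext h.symm)).trans hj) h0
    · exact (congrArg σ (Fin.ext h.symm)).trans hj
  · intro h h0
    have := σ.injective (h0.trans h.symm)
    simp [Fin.ext_iff] at this

lemma sum_shuffles_succ_zero {n k : ℕ} (f : Equiv.Perm (Fin (n + 1)) → M) :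
    ∑ σ ∈ shuffles (n + 1) (k + 1) 0, f σ = ∑ τ ∈ shuffles n k 0, f (insertZero 0 τ) := by
  rw [← sum_filter_insertZero 0 _ _ fun τ => insertZero_zero_mem_shuffles τ,
    Finset.filter_true_of_mem]
  intro σ hσ
  obtain ⟨j, hj⟩ := σ.surjective 0
  rcases shuffle_eq_zero_iff (by omega) hσ hj with ⟨h, -⟩ | ⟨h, h'⟩
  · exact (congrArg σ (Fin.ext h.symm)).trans hj
  · omega

lemma sum_shuffles_zero_succ {n q : ℕ} (f : Equiv.Perm (Fin (n + 1)) → M) :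
    ∑ σ ∈ shuffles (n + 1) 0 (q + 1), f σ = ∑ τ ∈ shuffles n 0 q, f (insertZero 0 τ) := by
  rw [← sum_filter_insertZero 0 _ _ fun τ => insertZero_mem_shuffles (k := 0) (by omega) τ,
    Finset.filter_true_of_mem]
  intro σ hσ
  obtain ⟨j, hj⟩ := σ.surjective 0
  rcases shuffle_eq_zero_iff (by omega) hσ hj with ⟨h, h'⟩ | ⟨h, -⟩
  · omega
  · exact (congrArg σ (Fin.ext h.symm)).trans hj

lemma shuffles_zero_zero (n : ℕ) : shuffles n 0 0 = {1} := by
  ext σ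
  simp only [shuffles, Finset.mem_filter, Finset.mem_univ, true_and, Finset.mem_singleton]
  constructor
  · rintro ⟨-, -, h⟩
    exact Equiv.ext fun i => h i (by omega)
  · rintro rfl
    exact ⟨fun i j _ h => by omega, fun i j _ _ h => by omega, fun _ _ => rfl⟩

end Shuffles

/-! ### Signed shuffle sums over infinite sequences -/

section Sequences

variable {α : Type*}

/-- The sequence `X₀, …, Xₖ₋₁, x, Xₖ, Xₖ₊₁, …`. -/
def seqInsert (k : ℕ) (x : α) (X : ℕ → α) : ℕ → α := fun i =>
  if i < k then X i else if i = k then x else X (i - 1)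

/-- The action of a permutation of `{0, …, n - 1}` on sequences. -/
def permSeq {n : ℕ} (σ : Equiv.Perm (Fin n)) (X : ℕ → α) : ℕ → α := fun i =>
  if h : i < n then X (σ ⟨i, h⟩) else X i

lemma permSeq_insertZero {n : ℕ} (j : Fin (n + 1)) (τ : Equiv.Perm (Fin n)) (x : α) (X : ℕ → α) :
    permSeq (insertZero j τ) (seqInsert 0 x X) = seqInsert j x (permSeq τ X) := by
  funext i
  have hjn := j.isLt
  rcases lt_or_ge i (n + 1) with hi | hi
  · rcases Fin.eq_self_or_eq_succAbove j ⟨i, hi⟩ with h | ⟨a, h⟩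
    · have hij : i = j := by rw [← h]
      simp only [permSeq, dif_pos hi, h, insertZero_self]
      simp [seqInsert, hij]
    · have hia : i = (j.succAbove a : ℕ) := by rw [← h]
      simp only [permSeq, dif_pos hi, h, insertZero_succAbove]
      rw [val_succAbove] at hia
      have ha := a.isLt
      split_ifs at hia with h'
      · simp [seqInsert, permSeq, hia, h']
      · have h2 : ¬ ((a : ℕ) + 1 < j) := by omega
        have h3 : ¬ ((a : ℕ) + 1 = j) := by omega
        simp [seqInsert, permSeq, hia, h2, h3]
  · have h1 : ¬ (i < n + 1) := by omega
    have h2 : ¬ (i < j) := by omega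
    have h3 : ¬ (i = j) := by omega
    have h4 : ¬ (i - 1 < n) := by omega
    have h5 : ¬ (i = 0) := by omega
    simp [permSeq, seqInsert, h1, h2, h3, h4, h5]

lemma permSeq_one (n : ℕ) (X : ℕ → α) : permSeq (1 : Equiv.Perm (Fin n)) X = X := by
  funext i; simp [permSeq]

variable {M : Type*} [AddCommGroup M]

/-- The signed sum of `Φ` over the `(k, q)`-shuffles of the first `n` members of a sequence. -/
def shuffleSum (n k q : ℕ) (Φ : (ℕ → α) → M) (X : ℕ → α) : M :=
  ∑ σ ∈ shuffles n k q, Equiv.Perm.sign σ • Φ (permSeq σ X)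

lemma shuffleSum_zero_zero (n : ℕ) (Φ : (ℕ → α) → M) (X : ℕ → α) :
    shuffleSum n 0 0 Φ X = Φ X := by
  simp [shuffleSum, shuffles_zero_zero, permSeq_one]

/-- The sign `(-1) ^ (k + 1)` arises when x is carried past the k + 1 entries of the first block to
the start of the second. -/
lemma shuffleSum_succ_succ {n k q : ℕ} (hn : k + 1 < n + 1) (Φ : (ℕ → α) → M) (x : α)
    (X : ℕ → α) :
    shuffleSum (n + 1) (k + 1) (q + 1) Φ (seqInsert 0 x X) =
      shuffleSum n k (q + 1) (fun Y => Φ (seqInsert 0 x Y)) X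
        + (-1 : ℤˣ) ^ (k + 1) • shuffleSum n (k + 1) q (fun Y => Φ (seqInsert (k + 1) x Y)) X := by
  simp only [shuffleSum, sum_shuffles_succ_succ hn, permSeq_insertZero, sign_insertZero,
    Finset.smul_sum, mul_smul, Fin.val_zero, pow_zero, one_smul]

lemma shuffleSum_succ_zero {n k : ℕ} (Φ : (ℕ → α) → M) (x : α) (X : ℕ → α) :
    shuffleSum (n + 1) (k + 1) 0 Φ (seqInsert 0 x X) =
      shuffleSum n k 0 (fun Y => Φ (seqInsert 0 x Y)) X := by
  simp only [shuffleSum, sum_shuffles_succ_zero, permSeq_insertZero, sign_insertZero,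
    mul_smul, Fin.val_zero, pow_zero, one_smul]

lemma shuffleSum_zero_succ {n q : ℕ} (Φ : (ℕ → α) → M) (x : α) (X : ℕ → α) :
    shuffleSum (n + 1) 0 (q + 1) Φ (seqInsert 0 x X) =
      shuffleSum n 0 q (fun Y => Φ (seqInsert 0 x Y)) X := by
  simp only [shuffleSum, sum_shuffles_zero_succ, permSeq_insertZero, sign_insertZero,
    mul_smul, Fin.val_zero, pow_zero, one_smul]

end Sequences

/-! ### Insertion of a bivector into the first slot of a circle product -/

section Contraction

variable {V W : Type*} [AddCommGroup V] [Module K V] [AddCommGroup W] [Module K W]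

/-- Evaluation of `f ∈ Hom((∧² V)^{⊗ n} ⊗ V, W)` at the first `n` members of a sequence. -/
def evalSeq {n : ℕ} (f : PreCochain K V W n) (X : ℕ → ⋀[K]^2 V) : V →ₗ[K] W :=
  f fun i : Fin n => X i

/-- The version of `insertArgs` for sequences. -/
def seqArgs {q : ℕ} (Q : PreCochain K V V q) (k : ℕ) (X : ℕ → ⋀[K]^2 V) : ℕ → ⋀[K]^2 V := fun a =>
  if a < k then X a
  else if a = k then derivExt (evalSeq Q fun b => X (k + b)) (X (k + q))
  else X (a + q)

/-- Every finite family begins some sequence, so testing on sequences loses nothing. It avoids casts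
between index types such as `Fin (p + (q + 1))` and `Fin (p + q + 1)`. -/
lemma evalSeq_ext {n : ℕ} {f f' : PreCochain K V W n}
    (h : ∀ X z, evalSeq f X z = evalSeq f' X z) : f = f' := by
  refine MultilinearMap.ext fun X => LinearMap.ext fun z => ?_
  have := h (fun i => if h : i < n then X ⟨i, h⟩ else 0) z
  simpa [evalSeq] using this

lemma evalSeq_curryLeft {n : ℕ} (f : PreCochain K V W (n + 1)) (x : ⋀[K]^2 V)
    (X : ℕ → ⋀[K]^2 V) :
    evalSeq (MultilinearMap.curryLeft f x) X = evalSeq f (seqInsert 0 x X) := by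
  simp only [evalSeq, MultilinearMap.curryLeft_apply]
  congr 1
  funext i
  refine Fin.cases ?_ (fun i => ?_) i <;> simp [seqInsert]

lemma evalSeq_seqInsert_self {n : ℕ} (f : PreCochain K V W n) (x : ⋀[K]^2 V)
    (X : ℕ → ⋀[K]^2 V) : evalSeq f (seqInsert n x X) = evalSeq f X := by
  simp only [evalSeq]
  congr 1
  funext i
  simp [seqInsert]

lemma seqInsert_add (k : ℕ) (x : ⋀[K]^2 V) (X : ℕ → ⋀[K]^2 V) :
    (fun b => seqInsert k x X (k + b)) = seqInsert 0 x fun b => X (k + b) := by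
  funext b
  rcases b with _ | b
  · simp [seqInsert]
  · have h1 : ¬ (k + b + 1 < k) := by omega
    have h2 : ¬ (k + b + 1 = k) := by omega
    simp [seqInsert, ← add_assoc, h1, h2]

lemma seqInsert_zero_add (k : ℕ) (x : ⋀[K]^2 V) (X : ℕ → ⋀[K]^2 V) :
    (fun b => seqInsert 0 x X (k + 1 + b)) = fun b => X (k + b) := by
  funext b
  simp only [seqInsert]
  rw [if_neg (by omega), if_neg (by omega)]
  congr 1; omega

lemma seqArgs_succ_seqInsert {q : ℕ} (Q : PreCochain K V V q) (k : ℕ) (x : ⋀[K]^2 V)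
    (X : ℕ → ⋀[K]^2 V) :
    seqArgs Q (k + 1) (seqInsert 0 x X) = seqInsert 0 x (seqArgs Q k X) := by
  funext a
  rcases a with _ | a
  · simp [seqArgs, seqInsert]
  · have h : ∀ b, seqInsert 0 x X (b + 1) = X b := fun b => by simp [seqInsert]
    have h' : ∀ b, seqInsert 0 x (seqArgs Q k X) (b + 1) = seqArgs Q k X b := fun b => by
      simp [seqInsert]
    rw [h', seqArgs, seqArgs, seqInsert_zero_add, show k + 1 + q = k + q + 1 by omega,
      show a + 1 + q = a + q + 1 by omega, h, h, h]
    simp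

/-- The entry in position k is the first argument that Q consumes, so x is absorbed by Q. -/
lemma seqArgs_seqInsert_self {q : ℕ} (Q : PreCochain K V V (q + 1)) (k : ℕ) (x : ⋀[K]^2 V)
    (X : ℕ → ⋀[K]^2 V) :
    seqArgs Q k (seqInsert k x X) = seqArgs (MultilinearMap.curryLeft Q x) k X := by
  funext a
  rw [seqArgs, seqArgs, seqInsert_add, evalSeq_curryLeft]
  have h : ∀ b, k ≤ b → seqInsert k x X (b + 1) = X b := fun b hb => by
    simp only [seqInsert]
    rw [if_neg (by omega), if_neg (by omega)]; rfl
  rw [← add_assoc, ← add_assoc, h _ (by omega)]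
  split_ifs with h1 h2
  · simp [seqInsert, h1]
  · rfl
  · rw [h _ (by omega)]

lemma seqArgs_zero_seqInsert (Q : PreCochain K V V 0) (x : ⋀[K]^2 V) (X : ℕ → ⋀[K]^2 V) :
    seqArgs Q 0 (seqInsert 0 x X) = seqInsert 0 (derivExt (evalSeq Q X) x) X := by
  have : ∀ X', evalSeq Q X' = evalSeq Q X := fun X' => by
    simp only [evalSeq]; congr 1; funext i; exact i.elim0
  funext a
  rw [seqArgs, this]
  rcases a with _ | a <;> simp [seqInsert]

lemma evalSeq_circ {p q : ℕ} (P : PreCochain K V W p) (Q : PreCochain K V V q)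
    (X : ℕ → ⋀[K]^2 V) (z : V) :
    evalSeq (circ P Q) X z =
      (∑ k ∈ Finset.range p, (-1 : ℤˣ) ^ (k * q) •
        shuffleSum (p + q) k q (fun Y => evalSeq P (seqArgs Q k Y) z) X)
      + (-1 : ℤˣ) ^ (p * q) • shuffleSum (p + q) p q
        (fun Y => evalSeq P Y (evalSeq Q (fun b => Y (p + b)) z)) X := by
  rw [evalSeq, circ_apply, Finset.sum_range]
  congr 1
  · refine Finset.sum_congr rfl fun k _ => ?_
    simp only [shuffleSum]
    congr 1
    refine Finset.sum_congr rfl fun σ _ => ?_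
    congr 3
    funext a
    have hk := k.isLt
    have ha := a.isLt
    simp only [insertArgs, seqArgs, evalSeq, permSeq]
    rw [dif_pos (show (k : ℕ) + q < p + q by omega), dif_pos (show (a : ℕ) < p + q by omega)]
    have : ∀ b : Fin q, (k : ℕ) + b < p + q := fun b => by omega
    simp only [this, dif_pos]
    simp only [Fin.lt_def, Fin.ext_iff]
    split_ifs <;> first | rfl | omega
  · simp only [shuffleSum, Finset.smul_sum]
    refine Finset.sum_congr rfl fun σ _ => ?_
    congr 2
    simp only [evalSeq, permSeq]
    congr 2
    · funext a
      rw [dif_pos (show (a : ℕ) < p + q by omega)]; rfl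
    · congr 1
      funext b
      rw [dif_pos (show p + (b : ℕ) < p + q by omega)]; rfl


variable (V W) in
/-- The map `X ↦ f(x, X, -)` from `Cⁿ⁺¹(V, W)` to `Cⁿ(V, W)`. -/
def contractC (x : ⋀[K]^2 V) (n : ℕ) : Cochain K V W (n + 1) →ₗ[K] Cochain K V W n where
  toFun f := ⟨MultilinearMap.curryLeft f.1 x, fun X i u v hi hX =>
    f.2 (Fin.cons x X) i.succ u v (by rw [Fin.val_succ, hi]) (by rw [Fin.cons_succ, hX])⟩
  map_add' _ _ := rfl
  map_smul' _ _ := rfl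

lemma evalSeq_contractC {n : ℕ} (f : Cochain K V W (n + 1)) (x : ⋀[K]^2 V)
    (X : ℕ → ⋀[K]^2 V) :
    evalSeq (contractC V W x n f).1 X = evalSeq f.1 (seqInsert 0 x X) :=
  evalSeq_curryLeft f.1 x X

variable (V W) in
/-- Insertion of `x` as the first argument; it is zero on `C⁰(V, W)`. -/
def contract (x : ⋀[K]^2 V) : CochainSpace K V W →ₗ[K] CochainSpace K V W :=
  DirectSum.toModule K ℕ _ fun
    | 0 => 0
    | n + 1 => DirectSum.lof K ℕ (Cochain K V W) n ∘ₗ contractC V W x n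

lemma contract_lof_zero (x : ⋀[K]^2 V) (f : Cochain K V W 0) :
    contract V W x (DirectSum.lof K ℕ _ 0 f) = 0 := by
  rw [contract, DirectSum.toModule_lof]; rfl

lemma contract_lof_succ (x : ⋀[K]^2 V) {n : ℕ} (f : Cochain K V W (n + 1)) :
    contract V W x (DirectSum.lof K ℕ _ (n + 1) f) =
      DirectSum.lof K ℕ _ n (contractC V W x n f) := by
  rw [contract, DirectSum.toModule_lof]; rfl

lemma contract_add (x y : ⋀[K]^2 V) :
    contract V W (x + y) = contract V W x + contract V W y := by
  refine DirectSum.linearMap_ext K fun n => LinearMap.ext fun f => ?_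
  simp only [LinearMap.comp_apply, LinearMap.add_apply]
  rcases n with _ | n
  · simp only [contract_lof_zero, add_zero]
  · simp only [contract_lof_succ, ← map_add]
    congr 1
    exact Subtype.ext (map_add (MultilinearMap.curryLeft f.1) x y)

/-- This is what permits induction on the degree: a cochain of positive degree is determined by its
contractions. -/
lemma lof_eq_zero_of_contract {n : ℕ} (f : Cochain K V W (n + 1))
    (h : ∀ x, contract V W x (DirectSum.lof K ℕ _ (n + 1) f) = 0) : f = 0 := by
  refine Subtype.ext (MultilinearMap.ext fun X => ?_)
  have := h (X 0)
  rw [contract_lof_succ] at this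
  have h1 := DirectSum.of_injective (β := Cochain K V W) n (this.trans (map_zero _).symm)
  have h2 := congrArg (fun t : Cochain K V W n => t.1 (Fin.tail X)) h1
  have h3 : MultilinearMap.curryLeft f.1 (X 0) (Fin.tail X) = 0 := h2
  rwa [MultilinearMap.curryLeft_apply, Fin.cons_self_tail] at h3

lemma lof_eq_lof {n n' : ℕ} (hn : n = n') {f : Cochain K V W n} {f' : Cochain K V W n'}
    (h : ∀ X z, evalSeq f.1 X z = evalSeq f'.1 X z) :
    DirectSum.lof K ℕ (Cochain K V W) n f = DirectSum.lof K ℕ (Cochain K V W) n' f' := by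
  subst hn
  congr 1
  exact Subtype.ext (evalSeq_ext h)

/-- The degrees of the three cochains agree only propositionally, hence the equations between
degrees among the hypotheses. -/
lemma contract_lof_eq {n m m₁ m₂ : ℕ} (hn : n = m + 1) (h₁ : m₁ = m) (h₂ : m₂ = m)
    (x : ⋀[K]^2 V) (c : ℤˣ) {f : Cochain K V W n} {f₁ : Cochain K V W m₁} {f₂ : Cochain K V W m₂}
    (h : ∀ X z, evalSeq f.1 (seqInsert 0 x X) z =
      c • evalSeq f₁.1 X z + evalSeq f₂.1 X z) :
    contract V W x (DirectSum.lof K ℕ _ n f) =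
      c • DirectSum.lof K ℕ (Cochain K V W) m₁ f₁ + DirectSum.lof K ℕ (Cochain K V W) m₂ f₂ := by
  subst hn h₁ h₂
  rw [contract_lof_succ, Units.smul_def, ← map_zsmul, ← map_add]
  congr 1
  refine Subtype.ext (evalSeq_ext fun X z => ?_)
  rw [evalSeq_contractC, h X z]
  rfl

/-- The leading argument x of a shuffled sequence goes either to P, which shifts the insertion slot
by one and costs `(-1) ^ (q + 1)`, or to Q as its first argument. For k = 0 the first block is empty
and only Q can receive it. -/
lemma evalSeq_circ_seqInsert_succ {p q : ℕ} (P : PreCochain K V W (p + 1))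
    (Q : PreCochain K V V (q + 1)) (x : ⋀[K]^2 V) (X : ℕ → ⋀[K]^2 V) (z : V) :
    evalSeq (circ P Q) (seqInsert 0 x X) z =
      (-1 : ℤˣ) ^ (q + 1) • evalSeq (circ (MultilinearMap.curryLeft P x) Q) X z
        + evalSeq (circ P (MultilinearMap.curryLeft Q x)) X z := by
  simp only [evalSeq_circ]
  rw [Finset.sum_range_succ', Finset.sum_range_succ']
  have e1 : p + 1 + (q + 1) = (p + q + 1) + 1 := by omega
  have e2 : p + (q + 1) = p + q + 1 := by omega
  have e3 : p + 1 + q = p + q + 1 := by omega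
  rw [e1, e2, e3, shuffleSum_succ_succ (by omega), zero_mul, zero_mul,
    shuffleSum_zero_succ]
  have hs : ∀ k ∈ Finset.range p, (-1 : ℤˣ) ^ ((k + 1) * (q + 1)) •
        shuffleSum (p + q + 1 + 1) (k + 1) (q + 1) (fun Y => evalSeq P (seqArgs Q (k + 1) Y) z)
          (seqInsert 0 x X) =
      (-1 : ℤˣ) ^ (q + 1) • ((-1 : ℤˣ) ^ (k * (q + 1)) • shuffleSum (p + q + 1) k (q + 1)
        (fun Y => evalSeq (MultilinearMap.curryLeft P x) (seqArgs Q k Y) z) X)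
      + (-1 : ℤˣ) ^ ((k + 1) * q) • shuffleSum (p + q + 1) (k + 1) q
        (fun Y => evalSeq P (seqArgs (MultilinearMap.curryLeft Q x) (k + 1) Y) z) X := by
    intro k hk
    rw [Finset.mem_range] at hk
    rw [shuffleSum_succ_succ (by omega), smul_add]
    simp only [seqArgs_succ_seqInsert, seqArgs_seqInsert_self, evalSeq_curryLeft, smul_smul,
      ← pow_add]
    congr 2
    · congr 1; ring
    -- The exponent (k + 1)(q + 1) is the sign in the circle product, and the further k + 1 comes
    -- from moving x past the first block. Together they give the sign belonging to the degree q of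
    -- the contracted Q.
    · rw [show (k + 1) * (q + 1) + (k + 1) = (k + 1) * q + 2 * (k + 1) by ring, pow_add _ _ (2 * _),
        pow_mul]
      simp
  rw [Finset.sum_congr rfl hs, Finset.sum_add_distrib, ← Finset.smul_sum]
  simp only [seqArgs_seqInsert_self, evalSeq_curryLeft, smul_add, smul_smul, ← pow_add,
    seqInsert_add, evalSeq_seqInsert_self, seqInsert_zero_add]
  have hp : (-1 : ℤˣ) ^ ((p + 1) * (q + 1)) = (-1) ^ (q + 1 + p * (q + 1)) := by
    congr 1; ring
  have hp' : (-1 : ℤˣ) ^ ((p + 1) * (q + 1) + (p + 1)) = (-1) ^ ((p + 1) * q) := by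
    rw [show (p + 1) * (q + 1) + (p + 1) = (p + 1) * q + 2 * (p + 1) by ring, pow_add _ _ (2 * _),
        pow_mul]
    simp
  rw [hp, hp']
  abel

lemma evalSeq_circ_zero_seqInsert_succ {q : ℕ} (P : PreCochain K V W 0)
    (Q : PreCochain K V V (q + 1)) (x : ⋀[K]^2 V) (X : ℕ → ⋀[K]^2 V) (z : V) :
    evalSeq (circ P Q) (seqInsert 0 x X) z =
      evalSeq (circ P (MultilinearMap.curryLeft Q x)) X z := by
  simp only [evalSeq_circ]
  rw [show 0 + (q + 1) = 0 + q + 1 by omega, shuffleSum_zero_succ]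
  simp only [seqInsert_add, evalSeq_curryLeft, evalSeq_seqInsert_self, Finset.range_zero,
    Finset.sum_empty, zero_mul]

/-- A map of degree 0 cannot absorb x but may act on it: the term k = 0 of the circle product
inserts T ⋆ x. This correction is the source of every exceptional term below. -/
lemma evalSeq_circ_succ_zero {p : ℕ} (P : PreCochain K V W (p + 1))
    (Q : PreCochain K V V 0) (x : ⋀[K]^2 V) (X : ℕ → ⋀[K]^2 V) (z : V) :
    evalSeq (circ P Q) (seqInsert 0 x X) z =
      evalSeq (circ (MultilinearMap.curryLeft P x) Q) X z
        + evalSeq (MultilinearMap.curryLeft P (derivExt (evalSeq Q X) x)) X z := by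
  simp only [evalSeq_circ]
  rw [Finset.sum_range_succ']
  simp only [mul_zero, pow_zero, one_smul, add_zero, shuffleSum_succ_zero, shuffleSum_zero_zero,
    seqArgs_succ_seqInsert, seqArgs_zero_seqInsert, evalSeq_curryLeft, seqInsert_zero_add]
  abel

end Contraction

/-! ### The pre-Lie identity and the graded Lie bracket -/

section PreLie

variable {V W : Type*} [AddCommGroup V] [Module K V] [AddCommGroup W] [Module K W]

variable (K V W) in
/-- `Cⁿ(V, W)` as a subspace of `C^*(V, W)`. -/
def homog (n : ℕ) : Submodule K (CochainSpace K V W) :=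
  LinearMap.range (DirectSum.lof K ℕ (Cochain K V W) n)

lemma lof_mem_homog {n : ℕ} (f : Cochain K V W n) :
    DirectSum.lof K ℕ _ n f ∈ homog K V W n := ⟨f, rfl⟩

lemma units_smul_mem {R M : Type*} [Ring R] [AddCommGroup M] [Module R M] (S : Submodule R M)
    (c : ℤˣ) {a : M} (ha : a ∈ S) : c • a ∈ S := by
  rcases Int.units_eq_one_or c with rfl | rfl
  · simpa using ha
  · simpa [Units.smul_def] using ha

lemma map_units_smul {R M N : Type*} [Ring R] [AddCommGroup M] [Module R M] [AddCommGroup N]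
    [Module R N] (f : M →ₗ[R] N) (c : ℤˣ) (a : M) : f (c • a) = c • f a := by
  rw [Units.smul_def, Units.smul_def, map_zsmul]

lemma contract_mem_homog (x : ⋀[K]^2 V) {n : ℕ} {f : CochainSpace K V W}
    (hf : f ∈ homog K V W (n + 1)) : contract V W x f ∈ homog K V W n := by
  obtain ⟨f, rfl⟩ := hf
  rw [contract_lof_succ]
  exact lof_mem_homog _

lemma contract_eq_zero (x : ⋀[K]^2 V) {f : CochainSpace K V W}
    (hf : f ∈ homog K V W 0) : contract V W x f = 0 := by
  obtain ⟨f, rfl⟩ := hf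
  exact contract_lof_zero x f

lemma eq_zero_of_contract {n : ℕ} {f : CochainSpace K V W} (hf : f ∈ homog K V W (n + 1))
    (h : ∀ x, contract V W x f = 0) : f = 0 := by
  obtain ⟨f, rfl⟩ := hf
  rw [lof_eq_zero_of_contract f h, map_zero]

variable (K V) in
/-- The circle product on `C^*(V, V)`. -/
def circT : CochainSpace K V V →ₗ[K] CochainSpace K V V →ₗ[K] CochainSpace K V V :=
  DirectSum.toModule K ℕ _ fun p =>
    (DirectSum.toModule K ℕ _ fun q =>
      ((circC (K := K) (V := V) p q).compr₂ (DirectSum.lof K ℕ (Cochain K V V) (p + q))).flip).flip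

lemma circT_lof {p q : ℕ} (P : Cochain K V V p) (Q : Cochain K V V q) :
    circT K V (DirectSum.lof K ℕ _ p P) (DirectSum.lof K ℕ _ q Q) =
      DirectSum.lof K ℕ _ (p + q) (circC p q P Q) := by
  rw [circT, DirectSum.toModule_lof, LinearMap.flip_apply, DirectSum.toModule_lof]
  rfl

lemma circT_mem {p q : ℕ} {P Q : CochainSpace K V V} (hP : P ∈ homog K V V p)
    (hQ : Q ∈ homog K V V q) : circT K V P Q ∈ homog K V V (p + q) := by
  obtain ⟨P, rfl⟩ := hP
  obtain ⟨Q, rfl⟩ := hQ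
  rw [circT_lof]
  exact lof_mem_homog _

lemma contract_circT_succ (x : ⋀[K]^2 V) {q : ℕ} (P : CochainSpace K V V)
    {Q : CochainSpace K V V} (hQ : Q ∈ homog K V V (q + 1)) :
    contract V V x (circT K V P Q) =
      (-1 : ℤˣ) ^ (q + 1) • circT K V (contract V V x P) Q + circT K V P (contract V V x Q) := by
  obtain ⟨Q, rfl⟩ := hQ
  induction P using DirectSum.induction_on with
  | zero => simp
  | add P P' h h' => simp only [map_add, LinearMap.add_apply, h, h', smul_add]; abel
  | of p P =>
    change contract V V x (circT K V (DirectSum.lof K ℕ _ p P) _) =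
      (-1 : ℤˣ) ^ (q + 1) • circT K V (contract V V x (DirectSum.lof K ℕ _ p P)) _ +
        circT K V (DirectSum.lof K ℕ _ p P) _
    rw [circT_lof, contract_lof_succ x Q]
    rcases p with _ | p
    · rw [contract_lof_zero, map_zero, LinearMap.zero_apply, smul_zero, circT_lof]
      -- A cochain P of degree 0 has no slot for x, so the summand in which P receives x is filled
      -- with zero.
      refine (contract_lof_eq (m := 0 + q) (m₁ := 0 + q) (f₁ := 0)
        (f₂ := circC 0 q P (contractC V V x q Q)) rfl rfl rfl x 1 ?_).trans
        (by rw [map_zero, smul_zero])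
      intro X z
      refine (evalSeq_circ_zero_seqInsert_succ P.1 Q.1 x X z).trans ?_
      rw [one_smul]
      exact (zero_add _).symm
    · rw [contract_lof_succ, circT_lof, circT_lof]
      refine contract_lof_eq (m := p + 1 + q) rfl (by omega) rfl x _ fun X z => ?_
      exact evalSeq_circ_seqInsert_succ P.1 Q.1 x X z

lemma exists_ofLinear {f : CochainSpace K V W} (hf : f ∈ homog K V W 0) :
    ∃ T : V →ₗ[K] W, f = DirectSum.lof K ℕ _ 0 (ofLinear T) := by
  obtain ⟨f, rfl⟩ := hf
  refine ⟨f.1 0, congrArg _ (Subtype.ext (MultilinearMap.ext fun X => ?_))⟩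
  rw [Subsingleton.elim X 0]
  rfl

lemma circT_ofLinear (S T : V →ₗ[K] V) :
    circT K V (DirectSum.lof K ℕ _ 0 (ofLinear S)) (DirectSum.lof K ℕ _ 0 (ofLinear T)) =
      DirectSum.lof K ℕ _ 0 (ofLinear (S ∘ₗ T)) := by
  rw [circT_lof]
  refine lof_eq_lof rfl fun X z => ?_
  refine (evalSeq_circ (ofLinear S).1 (ofLinear T).1 X z).trans ?_
  simp [shuffleSum_zero_zero, evalSeq, ofLinear]

lemma contract_circT_ofLinear (x : ⋀[K]^2 V) (P : CochainSpace K V V) (T : V →ₗ[K] V) :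
    contract V V x (circT K V P (DirectSum.lof K ℕ _ 0 (ofLinear T))) =
      circT K V (contract V V x P) (DirectSum.lof K ℕ _ 0 (ofLinear T))
        + contract V V (derivExt T x) P := by
  induction P using DirectSum.induction_on with
  | zero => simp
  | add P P' h h' => simp only [map_add, LinearMap.add_apply, h, h']; abel
  | of p P =>
    change contract V V x (circT K V (DirectSum.lof K ℕ _ p P) _) =
      circT K V (contract V V x (DirectSum.lof K ℕ _ p P)) _ +
        contract V V _ (DirectSum.lof K ℕ _ p P)
    rw [circT_lof]
    rcases p with _ | p
    · simp only [contract_lof_zero, map_zero, LinearMap.zero_apply, add_zero]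
      exact contract_lof_zero x _
    · rw [contract_lof_succ x P, contract_lof_succ _ P, circT_lof,
        ← one_smul ℤˣ (DirectSum.lof K ℕ (Cochain K V V) (p + 0) _)]
      refine contract_lof_eq (m := p) rfl rfl rfl x 1 fun X z => ?_
      rw [one_smul]
      exact evalSeq_circ_succ_zero P.1 (ofLinear T).1 x X z

/-- On u ∧ v both sides equal Su ∧ Tv + Tu ∧ Sv, which is symmetric in S and T. -/
lemma derivExt_comp_apply (S T : V →ₗ[K] V) (x : ⋀[K]^2 V) :
    derivExt S (derivExt T x) - derivExt (S ∘ₗ T) x =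
      derivExt T (derivExt S x) - derivExt (T ∘ₗ S) x := by
  have : derivExt S ∘ₗ derivExt T - derivExt (S ∘ₗ T) =
      derivExt T ∘ₗ derivExt S - derivExt (T ∘ₗ S) := by
    refine exteriorPower.linearMap_ext (AlternatingMap.ext fun v => ?_)
    have hv : exteriorPower.ιMulti K 2 v = wedge (v 0) (v 1) := by
      rw [wedge]; congr 1; ext i; fin_cases i <;> rfl
    simp only [LinearMap.compAlternatingMap_apply, hv, LinearMap.sub_apply, LinearMap.comp_apply,
      derivExt_wedge, map_add]
    abel
  exact LinearMap.congr_fun this x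

variable (K V) in
/-- The associator of the circle product. -/
def assocT (P Q R : CochainSpace K V V) : CochainSpace K V V :=
  circT K V (circT K V P Q) R - circT K V P (circT K V Q R)

lemma assocT_zero_left (Q R : CochainSpace K V V) : assocT K V 0 Q R = 0 := by simp [assocT]

lemma assocT_mem {p q r : ℕ} {P Q R : CochainSpace K V V} (hP : P ∈ homog K V V p)
    (hQ : Q ∈ homog K V V q) (hR : R ∈ homog K V V r) :
    assocT K V P Q R ∈ homog K V V (p + q + r) :=
  sub_mem (circT_mem (circT_mem hP hQ) hR) (add_assoc p q r ▸ circT_mem hP (circT_mem hQ hR))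

/-- When Q and R have positive degree, contraction obeys the graded Leibniz rule on both iterated
products, hence on the associator. -/
lemma contract_assocT_succ_succ (x : ⋀[K]^2 V) {q r : ℕ} (P : CochainSpace K V V)
    {Q R : CochainSpace K V V} (hQ : Q ∈ homog K V V (q + 1)) (hR : R ∈ homog K V V (r + 1)) :
    contract V V x (assocT K V P Q R) =
      (-1 : ℤˣ) ^ (q + r) • assocT K V (contract V V x P) Q R
        + (-1 : ℤˣ) ^ (r + 1) • assocT K V P (contract V V x Q) R
        + assocT K V P Q (contract V V x R) := by
  have hQR : circT K V Q R ∈ homog K V V (q + 1 + r + 1) := by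
    have := circT_mem hQ hR
    exact this
  rw [assocT, map_sub, contract_circT_succ x _ hR, contract_circT_succ x _ hQ,
    contract_circT_succ x _ hQR, contract_circT_succ x _ hR]
  simp only [assocT, map_add, LinearMap.add_apply, Units.smul_def,
    map_zsmul, LinearMap.smul_apply, smul_sub, smul_add, smul_smul]
  push_cast
  rw [show (-1 : ℤ) ^ (q + r) = (-1) ^ (q + 1 + r + 1) by ring,
    show (-1 : ℤ) ^ (r + 1) * (-1) ^ (q + 1) = (-1) ^ (q + 1 + r + 1) by ring]
  abel

/-- The correction term survives in the associator because R can be contracted while T cannot.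
`contract_assocT_succ_ofLinear` produces the same correction with T and R interchanged, so the two
match in the pre-Lie identity. -/
lemma contract_assocT_ofLinear_succ (x : ⋀[K]^2 V) {r : ℕ} (P : CochainSpace K V V)
    (T : V →ₗ[K] V) {R : CochainSpace K V V} (hR : R ∈ homog K V V (r + 1)) :
    contract V V x (assocT K V P (DirectSum.lof K ℕ _ 0 (ofLinear T)) R) =
      (-1 : ℤˣ) ^ (r + 1) • assocT K V (contract V V x P) (DirectSum.lof K ℕ _ 0 (ofLinear T)) R
        + (-1 : ℤˣ) ^ (r + 1) • circT K V (contract V V (derivExt T x) P) R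
        + assocT K V P (DirectSum.lof K ℕ _ 0 (ofLinear T)) (contract V V x R) := by
  have hQR : circT K V (DirectSum.lof K ℕ _ 0 (ofLinear T)) R ∈ homog K V V (r + 1) := by
    simpa using circT_mem (lof_mem_homog (ofLinear T)) hR
  rw [assocT, map_sub, contract_circT_succ x _ hR, contract_circT_ofLinear,
    contract_circT_succ x _ hQR, contract_circT_succ x _ hR, contract_lof_zero]
  simp only [assocT, map_add, LinearMap.add_apply, Units.smul_def,
    smul_sub, smul_add, map_zero, LinearMap.zero_apply, smul_zero]
  abel

lemma contract_assocT_succ_ofLinear (x : ⋀[K]^2 V) {r : ℕ} (P : CochainSpace K V V)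
    (T : V →ₗ[K] V) {R : CochainSpace K V V} (hR : R ∈ homog K V V (r + 1)) :
    contract V V x (assocT K V P R (DirectSum.lof K ℕ _ 0 (ofLinear T))) =
      (-1 : ℤˣ) ^ (r + 1) • assocT K V (contract V V x P) R (DirectSum.lof K ℕ _ 0 (ofLinear T))
        + (-1 : ℤˣ) ^ (r + 1) • circT K V (contract V V (derivExt T x) P) R
        + assocT K V P (contract V V x R) (DirectSum.lof K ℕ _ 0 (ofLinear T)) := by
  have hQR : circT K V R (DirectSum.lof K ℕ _ 0 (ofLinear T)) ∈ homog K V V (r + 1) := by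
    simpa using circT_mem hR (lof_mem_homog (ofLinear T))
  rw [assocT, map_sub, contract_circT_ofLinear, contract_circT_succ x _ hR,
    contract_circT_succ x _ hQR, contract_circT_ofLinear, contract_circT_succ _ _ hR]
  simp only [assocT, map_add, LinearMap.add_apply, Units.smul_def,
    map_zsmul, LinearMap.smul_apply, smul_sub]
  abel

/-- The two middle corrections are exchanged by S ↔ T, and the last one is symmetric by
`derivExt_comp_apply`. -/
lemma contract_assocT_ofLinear (x : ⋀[K]^2 V) (P : CochainSpace K V V) (S T : V →ₗ[K] V) :
    contract V V x (assocT K V P (DirectSum.lof K ℕ _ 0 (ofLinear S))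
        (DirectSum.lof K ℕ _ 0 (ofLinear T))) =
      assocT K V (contract V V x P) (DirectSum.lof K ℕ _ 0 (ofLinear S))
          (DirectSum.lof K ℕ _ 0 (ofLinear T))
        + circT K V (contract V V (derivExt S x) P) (DirectSum.lof K ℕ _ 0 (ofLinear T))
        + circT K V (contract V V (derivExt T x) P) (DirectSum.lof K ℕ _ 0 (ofLinear S))
        + contract V V (derivExt S (derivExt T x) - derivExt (S ∘ₗ T) x) P := by
  have h : ∀ a b : ⋀[K]^2 V, contract V V (a - b) P = contract V V a P - contract V V b P := by
    intro a b
    rw [eq_sub_iff_add_eq, ← LinearMap.add_apply, ← contract_add, sub_add_cancel]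
  rw [h, assocT, map_sub, contract_circT_ofLinear, contract_circT_ofLinear, circT_ofLinear,
    contract_circT_ofLinear, contract_circT_ofLinear, assocT, circT_ofLinear]
  simp only [map_add, LinearMap.add_apply]
  abel

/-- The circle product is graded right pre-Lie. -/
lemma assocT_comm {p q r : ℕ} {P Q R : CochainSpace K V V} (hP : P ∈ homog K V V p)
    (hQ : Q ∈ homog K V V q) (hR : R ∈ homog K V V r) :
    assocT K V P Q R = (-1 : ℤˣ) ^ (q * r) • assocT K V P R Q := by
  obtain ⟨n, hn⟩ : ∃ n, n = p + q + r := ⟨_, rfl⟩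
  induction n generalizing p q r P Q R with
  | zero =>
    obtain rfl : p = 0 := by omega
    obtain rfl : q = 0 := by omega
    obtain rfl : r = 0 := by omega
    obtain ⟨P, rfl⟩ := exists_ofLinear hP
    obtain ⟨Q, rfl⟩ := exists_ofLinear hQ
    obtain ⟨R, rfl⟩ := exists_ofLinear hR
    -- In degree 0 the circle product is composition of linear maps, so both associators vanish.
    simp [assocT, circT_ofLinear, LinearMap.comp_assoc]
  | succ n ih =>
    rw [← sub_eq_zero]
    have hmem : assocT K V P Q R - (-1 : ℤˣ) ^ (q * r) • assocT K V P R Q ∈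
        homog K V V (n + 1) := by
      refine sub_mem (hn ▸ assocT_mem hP hQ hR) (units_smul_mem _ _ ?_)
      rw [hn, add_right_comm]
      exact assocT_mem hP hR hQ
    refine eq_zero_of_contract hmem fun x => ?_
    -- Contracting P lowers the total degree. If P has degree 0 there is nothing to lower, but then
    -- its contraction is zero.
    have ihP : assocT K V (contract V V x P) Q R =
        (-1 : ℤˣ) ^ (q * r) • assocT K V (contract V V x P) R Q := by
      rcases p with _ | p
      · rw [contract_eq_zero x hP, assocT_zero_left, assocT_zero_left, smul_zero]
      · exact ih (contract_mem_homog x hP) hQ hR (by omega)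
    rw [map_sub, map_units_smul, sub_eq_zero]
    -- The contraction formula depends on which of Q and R have degree 0.
    rcases q with _ | q <;> rcases r with _ | r
    · obtain ⟨Q, rfl⟩ := exists_ofLinear hQ
      obtain ⟨R, rfl⟩ := exists_ofLinear hR
      rw [contract_assocT_ofLinear, contract_assocT_ofLinear, ihP, derivExt_comp_apply]
      simp only [mul_zero, pow_zero, one_smul]
      abel
    · obtain ⟨Q, rfl⟩ := exists_ofLinear hQ
      rw [contract_assocT_ofLinear_succ x P Q hR, contract_assocT_succ_ofLinear x P Q hR, ihP,
        ih hP hQ (contract_mem_homog x hR) (by omega)]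
      simp
    · obtain ⟨R, rfl⟩ := exists_ofLinear hR
      rw [contract_assocT_ofLinear_succ x P R hQ, contract_assocT_succ_ofLinear x P R hQ, ihP,
        ih hP (contract_mem_homog x hQ) hR (by omega)]
      simp
    · rw [contract_assocT_succ_succ x P hQ hR, contract_assocT_succ_succ x P hR hQ, ihP,
        ih hP (contract_mem_homog x hQ) hR (by omega),
        ih hP hQ (contract_mem_homog x hR) (by omega)]
      simp only [smul_add, smul_smul, ← pow_add]
      have e1 : (-1 : ℤˣ) ^ (q + r + (q + 1) * (r + 1)) = (-1) ^ ((q + 1) * (r + 1) + (r + q)) := by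
        congr 1; ring
      have e2 : (-1 : ℤˣ) ^ (r + 1 + q * (r + 1)) = (-1) ^ ((q + 1) * (r + 1)) := by
        congr 1; ring
      have e3 : (-1 : ℤˣ) ^ ((q + 1) * (r + 1) + (q + 1)) = (-1) ^ ((q + 1) * r) := by
        rw [show (q + 1) * (r + 1) + (q + 1) = (q + 1) * r + 2 * (q + 1) by ring,
          pow_add _ _ (2 * _), pow_mul]
        simp
      rw [e1, e2, e3]
      abel

lemma lieBracket_eq {p q : ℕ} {P Q : CochainSpace K V V} (hP : P ∈ homog K V V p)
    (hQ : Q ∈ homog K V V q) :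
    lieBracket K V P Q = circT K V P Q - (-1 : ℤˣ) ^ (p * q) • circT K V Q P := by
  obtain ⟨P, rfl⟩ := hP
  obtain ⟨Q, rfl⟩ := hQ
  rw [circT_lof, circT_lof, lieBracket, DirectSum.toModule_lof, LinearMap.flip_apply,
    DirectSum.toModule_lof, LinearMap.flip_apply, bracketC]
  simp only [LinearMap.sub_apply, LinearMap.smul_apply, LinearMap.flip_apply,
    LinearMap.compr₂_apply]
  -- The bracket is defined with a sign in K, while the formula uses a unit of ℤ; the two are
  -- compared for each parity.
  rcases neg_one_pow_eq_or ℤ (p * q) with h | h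
  · rw [Units.smul_def]
    push_cast
    rw [h, show (-1 : K) ^ (p * q) = ((-1 : ℤ) ^ (p * q) : ℤ) by push_cast; rfl, h]
    simp
  · rw [Units.smul_def]
    push_cast
    rw [h, show (-1 : K) ^ (p * q) = ((-1 : ℤ) ^ (p * q) : ℤ) by push_cast; rfl, h]
    simp

lemma lieBracket_mem {p q : ℕ} {P Q : CochainSpace K V V} (hP : P ∈ homog K V V p)
    (hQ : Q ∈ homog K V V q) : lieBracket K V P Q ∈ homog K V V (p + q) := by
  rw [lieBracket_eq hP hQ]
  exact sub_mem (circT_mem hP hQ) (units_smul_mem _ _ (add_comm p q ▸ circT_mem hQ hP))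

lemma lieBracket_swap {p q : ℕ} {P Q : CochainSpace K V V} (hP : P ∈ homog K V V p)
    (hQ : Q ∈ homog K V V q) :
    lieBracket K V P Q = -(-1 : ℤˣ) ^ (p * q) • lieBracket K V Q P := by
  rw [lieBracket_eq hP hQ, lieBracket_eq hQ hP, mul_comm q p]
  rcases neg_one_pow_eq_or ℤˣ (p * q) with h | h
  · rw [h]; simp
  · rw [h]; simp [Units.smul_def]; abel

/-- The graded Jacobi identity. -/
lemma lieBracket_lieBracket {p q r : ℕ} {P Q R : CochainSpace K V V} (hP : P ∈ homog K V V p)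
    (hQ : Q ∈ homog K V V q) (hR : R ∈ homog K V V r) :
    lieBracket K V (lieBracket K V P Q) R =
      lieBracket K V P (lieBracket K V Q R)
        + (-1 : ℤˣ) ^ (q * r) • lieBracket K V (lieBracket K V P R) Q := by
  rw [lieBracket_eq (lieBracket_mem hP hQ) hR, lieBracket_eq hP (lieBracket_mem hQ hR),
    lieBracket_eq (lieBracket_mem hP hR) hQ, lieBracket_eq hP hQ, lieBracket_eq hQ hR,
    lieBracket_eq hP hR]
  -- The Jacobi identity is a signed sum of three pre-Lie identities, one for each choice of the
  -- leftmost factor. Once the parities of pq, pr and qr are fixed this is additive algebra.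
  have h1 := assocT_comm hP hQ hR
  have h2 := assocT_comm hQ hP hR
  have h3 := assocT_comm hR hP hQ
  simp only [assocT] at h1 h2 h3
  simp only [add_mul, mul_add, pow_add, mul_comm r q] at h2 h3 ⊢
  rcases neg_one_pow_eq_or ℤˣ (p * q) with a | a <;>
  rcases neg_one_pow_eq_or ℤˣ (p * r) with b | b <;>
  rcases neg_one_pow_eq_or ℤˣ (q * r) with c | c <;>
  simp only [a, b, c, one_smul, Units.neg_smul, mul_one, mul_neg, neg_neg,
    map_sub, map_neg, LinearMap.sub_apply, LinearMap.neg_apply] at h1 h2 h3 ⊢ <;>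
  grind

end PreLie

/-! ### Koszul-signed sums over splittings of a list -/

section ListSplittings

variable {α : Type*}

lemma ofFn_insertZero {n : ℕ} (j : Fin (n + 1)) (τ : Equiv.Perm (Fin n)) (y : Fin (n + 1) → α) :
    List.ofFn (fun i => y (insertZero j τ i)) =
      (List.ofFn fun i => y (τ i).succ).take j ++
        y 0 :: (List.ofFn fun i => y (τ i).succ).drop j := by
  have hj := j.isLt
  refine List.ext_getElem (by simp; omega) fun i h1 h2 => ?_
  rw [List.length_ofFn] at h1
  rw [List.getElem_ofFn]
  rcases Fin.eq_self_or_eq_succAbove j ⟨i, h1⟩ with h | ⟨a, h⟩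
  · have hij : i = j := by rw [← h]
    rw [h, insertZero_self, List.getElem_append_right (by simp [hij])]
    simp [hij, Nat.min_eq_left (Nat.lt_succ_iff.mp hj)]
  · have hia : i = (j.succAbove a : ℕ) := by rw [← h]
    rw [h, insertZero_succAbove]
    rw [val_succAbove] at hia
    have ha := a.isLt
    split_ifs at hia with h'
    · rw [List.getElem_append_left (by simp; omega)]
      simp [hia]
    · rw [List.getElem_append_right (by simp; omega)]
      have : i - ((List.ofFn fun i => y (τ i).succ).take j).length = (a - j) + 1 := by
        simp; omega
      simp only [this, List.getElem_cons_succ, List.getElem_drop, List.getElem_ofFn]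
      congr 3
      ext; simp only; omega

variable {M : Type*} [AddCommGroup M]

/-- Pascal's rule summed over all block sizes. The first sum collects the shuffles whose first block
starts with 0, the second those whose second block does. -/
lemma sum_shuffles_fin_succ {n : ℕ} (f : ℕ → Equiv.Perm (Fin (n + 1)) → M) :
    ∑ i : Fin (n + 2), ∑ σ ∈ shuffles (n + 1) i (n + 1 - i), f i σ =
      ∑ i : Fin (n + 1), ∑ τ ∈ shuffles n i (n - i), f (i + 1) (insertZero 0 τ)
        + ∑ i : Fin (n + 1), ∑ τ ∈ shuffles n i (n - i), f i (insertZero i τ) := by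
  rw [Fin.sum_univ_succ, Fin.sum_univ_castSucc, Fin.sum_univ_castSucc (n := n),
    Fin.sum_univ_succ (f := fun i : Fin (n + 1) => ∑ τ ∈ shuffles n i (n - i),
      f i (insertZero i τ))]
  have h0 : ∑ σ ∈ shuffles (n + 1) ((0 : Fin (n + 2)) : ℕ) (n + 1 - ((0 : Fin (n + 2)) : ℕ)),
      f ((0 : Fin (n + 2)) : ℕ) σ = ∑ τ ∈ shuffles n ((0 : Fin (n + 1)) : ℕ)
        (n - ((0 : Fin (n + 1)) : ℕ)), f ((0 : Fin (n + 1)) : ℕ) (insertZero 0 τ) :=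
    sum_shuffles_zero_succ (f 0)
  have h1 : ∑ σ ∈ shuffles (n + 1) ((Fin.last n).succ : ℕ) (n + 1 - ((Fin.last n).succ : ℕ)),
      f ((Fin.last n).succ : ℕ) σ = ∑ τ ∈ shuffles n (Fin.last n : ℕ) (n - (Fin.last n : ℕ)),
        f ((Fin.last n : ℕ) + 1) (insertZero 0 τ) := by
    simp only [Fin.val_succ, Fin.val_last, Nat.sub_self]
    exact sum_shuffles_succ_zero (f (n + 1))
  have h2 : ∀ i : Fin n, ∑ σ ∈ shuffles (n + 1) (i.castSucc.succ : ℕ)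
        (n + 1 - (i.castSucc.succ : ℕ)), f (i.castSucc.succ : ℕ) σ =
      ∑ τ ∈ shuffles n (i.castSucc : ℕ) (n - (i.castSucc : ℕ)),
        f ((i.castSucc : ℕ) + 1) (insertZero 0 τ)
      + ∑ τ ∈ shuffles n (i.succ : ℕ) (n - (i.succ : ℕ)), f (i.succ : ℕ) (insertZero i.succ τ) := by
    intro i
    have hi := i.isLt
    simp only [Fin.val_succ, Fin.val_castSucc]
    obtain ⟨m, hm⟩ : ∃ m, n - i = m + 1 := ⟨n - i - 1, by omega⟩
    rw [show n + 1 - (i + 1) = m + 1 by omega, hm, show n - ((i : ℕ) + 1) = m by omega]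
    exact sum_shuffles_succ_succ (by omega) (f (i + 1))
  rw [h0, h1, Finset.sum_congr rfl fun i _ => h2 i, Finset.sum_add_distrib]
  abel

/-- The total degree of a list of elements with degrees. -/
def degSum (xs : List (ℤ × α)) : ℤ := (xs.map Prod.fst).sum

lemma degSum_nil : degSum ([] : List (ℤ × α)) = 0 := rfl

lemma degSum_cons (x : ℤ × α) (xs : List (ℤ × α)) : degSum (x :: xs) = x.1 + degSum xs := by
  simp [degSum]

/-- The sum of `G S T` over all splittings of the list `xs` into two sublists `S` and `T`, with
Koszul signs. -/
def splitSum : List (ℤ × α) → (List (ℤ × α) → List (ℤ × α) → M) → M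
  | [], G => G [] []
  | x :: xs, G => splitSum xs (fun S T => G (x :: S) T)
      + splitSum xs (fun S T => Int.negOnePow (x.1 * degSum S) • G S (x :: T))

lemma splitSum_congr (p : ℤ × α → Prop) (xs : List (ℤ × α)) (hxs : ∀ x ∈ xs, p x)
    (G G' : List (ℤ × α) → List (ℤ × α) → M)
    (h : ∀ S T, (∀ x ∈ S, p x) → (∀ x ∈ T, p x) → G S T = G' S T) :
    splitSum xs G = splitSum xs G' := by
  induction xs generalizing G G' with
  | nil => exact h [] [] (by simp) (by simp)
  | cons x xs ih =>
    rw [List.forall_mem_cons] at hxs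
    simp only [splitSum]
    congr 1
    · exact ih hxs.2 _ _ fun S T hS hT => h _ _ (List.forall_mem_cons.mpr ⟨hxs.1, hS⟩) hT
    · exact ih hxs.2 _ _ fun S T hS hT => by
        rw [h _ _ hS (List.forall_mem_cons.mpr ⟨hxs.1, hT⟩)]

lemma splitSum_add (xs : List (ℤ × α)) (G G' : List (ℤ × α) → List (ℤ × α) → M) :
    splitSum xs (fun S T => G S T + G' S T) = splitSum xs G + splitSum xs G' := by
  induction xs generalizing G G' with
  | nil => rfl
  | cons x xs ih => simp only [splitSum, smul_add, ih]; abel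

lemma splitSum_smul (xs : List (ℤ × α)) (c : ℤˣ) (G : List (ℤ × α) → List (ℤ × α) → M) :
    splitSum xs (fun S T => c • G S T) = c • splitSum xs G := by
  induction xs generalizing G with
  | nil => rfl
  | cons x xs ih => simp only [splitSum, smul_add, ih, smul_comm _ c]

lemma map_splitSum {N : Type*} [AddCommGroup N] (f : M →+ N) (xs : List (ℤ × α))
    (G : List (ℤ × α) → List (ℤ × α) → M) :
    f (splitSum xs G) = splitSum xs fun S T => f (G S T) := by
  induction xs generalizing G with
  | nil => rfl
  | cons x xs ih => simp only [splitSum, map_add, ih, Units.smul_def, map_zsmul]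

/-- Exchanging the blocks amounts to moving all of S past all of T. -/
lemma splitSum_swap (xs : List (ℤ × α)) (G : List (ℤ × α) → List (ℤ × α) → M) :
    splitSum xs G = splitSum xs fun S T => Int.negOnePow (degSum S * degSum T) • G T S := by
  induction xs generalizing G with
  | nil => simp [splitSum, degSum_nil]
  | cons x xs ih =>
    simp only [splitSum]
    rw [add_comm, ih, ih fun S T => G (x :: S) T]
    simp only [smul_smul, degSum_cons, ← Int.negOnePow_add]
    congr 2 <;> funext S T <;> congr 1 <;> rw [Int.negOnePow_eq_iff]
    · exact ⟨0, by ring⟩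
    · exact ⟨-(x.1 * degSum S), by ring⟩

/-- The new inversions pair the value 0 in position j with the j entries before it; those after it
are in order. -/
lemma koszulSign_insertZero {n : ℕ} (d : Fin (n + 1) → ℤ) (j : Fin (n + 1))
    (τ : Equiv.Perm (Fin n)) :
    koszulSign d (insertZero j τ) =
      Int.negOnePow (d 0 * ((List.ofFn fun i => d (τ i).succ).take j).sum) *
        koszulSign (fun i => d i.succ) τ := by
  have hsum : ∀ f : Fin n → ℤ, Int.negOnePow (∑ i, f i) = ∏ i, Int.negOnePow (f i) := by
    intro f
    exact map_sum (⟨⟨fun a => Additive.ofMul (Int.negOnePow a), Int.negOnePow_zero⟩,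
      Int.negOnePow_add⟩ : ℤ →+ Additive ℤˣ) f Finset.univ
  rw [koszulSign, Fin.prod_univ_succAbove _ j, Finset.prod_eq_one, one_mul, List.sum_take_ofFn,
    Finset.mul_sum, Finset.sum_filter, hsum, koszulSign, ← Finset.prod_mul_distrib]
  · refine Finset.prod_congr rfl fun a _ => ?_
    rw [Fin.prod_univ_succAbove _ j]
    simp only [insertZero_self, insertZero_succAbove, Fin.succ_pos, and_true,
      Fin.succAbove_lt_succAbove_iff, Fin.succ_lt_succ_iff]
    congr 1
    have : (j.succAbove a < j) ↔ (a : ℕ) < j := by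
      rw [Fin.lt_def, val_succAbove]; split_ifs <;> omega
    simp only [this, mul_comm (d 0)]
    split_ifs <;> simp
  · intro b _
    rw [insertZero_self, if_neg]
    simp

/-- Identifies the recursive sum, which suits induction, with the sum over shuffles in the
definition of an L_∞-algebra. Placing the head of the list in S or in T is the dichotomy of
`sum_shuffles_fin_succ`. -/
lemma splitSum_ofFn {n : ℕ} (y : Fin n → ℤ × α) (G : List (ℤ × α) → List (ℤ × α) → M) :
    splitSum (List.ofFn y) G =
      ∑ i : Fin (n + 1), ∑ σ ∈ shuffles n i (n - i), koszulSign (fun a => (y a).1) σ •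
        G ((List.ofFn fun a => y (σ a)).take i) ((List.ofFn fun a => y (σ a)).drop i) := by
  induction n generalizing G with
  | zero => simp [splitSum, shuffles_zero_zero, koszulSign]
  | succ n ih =>
    rw [sum_shuffles_fin_succ fun i σ => koszulSign (fun a => (y a).1) σ •
        G ((List.ofFn fun a => y (σ a)).take i) ((List.ofFn fun a => y (σ a)).drop i),
      List.ofFn_succ]
    simp only [splitSum, ih]
    congr 1
    · refine Finset.sum_congr rfl fun i _ => Finset.sum_congr rfl fun τ _ => ?_
      rw [ofFn_insertZero, koszulSign_insertZero]
      simp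
    · refine Finset.sum_congr rfl fun i _ => Finset.sum_congr rfl fun τ _ => ?_
      have hi : (i : ℕ) ≤ n := Nat.lt_succ_iff.mp i.isLt
      have hlen : ((List.ofFn fun a => y (τ a).succ).take i).length = i := by simp [hi]
      rw [ofFn_insertZero, koszulSign_insertZero, List.take_left' hlen, List.drop_left' hlen,
        smul_smul, mul_comm (Int.negOnePow _)]
      congr 4
      simp only [degSum, List.map_take, List.map_ofFn]
      rfl

end ListSplittings

/-! ### Voronov's theorem on higher derived brackets -/

section HigherDerivedBrackets

variable {L F : Type*} [AddCommGroup L] [Module K L] [AddCommGroup F] [Module K F]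

/-- Voronov's data: a graded Lie algebra `L`, an abelian subalgebra `ι : F → L` and a projection
`P : L → F` whose kernel is a subalgebra. The last property is used in the equivalent form
`P [a, b] = P [P a, b] + P [a, P b]`. -/
structure IsVData (𝒜 : ℤ → Submodule K L) (𝒢 : ℤ → Submodule K F) (br : L →ₗ[K] L →ₗ[K] L)
    (ι : F →ₗ[K] L) (P : L →ₗ[K] F) : Prop where
  br_mem : ∀ {i j : ℤ} {a b : L}, a ∈ 𝒜 i → b ∈ 𝒜 j → br a b ∈ 𝒜 (i + j)
  br_swap : ∀ {i j : ℤ} {a b : L}, a ∈ 𝒜 i → b ∈ 𝒜 j →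
    br a b = -Int.negOnePow (i * j) • br b a
  jacobi : ∀ {i j k : ℤ} {a b c : L}, a ∈ 𝒜 i → b ∈ 𝒜 j → c ∈ 𝒜 k →
    br (br a b) c = br a (br b c) + Int.negOnePow (j * k) • br (br a c) b
  ι_mem : ∀ {i : ℤ} {a : F}, a ∈ 𝒢 i → ι a ∈ 𝒜 i
  P_mem : ∀ {i : ℤ} {a : L}, a ∈ 𝒜 i → P a ∈ 𝒢 i
  abelian : ∀ a b : F, br (ι a) (ι b) = 0
  P_br : ∀ a b : L, P (br a b) = P (br (ι (P a)) b) + P (br a (ι (P b)))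

/-- `[⋯[[A, x₁], x₂], ⋯, xₙ]`. -/
def listBracket (br : L →ₗ[K] L →ₗ[K] L) (ι : F →ₗ[K] L) (A : L) (xs : List F) : L :=
  xs.foldl (fun A x => br A (ι x)) A

section

variable (br : L →ₗ[K] L →ₗ[K] L) (ι : F →ₗ[K] L)

lemma listBracket_nil (A : L) : listBracket br ι A [] = A := rfl

lemma listBracket_cons (A : L) (x : F) (xs : List F) :
    listBracket br ι A (x :: xs) = listBracket br ι (br A (ι x)) xs := rfl

lemma listBracket_concat (A : L) (x : F) (xs : List F) :
    listBracket br ι A (xs ++ [x]) = br (listBracket br ι A xs) (ι x) := by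
  simp [listBracket]

lemma listBracket_add (A A' : L) (xs : List F) :
    listBracket br ι (A + A') xs = listBracket br ι A xs + listBracket br ι A' xs := by
  induction xs generalizing A A' with
  | nil => rfl
  | cons x xs ih => simp only [listBracket_cons, map_add, LinearMap.add_apply, ih]

lemma listBracket_units_smul (c : ℤˣ) (A : L) (xs : List F) :
    listBracket br ι (c • A) xs = c • listBracket br ι A xs := by
  induction xs generalizing A with
  | nil => rfl
  | cons x xs ih =>
    rw [listBracket_cons, map_units_smul, listBracket_cons, ← ih]
    simp [Units.smul_def]

lemma listBracket_zero (xs : List F) : listBracket br ι 0 xs = 0 := by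
  induction xs with
  | nil => rfl
  | cons x xs ih => rwa [listBracket_cons, map_zero, LinearMap.zero_apply]

end

variable {𝒜 : ℤ → Submodule K L} {𝒢 : ℤ → Submodule K F} {br : L →ₗ[K] L →ₗ[K] L}
  {ι : F →ₗ[K] L} {P : L →ₗ[K] F}

namespace IsVData

lemma listBracket_mem (hV : IsVData 𝒜 𝒢 br ι P) {a : ℤ} {A : L} (hA : A ∈ 𝒜 a)
    (xs : List (ℤ × F)) (hxs : ∀ x ∈ xs, x.2 ∈ 𝒢 x.1) :
    listBracket br ι A (xs.map Prod.snd) ∈ 𝒜 (a + degSum xs) := by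
  induction xs generalizing a A with
  | nil => simpa [degSum_nil, listBracket_nil] using hA
  | cons x xs ih =>
    rw [List.forall_mem_cons] at hxs
    rw [degSum_cons, ← add_assoc]
    exact ih (hV.br_mem hA (hV.ι_mem hxs.1)) hxs.2

/-- The Leibniz rule for iterated brackets. -/
lemma listBracket_br (hV : IsVData 𝒜 𝒢 br ι P) {a b : ℤ} {A B : L} (hA : A ∈ 𝒜 a)
    (hB : B ∈ 𝒜 b) (xs : List (ℤ × F)) (hxs : ∀ x ∈ xs, x.2 ∈ 𝒢 x.1) :
    listBracket br ι (br A B) (xs.map Prod.snd) = splitSum xs fun S T =>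
      Int.negOnePow (b * degSum S) • br (listBracket br ι A (S.map Prod.snd))
        (listBracket br ι B (T.map Prod.snd)) := by
  induction xs generalizing a b A B with
  | nil => simp [splitSum, degSum_nil, listBracket_nil]
  | cons x xs ih =>
    rw [List.forall_mem_cons] at hxs
    have hx := hV.ι_mem hxs.1
    -- The Jacobi identity sends x either into B, where it joins T, or past B into A, where it joins
    -- S. In the first case the degree of B grows by that of x, which accounts for the Koszul sign
    -- of placing x in T.
    rw [List.map_cons, listBracket_cons, hV.jacobi hA hB hx, listBracket_add,
      listBracket_units_smul, ih hA (hV.br_mem hB hx) hxs.2, ih (hV.br_mem hA hx) hB hxs.2,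
      splitSum, ← splitSum_smul, add_comm]
    simp only [degSum_cons, List.map_cons, listBracket_cons, smul_smul, ← Int.negOnePow_add,
      mul_add, add_mul]
    congr 3
    funext S T
    rw [add_comm (b * degSum S)]

/-- Since F is abelian, the Jacobi identity gives [[A, s], x] = ±[[A, x], s], so x can be moved to
the front one step at a time. -/
lemma listBracket_append_cons (hV : IsVData 𝒜 𝒢 br ι P) {a : ℤ} {A : L} (hA : A ∈ 𝒜 a)
    (S T : List (ℤ × F)) (hS : ∀ x ∈ S, x.2 ∈ 𝒢 x.1) (x : ℤ × F) (hx : x.2 ∈ 𝒢 x.1) :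
    listBracket br ι A ((S ++ x :: T).map Prod.snd) =
      Int.negOnePow (x.1 * degSum S) •
        listBracket br ι (br A (ι x.2)) ((S ++ T).map Prod.snd) := by
  induction S generalizing a A with
  | nil => simp [degSum_nil, listBracket_cons]
  | cons s S ih =>
    rw [List.forall_mem_cons] at hS
    rw [List.cons_append, List.map_cons, listBracket_cons,
      ih (hV.br_mem hA (hV.ι_mem hS.1)) hS.2, hV.jacobi hA (hV.ι_mem hS.1) (hV.ι_mem hx),
      hV.abelian, map_zero, zero_add, listBracket_units_smul, smul_smul, degSum_cons,
      ← Int.negOnePow_add, List.cons_append, List.map_cons, listBracket_cons]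
    congr 2
    ring

/-- Iterated brackets are graded symmetric. -/
lemma listBracket_perm (hV : IsVData 𝒜 𝒢 br ι P) {a : ℤ} {A : L} (hA : A ∈ 𝒜 a)
    {n : ℕ} (y : Fin n → ℤ × F) (hy : ∀ i, (y i).2 ∈ 𝒢 (y i).1) (σ : Equiv.Perm (Fin n)) :
    listBracket br ι A (List.ofFn fun i => (y (σ i)).2) =
      koszulSign (fun i => (y i).1) σ • listBracket br ι A (List.ofFn fun i => (y i).2) := by
  induction n generalizing a A with
  | zero =>
    rw [Subsingleton.elim σ 1]
    simp [koszulSign]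
  | succ n ih =>
    -- The entry with index 0 is pulled to the front, and the induction hypothesis sorts the others.
    obtain ⟨j, hj⟩ := σ.surjective 0
    obtain ⟨τ, rfl⟩ := exists_eq_insertZero hj
    have h1 : (List.ofFn fun i => (y (insertZero j τ i)).2) =
        (List.ofFn fun i => y (insertZero j τ i)).map Prod.snd := by
      rw [List.map_ofFn]; rfl
    have h2 : ∀ x ∈ (List.ofFn fun i => y (τ i).succ), x.2 ∈ 𝒢 x.1 := by
      intro x hx
      rw [List.mem_ofFn] at hx
      obtain ⟨i, rfl⟩ := hx
      exact hy _
    rw [h1, ofFn_insertZero, hV.listBracket_append_cons hA _ _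
      (fun x hx => h2 x (List.mem_of_mem_take hx)) _ (hy 0), List.take_append_drop,
      List.map_ofFn, List.ofFn_succ (f := fun i => (y i).2), listBracket_cons]
    have := ih (hV.br_mem hA (hV.ι_mem (hy 0))) (fun i => y i.succ) (fun i => hy _) τ
    rw [koszulSign_insertZero, mul_smul, ← this]
    simp only [degSum, List.map_take, List.map_ofFn]
    rfl

/-- The generalized Jacobi identity for higher derived brackets, as a sum over splittings. -/
lemma splitSum_listBracket [CharZero K] (hV : IsVData 𝒜 𝒢 br ι P) {Δ : L} (hΔ : Δ ∈ 𝒜 1)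
    (hΔΔ : br Δ Δ = 0) (xs : List (ℤ × F)) (hxs : ∀ x ∈ xs, x.2 ∈ 𝒢 x.1) :
    (splitSum xs fun S T => P (listBracket br ι Δ
      (P (listBracket br ι Δ (S.map Prod.snd)) :: T.map Prod.snd))) = 0 := by
  set D : List (ℤ × F) → L := fun S => listBracket br ι Δ (S.map Prod.snd) with hD
  -- The projected Leibniz expansion of [⋯[[Δ, Δ], x₁], ⋯, xₙ] = 0.
  have h0 : (splitSum xs fun S T => Int.negOnePow (degSum S) • P (br (D S) (D T))) = 0 := by
    have h := hV.listBracket_br hΔ hΔ xs hxs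
    rw [hΔΔ, listBracket_zero] at h
    have h' := congrArg P h
    rw [map_zero, ← LinearMap.toAddMonoidHom_coe, map_splitSum] at h'
    rw [h']
    congr 1
    funext S T
    rw [LinearMap.toAddMonoidHom_coe, map_units_smul, one_mul]
  have hmem : ∀ S : List (ℤ × F), (∀ x ∈ S, x.2 ∈ 𝒢 x.1) → D S ∈ 𝒜 (1 + degSum S) :=
    fun S hS => hV.listBracket_mem hΔ S hS
  -- The element 𝒫(D S) has degree 1 + |S|, which determines the sign when it is moved in front of
  -- T.
  have hmove : ∀ S T : List (ℤ × F), (∀ x ∈ S, x.2 ∈ 𝒢 x.1) → (∀ x ∈ T, x.2 ∈ 𝒢 x.1) →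
      br (D T) (ι (P (D S))) = Int.negOnePow ((1 + degSum S) * degSum T) •
        listBracket br ι Δ (P (D S) :: T.map Prod.snd) := by
    intro S T hS hT
    have := hV.listBracket_append_cons hΔ T [] hT (1 + degSum S, P (D S)) (hV.P_mem (hmem S hS))
    rwa [List.map_append, List.map_cons, List.map_nil, listBracket_concat, List.append_nil] at this
  have h1 : (splitSum xs fun S T => Int.negOnePow (degSum S) • P (br (ι (P (D S))) (D T))) =
      splitSum xs fun S T => P (listBracket br ι Δ (P (D S) :: T.map Prod.snd)) := by
    refine splitSum_congr (fun x => x.2 ∈ 𝒢 x.1) xs hxs _ _ fun S T hS hT => ?_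
    rw [hV.br_swap (hV.ι_mem (hV.P_mem (hmem S hS))) (hmem T hT), hmove S T hS hT,
      map_units_smul, map_units_smul, smul_smul, smul_smul]
    convert one_smul ℤˣ _
    rw [← Int.negOnePow_succ, ← Int.negOnePow_add, ← Int.negOnePow_add]
    refine Int.negOnePow_even _ ⟨1 + degSum S + degSum T + degSum S * degSum T, by ring⟩
  -- Here 𝒫 falls on the block T, so S and T are first exchanged to bring the sum to the form of
  -- `h1`.
  have h2 : (splitSum xs fun S T => Int.negOnePow (degSum S) • P (br (D S) (ι (P (D T))))) =
      splitSum xs fun S T => P (listBracket br ι Δ (P (D S) :: T.map Prod.snd)) := by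
    rw [splitSum_swap]
    refine splitSum_congr (fun x => x.2 ∈ 𝒢 x.1) xs hxs _ _ fun S T hS hT => ?_
    rw [hmove S T hS hT, map_units_smul, smul_smul, smul_smul]
    convert one_smul ℤˣ _
    rw [← Int.negOnePow_add, ← Int.negOnePow_add]
    refine Int.negOnePow_even _ ⟨degSum T + degSum S * degSum T, by ring⟩
  have h3 : (splitSum xs fun S T => P (listBracket br ι Δ (P (D S) :: T.map Prod.snd)))
      + (splitSum xs fun S T => P (listBracket br ι Δ (P (D S) :: T.map Prod.snd))) = 0 := by
    nth_rewrite 1 [← h1]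
    rw [← h2, ← splitSum_add, ← h0]
    congr 1
    funext S T
    rw [← smul_add, ← hV.P_br]
  -- The two halves of 𝒫[D S, D T] contribute the same sum, so characteristic 0 allows division by
  -- 2.
  rw [← two_smul K] at h3
  exact (smul_eq_zero.mp h3).resolve_left two_ne_zero

/-- Voronov's theorem: higher derived brackets form an `L_∞`-algebra. -/
theorem isLInfinityAlgebra [CharZero K] (hV : IsVData 𝒜 𝒢 br ι P)
    (h𝒢 : DirectSum.IsInternal 𝒢) {Δ : L} (hΔ : Δ ∈ 𝒜 1) (hΔΔ : br Δ Δ = 0) (hPΔ : P Δ = 0)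
    (l : ∀ k : ℕ, MultilinearMap K (fun _ : Fin k => F) F)
    (hl : ∀ k x, l k x = P (listBracket br ι Δ (List.ofFn x))) :
    IsLInfinityAlgebra 𝒢 l where
  isInternal := h𝒢
  degree_one k _ d x hx := by
    rw [hl]
    have hmem := hV.listBracket_mem hΔ (List.ofFn fun i => (d i, x i)) (by
      intro y hy
      rw [List.mem_ofFn] at hy
      obtain ⟨i, rfl⟩ := hy
      exact hx i)
    have := hV.P_mem hmem
    simp only [degSum, List.map_ofFn, List.sum_ofFn] at this
    rw [add_comm]
    exact this
  graded_symm k _ d x hx σ := by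
    rw [hl, hl, ← map_units_smul]
    exact congrArg P (hV.listBracket_perm hΔ (fun i => (d i, x i)) hx σ)
  generalized_jacobi n _ d x hx := by
    have h := hV.splitSum_listBracket hΔ hΔΔ (List.ofFn fun i => (d i, x i)) (by
      intro y hy
      rw [List.mem_ofFn] at hy
      obtain ⟨i, rfl⟩ := hy
      exact hx i)
    -- The splitting with S empty would contribute the bracket l₀ = 𝒫Δ. It vanishes, which leaves
    -- the blocks of size i + 1 in the Jacobi identity.
    rw [splitSum_ofFn, Fin.sum_univ_succ, Finset.sum_eq_zero, zero_add] at h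
    · rw [← h]
      refine Finset.sum_congr rfl fun i _ => ?_
      have hi := i.isLt
      refine Finset.sum_congr ?_ fun σ _ => ?_
      · ext σ
        simp only [unshuffles, shuffles, Finset.mem_filter, Finset.mem_univ, true_and, Fin.val_succ]
        constructor
        · rintro ⟨h1, h2⟩
          exact ⟨h1, fun a b ha hab _ => h2 a b ha hab, fun a ha => by omega⟩
        · rintro ⟨h1, h2, -⟩
          exact ⟨h1, fun a b ha hab => h2 a b ha hab (by omega)⟩
      · congr 1
        rw [hl, hl, List.ofFn_cons]
        congr 3
        · congr 2
          refine List.ext_getElem (by simp) fun m h1 h2 => ?_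
          simp only [List.getElem_ofFn, List.getElem_map, List.getElem_take]
        · refine List.ext_getElem (by simp) fun m h1 h2 => ?_
          simp only [List.getElem_ofFn, List.getElem_map, List.getElem_drop]
          rfl
    · intro σ _
      simp [listBracket_nil, hPΔ, listBracket_cons, listBracket_zero]

end IsVData

end HigherDerivedBrackets

/-! ### Naturality of the circle product and of contraction -/

section Transport

variable {V W V' W' : Type*} [AddCommGroup V] [Module K V] [AddCommGroup W] [Module K W]
  [AddCommGroup V'] [Module K V'] [AddCommGroup W'] [Module K W']

/-- To prove a linear property of bivectors it suffices to consider decomposable ones. -/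
lemma wedge_induction {p : ⋀[K]^2 V → Prop} (hw : ∀ x y, p (wedge x y)) (h0 : p 0)
    (hadd : ∀ a b, p a → p b → p (a + b)) (hsmul : ∀ (c : K) a, p a → p (c • a))
    (x : ⋀[K]^2 V) : p x := by
  have hx : x ∈ Submodule.span K (Set.range (exteriorPower.ιMulti K 2 (M := V))) := by
    rw [exteriorPower.ιMulti_span]; trivial
  induction hx using Submodule.span_induction with
  | mem x hx =>
    obtain ⟨v, rfl⟩ := hx
    have : exteriorPower.ιMulti K 2 v = wedge (v 0) (v 1) := by
      rw [wedge]; congr 1; ext i; fin_cases i <;> rfl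
    rw [this]
    exact hw _ _
  | zero => exact h0
  | add a b _ _ ha hb => exact hadd a b ha hb
  | smul c a _ ha => exact hsmul c a ha

lemma map_wedge (j : V' →ₗ[K] V) (x y : V') :
    exteriorPower.map 2 j (wedge x y) = wedge (j x) (j y) := by
  rw [wedge, exteriorPower.map_apply_ιMulti, wedge]
  congr 1
  ext a; fin_cases a <;> rfl

lemma derivExt_map (j : V' →ₗ[K] V) (A : V →ₗ[K] V) (A' : V' →ₗ[K] V')
    (h : ∀ z, A (j z) = j (A' z)) (x : ⋀[K]^2 V') :
    derivExt A (exteriorPower.map 2 j x) = exteriorPower.map 2 j (derivExt A' x) := by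
  induction x using wedge_induction with
  | hw x y => simp only [map_wedge, derivExt_wedge, map_add, h]
  | h0 => simp
  | hadd a b ha hb => simp only [map_add, ha, hb]
  | hsmul c a ha => simp only [map_smul, ha]

lemma permSeq_comp {α β : Type*} (f : α → β) {n : ℕ} (σ : Equiv.Perm (Fin n)) (X : ℕ → α) :
    (permSeq σ fun i => f (X i)) = fun i => f (permSeq σ X i) := by
  funext i
  simp only [permSeq]
  split_ifs <;> rfl

/-- Naturality of the circle product. -/
lemma evalSeq_circ_map (j : V' →ₗ[K] V) (r : W →ₗ[K] W') {p q : ℕ} {P : PreCochain K V W p}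
    {P' : PreCochain K V' W' p} {Q : PreCochain K V V q} {Q' : PreCochain K V' V' q}
    (hP : ∀ X z, r (evalSeq P (fun i => exteriorPower.map 2 j (X i)) (j z)) = evalSeq P' X z)
    (hQ : ∀ X z, evalSeq Q (fun i => exteriorPower.map 2 j (X i)) (j z) = j (evalSeq Q' X z))
    (X : ℕ → ⋀[K]^2 V') (z : V') :
    r (evalSeq (circ P Q) (fun i => exteriorPower.map 2 j (X i)) (j z)) =
      evalSeq (circ P' Q') X z := by
  have hs : ∀ k Y, (seqArgs Q k fun i => exteriorPower.map 2 j (Y i)) =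
      fun i => exteriorPower.map 2 j (seqArgs Q' k Y i) := by
    intro k Y
    funext a
    simp only [seqArgs]
    split_ifs
    · rfl
    · exact derivExt_map j _ _ (hQ _) _
    · rfl
  simp only [evalSeq_circ, shuffleSum, map_add, map_sum, map_units_smul, permSeq_comp, hs, hP, hQ]

lemma lof_eq_zero {n : ℕ} {f : Cochain K V W n} (h : ∀ X z, evalSeq f.1 X z = 0) :
    DirectSum.lof K ℕ (Cochain K V W) n f = 0 := by
  rw [← map_zero (DirectSum.lof K ℕ (Cochain K V W) n)]
  exact lof_eq_lof rfl h

variable (K) in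
/-- `transport` on the whole graded vector space. -/
def transportT (j : V' →ₗ[K] V) (r : W →ₗ[K] W') :
    CochainSpace K V W →ₗ[K] CochainSpace K V' W' :=
  DirectSum.lmap fun n => transport j r n

lemma transportT_lof (j : V' →ₗ[K] V) (r : W →ₗ[K] W') {n : ℕ} (f : Cochain K V W n) :
    transportT K j r (DirectSum.lof K ℕ _ n f) = DirectSum.lof K ℕ _ n (transport j r n f) :=
  DirectSum.lmap_lof ..

lemma evalSeq_transport (j : V' →ₗ[K] V) (r : W →ₗ[K] W') {n : ℕ} (f : Cochain K V W n)
    (X : ℕ → ⋀[K]^2 V') (z : V') :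
    evalSeq (transport j r n f).1 X z =
      r (evalSeq f.1 (fun i => exteriorPower.map 2 j (X i)) (j z)) := rfl

lemma transportT_mem (j : V' →ₗ[K] V) (r : W →ₗ[K] W') {n : ℕ} {f : CochainSpace K V W}
    (hf : f ∈ homog K V W n) : transportT K j r f ∈ homog K V' W' n := by
  obtain ⟨f, rfl⟩ := hf
  rw [transportT_lof]
  exact lof_mem_homog _

lemma contract_transportT (j : V' →ₗ[K] V) (r : W →ₗ[K] W') (f : CochainSpace K V W)
    (x : ⋀[K]^2 V') :
    contract V' W' x (transportT K j r f) =
      transportT K j r (contract V W (exteriorPower.map 2 j x) f) := by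
  induction f using DirectSum.induction_on with
  | zero => simp
  | add f f' h h' => simp only [map_add, h, h']
  | of n f =>
    change contract V' W' x (transportT K j r (DirectSum.lof K ℕ _ n f)) =
      transportT K j r (contract V W (exteriorPower.map 2 j x) (DirectSum.lof K ℕ _ n f))
    rw [transportT_lof]
    rcases n with _ | n
    · rw [contract_lof_zero, contract_lof_zero, map_zero]
    · rw [contract_lof_succ, contract_lof_succ, transportT_lof]
      refine lof_eq_lof rfl fun X z => ?_
      rw [evalSeq_contractC, evalSeq_transport, evalSeq_transport, evalSeq_contractC]
      congr 3
      funext i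
      simp only [seqInsert]
      split_ifs <;> rfl

end Transport

/-! ### Voronov's data on C^*(g ⊕ h, g ⊕ h) -/

section VData

variable {V W : Type*} [AddCommGroup V] [Module K V] [AddCommGroup W] [Module K W]

variable (K V W) in
/-- The `ℤ`-grading of `C^*(V, W)`. -/
def gradingZ : ℤ → Submodule K (CochainSpace K V W)
  | Int.ofNat n => homog K V W n
  | Int.negSucc _ => ⊥

lemma gradingZ_cases {i : ℤ} {a : CochainSpace K V W} (ha : a ∈ gradingZ K V W i) :
    a = 0 ∨ ∃ n : ℕ, i = n ∧ a ∈ homog K V W n := by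
  rcases i with n | n
  · exact Or.inr ⟨n, rfl, ha⟩
  · exact Or.inl ha

lemma mem_gradingZ {n : ℕ} {a : CochainSpace K V W} (ha : a ∈ homog K V W n) :
    a ∈ gradingZ K V W n := ha

lemma negOnePow_natCast (n : ℕ) : Int.negOnePow n = (-1 : ℤˣ) ^ n := by
  rw [Int.negOnePow_def, zpow_natCast]

variable (K V W) in
/-- The decomposition of `C^*(V, W)` with respect to its `ℤ`-grading. -/
lemma isInternal_gradingZ : DirectSum.IsInternal (gradingZ K V W) := by
  classical
  -- The ℕ-grading is extended by zero: the decomposition map sends the n-th summand to the integer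
  -- degree n, and negative degrees contribute nothing.
  refine (DirectSum.Decomposition.ofLinearMap (gradingZ K V W)
    (DirectSum.toModule K ℕ _ fun n =>
      DirectSum.lof K ℤ (fun i => gradingZ K V W i) n ∘ₗ
        (DirectSum.lof K ℕ (Cochain K V W) n).codRestrict (gradingZ K V W n)
          fun f => lof_mem_homog f) ?_ ?_).isInternal
  · refine DirectSum.linearMap_ext K fun n => LinearMap.ext fun f => ?_
    simp [DirectSum.toModule_lof]
    rfl
  · refine DirectSum.linearMap_ext K fun i => LinearMap.ext fun ⟨a, ha⟩ => ?_
    rcases i with n | n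
    · obtain ⟨f, rfl⟩ := ha
      simp [DirectSum.toModule_lof]
      rfl
    · obtain rfl : a = 0 := ha
      exact (map_zero _).trans (map_zero _).symm

lemma gradingF_eq {g h : Type*} [AddCommGroup g] [Module K g] [AddCommGroup h] [Module K h] :
    gradingF K g h = gradingZ K h g := by
  funext i
  rcases i with n | n <;> rfl

variable (g h : Type*) [AddCommGroup g] [Module K g] [AddCommGroup h] [Module K h]

lemma inclF_eq : inclF K g h = transportT K (LinearMap.snd K g h) (LinearMap.inl K g h) := rfl

lemma projF_eq : projF K g h = transportT K (LinearMap.inr K g h) (LinearMap.fst K g h) := rfl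

variable {g h}

lemma projF_inclF (a : CochainSpace K h g) : projF K g h (inclF K g h a) = a := by
  induction a using DirectSum.induction_on with
  | zero => simp
  | add a b ha hb => simp only [map_add, ha, hb]
  | of n f =>
    change projF K g h (inclF K g h (DirectSum.lof K ℕ _ n f)) = DirectSum.lof K ℕ _ n f
    rw [inclF_eq, projF_eq, transportT_lof, transportT_lof]
    refine lof_eq_lof rfl fun X z => ?_
    rw [evalSeq_transport, evalSeq_transport]
    have : ∀ x : ⋀[K]^2 h, exteriorPower.map 2 (LinearMap.snd K g h)
        (exteriorPower.map 2 (LinearMap.inr K g h) x) = x := fun x => by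
      rw [← LinearMap.comp_apply, ← exteriorPower.map_comp, LinearMap.snd_comp_inr,
        exteriorPower.map_id, LinearMap.id_apply]
    simp [this]

/-- An extended cochain takes values in g and sees only the h-components of its arguments. By
naturality along the projection to h, the inner factor may therefore be replaced by zero. -/
lemma circT_inclF (a b : CochainSpace K h g) :
    circT K (g × h) (inclF K g h a) (inclF K g h b) = 0 := by
  induction a using DirectSum.induction_on with
  | zero => simp
  | add a a' ha ha' => simp only [map_add, LinearMap.add_apply, ha, ha', add_zero]
  | of p P =>
    induction b using DirectSum.induction_on with
    | zero => simp
    | add b b' hb hb' => simp only [map_add, hb, hb', add_zero]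
    | of q Q =>
      change circT K (g × h) (inclF K g h (DirectSum.lof K ℕ _ p P))
        (inclF K g h (DirectSum.lof K ℕ _ q Q)) = 0
      rw [inclF_eq, transportT_lof, transportT_lof, circT_lof]
      refine lof_eq_zero fun X z => ?_
      have h0 : circ P.1 (0 : PreCochain K h h q) = 0 := by
        simpa using circ_smul_right (0 : K) P.1 (0 : PreCochain K h h q)
      refine (evalSeq_circ_map (LinearMap.snd K g h) (LinearMap.inl K g h) (P := P.1) (Q := 0)
        (fun X z => rfl) (fun X z => rfl) X z).symm.trans ?_
      rw [h0]
      exact map_zero _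

/-- A cochain is in the kernel of the projection when it maps arguments from h into h. Such cochains
are stable under composition: naturality along the inclusion of h replaces Q by its restriction to h
and P by zero. -/
lemma projF_circT {p q : ℕ} {P Q : CochainSpace K (g × h) (g × h)}
    (hP : P ∈ homog K (g × h) (g × h) p) (hQ : Q ∈ homog K (g × h) (g × h) q)
    (hP0 : projF K g h P = 0) (hQ0 : projF K g h Q = 0) :
    projF K g h (circT K (g × h) P Q) = 0 := by
  obtain ⟨P, rfl⟩ := hP
  obtain ⟨Q, rfl⟩ := hQ
  rw [projF_eq, transportT_lof] at hP0 hQ0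
  have hP1 := DirectSum.of_injective (β := Cochain K h g) p (hP0.trans (map_zero _).symm)
  have hQ1 := DirectSum.of_injective (β := Cochain K h g) q (hQ0.trans (map_zero _).symm)
  rw [projF_eq, circT_lof, transportT_lof]
  refine lof_eq_zero fun X z => ?_
  rw [evalSeq_transport]
  have h0 : circ (0 : PreCochain K h g p) (transport (LinearMap.inr K g h) (LinearMap.snd K g h) q Q).1
      = 0 := by
    simpa using circ_smul_left (0 : K) (0 : PreCochain K h g p)
      (transport (LinearMap.inr K g h) (LinearMap.snd K g h) q Q).1
  refine (evalSeq_circ_map (LinearMap.inr K g h) (LinearMap.fst K g h) (P := P.1) (Q := Q.1)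
    (P' := 0) (Q' := (transport (LinearMap.inr K g h) (LinearMap.snd K g h) q Q).1)
    (fun X z => ?_) (fun X z => ?_) X z).trans ?_
  · exact congrArg (fun f : Cochain K h g p => evalSeq f.1 X z) hP1
  · refine Prod.ext ?_ rfl
    exact congrArg (fun f : Cochain K h g q => evalSeq f.1 X z) hQ1
  · rw [h0]; rfl

lemma projF_lieBracket {p q : ℕ} {P Q : CochainSpace K (g × h) (g × h)}
    (hP : P ∈ homog K (g × h) (g × h) p) (hQ : Q ∈ homog K (g × h) (g × h) q)
    (hP0 : projF K g h P = 0) (hQ0 : projF K g h Q = 0) :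
    projF K g h (lieBracket K (g × h) P Q) = 0 := by
  rw [lieBracket_eq hP hQ, map_sub, map_units_smul, projF_circT hP hQ hP0 hQ0,
    projF_circT hQ hP hQ0 hP0, smul_zero, sub_zero]

lemma inclF_mem {n : ℕ} {a : CochainSpace K h g} (ha : a ∈ homog K h g n) :
    inclF K g h a ∈ homog K (g × h) (g × h) n := transportT_mem _ _ ha

lemma projF_mem {n : ℕ} {a : CochainSpace K (g × h) (g × h)}
    (ha : a ∈ homog K (g × h) (g × h) n) : projF K g h a ∈ homog K h g n := transportT_mem _ _ ha

lemma lieBracket_inclF (a b : CochainSpace K h g) :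
    lieBracket K (g × h) (inclF K g h a) (inclF K g h b) = 0 := by
  induction a using DirectSum.induction_on with
  | zero => simp
  | add a a' ha ha' => simp only [map_add, LinearMap.add_apply, ha, ha', add_zero]
  | of p P =>
    induction b using DirectSum.induction_on with
    | zero => simp
    | add b b' hb hb' => simp only [map_add, hb, hb', add_zero]
    | of q Q =>
      refine (lieBracket_eq (inclF_mem (lof_mem_homog P)) (inclF_mem (lof_mem_homog Q))).trans ?_
      rw [circT_inclF, circT_inclF, smul_zero, sub_zero]

/-- The elements a - 𝒫a and b - 𝒫b lie in the kernel of 𝒫, hence so does their bracket; the term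
[𝒫a, 𝒫b] of its expansion is zero because F is abelian. -/
lemma projF_lieBracket_eq (a b : CochainSpace K (g × h) (g × h)) :
    projF K g h (lieBracket K (g × h) a b) =
      projF K g h (lieBracket K (g × h) (inclF K g h (projF K g h a)) b)
        + projF K g h (lieBracket K (g × h) a (inclF K g h (projF K g h b))) := by
  induction a using DirectSum.induction_on with
  | zero => simp
  | add a a' ha ha' => simp only [map_add, LinearMap.add_apply, ha, ha']; abel
  | of p P =>
    induction b using DirectSum.induction_on with
    | zero => simp
    | add b b' hb hb' => simp only [map_add, hb, hb']; abel
    | of q Q =>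
      have hP : DirectSum.of (Cochain K (g × h) (g × h)) p P ∈ homog K (g × h) (g × h) p :=
        lof_mem_homog P
      have hQ : DirectSum.of (Cochain K (g × h) (g × h)) q Q ∈ homog K (g × h) (g × h) q :=
        lof_mem_homog Q
      generalize DirectSum.of (Cochain K (g × h) (g × h)) p P = a at hP ⊢
      generalize DirectSum.of (Cochain K (g × h) (g × h)) q Q = b at hQ ⊢
      have h1 := projF_lieBracket (sub_mem hP (inclF_mem (projF_mem hP)))
        (sub_mem hQ (inclF_mem (projF_mem hQ))) (by rw [map_sub, projF_inclF, sub_self])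
        (by rw [map_sub, projF_inclF, sub_self])
      simp only [map_sub, LinearMap.sub_apply, lieBracket_inclF, sub_zero] at h1
      rw [← sub_eq_zero, ← h1]
      abel

variable (K g h) in
-- Negative degrees contain only 0, so each axiom reduces to the corresponding statement for natural
-- degrees.
lemma isVData : IsVData (gradingZ K (g × h) (g × h)) (gradingZ K h g) (lieBracket K (g × h))
    (inclF K g h) (projF K g h) where
  br_mem {i j a b} ha hb := by
    rcases gradingZ_cases ha with rfl | ⟨p, rfl, ha⟩
    · simp
    rcases gradingZ_cases hb with rfl | ⟨q, rfl, hb⟩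
    · simp
    rw [← Nat.cast_add]
    exact mem_gradingZ (lieBracket_mem ha hb)
  br_swap {i j a b} ha hb := by
    rcases gradingZ_cases ha with rfl | ⟨p, rfl, ha⟩
    · simp
    rcases gradingZ_cases hb with rfl | ⟨q, rfl, hb⟩
    · simp
    rw [← Nat.cast_mul, negOnePow_natCast]
    exact lieBracket_swap ha hb
  jacobi {i j k a b c} ha hb hc := by
    rcases gradingZ_cases ha with rfl | ⟨p, rfl, ha⟩
    · simp
    rcases gradingZ_cases hb with rfl | ⟨q, rfl, hb⟩
    · simp
    rcases gradingZ_cases hc with rfl | ⟨r, rfl, hc⟩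
    · simp
    rw [← Nat.cast_mul, negOnePow_natCast]
    exact lieBracket_lieBracket ha hb hc
  ι_mem {i a} ha := by
    rcases gradingZ_cases ha with rfl | ⟨p, rfl, ha⟩
    · simp
    exact mem_gradingZ (inclF_mem ha)
  P_mem {i a} ha := by
    rcases gradingZ_cases ha with rfl | ⟨p, rfl, ha⟩
    · simp
    exact mem_gradingZ (projF_mem ha)
  abelian := lieBracket_inclF
  P_br := projF_lieBracket_eq

end VData

/-! ### A 3-Lie bracket as a Maurer-Cartan element -/

section AlternatingThree

variable {V W : Type*} [AddCommGroup V] [Module K V] [AddCommGroup W] [Module K W]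

lemma alt₃_swap₀₁ (f : V [⋀^Fin 3]→ₗ[K] W) (x y z : V) : f ![x, y, z] = -f ![y, x, z] := by
  rw [← f.map_swap ![y, x, z] (i := 0) (j := 1) (by decide)]
  congr 1
  ext i; fin_cases i <;> rfl

lemma alt₃_swap₁₂ (f : V [⋀^Fin 3]→ₗ[K] W) (x y z : V) : f ![x, y, z] = -f ![x, z, y] := by
  rw [← f.map_swap ![x, z, y] (i := 1) (j := 2) (by decide)]
  congr 1
  ext i; fin_cases i <;> rfl

lemma alt₃_add₀ (f : V [⋀^Fin 3]→ₗ[K] W) (x x' y z : V) :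
    f ![x + x', y, z] = f ![x, y, z] + f ![x', y, z] := by
  have hu : ∀ t, Function.update ![x, y, z] 0 t = ![t, y, z] := fun t => by
    ext i; fin_cases i <;> rfl
  have := f.map_update_add ![x, y, z] 0 x x'
  rwa [hu, hu, hu] at this

lemma alt₃_smul₀ (f : V [⋀^Fin 3]→ₗ[K] W) (c : K) (x y z : V) :
    f ![c • x, y, z] = c • f ![x, y, z] := by
  have hu : ∀ t, Function.update ![x, y, z] 0 t = ![t, y, z] := fun t => by
    ext i; fin_cases i <;> rfl
  have := f.map_update_smul ![x, y, z] 0 c x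
  rwa [hu, hu] at this

lemma alt₃_add₁ (f : V [⋀^Fin 3]→ₗ[K] W) (x y y' z : V) :
    f ![x, y + y', z] = f ![x, y, z] + f ![x, y', z] := by
  rw [alt₃_swap₀₁, alt₃_add₀, alt₃_swap₀₁ f y, alt₃_swap₀₁ f y']; abel

lemma alt₃_smul₁ (f : V [⋀^Fin 3]→ₗ[K] W) (c : K) (x y z : V) :
    f ![x, c • y, z] = c • f ![x, y, z] := by
  rw [alt₃_swap₀₁, alt₃_smul₀, alt₃_swap₀₁ f y, smul_neg, neg_neg]

lemma alt₃_add₂ (f : V [⋀^Fin 3]→ₗ[K] W) (x y z z' : V) :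
    f ![x, y, z + z'] = f ![x, y, z] + f ![x, y, z'] := by
  rw [alt₃_swap₁₂, alt₃_add₁, alt₃_swap₁₂ f x z, alt₃_swap₁₂ f x z']; abel

lemma alt₃_smul₂ (f : V [⋀^Fin 3]→ₗ[K] W) (c : K) (x y z : V) :
    f ![x, y, c • z] = c • f ![x, y, z] := by
  rw [alt₃_swap₁₂, alt₃_smul₁, alt₃_swap₁₂ f x z, smul_neg, neg_neg]

lemma alt₃_zero₀ (f : V [⋀^Fin 3]→ₗ[K] W) (y z : V) : f ![0, y, z] = 0 := by
  simpa using alt₃_smul₀ f 0 0 y z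

lemma alt₃_zero₁ (f : V [⋀^Fin 3]→ₗ[K] W) (x z : V) : f ![x, 0, z] = 0 := by
  simpa using alt₃_smul₁ f 0 x 0 z

lemma alt₃_zero₂ (f : V [⋀^Fin 3]→ₗ[K] W) (x y : V) : f ![x, y, 0] = 0 := by
  simpa using alt₃_smul₂ f 0 x y 0

lemma alt₂_zero_left (f : V [⋀^Fin 2]→ₗ[K] W) (y : V) : f ![0, y] = 0 := by
  simpa using alt₂_smul_left f 0 0 y

lemma alt₂_zero_right (f : V [⋀^Fin 2]→ₗ[K] W) (x : V) : f ![x, 0] = 0 := by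
  simpa using alt₂_smul_right f 0 x 0

lemma contract_ofAlternating (f : V [⋀^Fin 3]→ₗ[K] W) (x : ⋀[K]^2 V) :
    contract V W x (DirectSum.lof K ℕ _ 1 (ofAlternating f)) =
      DirectSum.lof K ℕ _ 0 (ofLinear (curryAlt f x)) := by
  rw [contract_lof_succ]
  rfl

lemma lof_ofLinear_add (S T : V →ₗ[K] W) :
    DirectSum.lof K ℕ (Cochain K V W) 0 (ofLinear S) + DirectSum.lof K ℕ _ 0 (ofLinear T) =
      DirectSum.lof K ℕ _ 0 (ofLinear (S + T)) := by
  rw [← map_add]; rfl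

lemma lof_ofLinear_sub (S T : V →ₗ[K] W) :
    DirectSum.lof K ℕ (Cochain K V W) 0 (ofLinear S) - DirectSum.lof K ℕ _ 0 (ofLinear T) =
      DirectSum.lof K ℕ _ 0 (ofLinear (S - T)) := by
  rw [← map_sub]; rfl

lemma lof_ofLinear_neg (S : V →ₗ[K] W) :
    -DirectSum.lof K ℕ (Cochain K V W) 0 (ofLinear S) = DirectSum.lof K ℕ _ 0 (ofLinear (-S)) := by
  rw [← map_neg]; rfl

lemma lof_ofLinear_smul (c : K) (S : V →ₗ[K] W) :
    c • DirectSum.lof K ℕ (Cochain K V W) 0 (ofLinear S) =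
      DirectSum.lof K ℕ _ 0 (ofLinear (c • S)) := by
  rw [← map_smul]; rfl

lemma ofLinear_injective : Function.Injective
    fun T : V →ₗ[K] W => DirectSum.lof K ℕ (Cochain K V W) 0 (ofLinear T) := by
  intro S T h
  have h1 := DirectSum.of_injective (β := Cochain K V W) 0 h
  exact congrArg (fun f : Cochain K V W 0 => f.1 0) h1

lemma lof_ofLinear_zero : DirectSum.lof K ℕ (Cochain K V W) 0 (ofLinear 0) = 0 :=
  map_zero (DirectSum.lof K ℕ (Cochain K V W) 0)

/-- The Maurer-Cartan equation `[s, s] = 0` for a 3-Lie bracket `s`. -/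
lemma lieBracket_self_ofAlternating (s : Bracket K V) :
    lieBracket K V (DirectSum.lof K ℕ _ 1 (ofAlternating s.br))
      (DirectSum.lof K ℕ _ 1 (ofAlternating s.br)) = 0 := by
  set Δ := DirectSum.lof K ℕ (Cochain K V V) 1 (ofAlternating s.br) with hΔdef
  have hΔ : Δ ∈ homog K V V 1 := lof_mem_homog _
  -- The operator obtained from Δ ∘ Δ by contracting with x and then y. On decomposable bivectors
  -- its vanishing is the fundamental identity: x acts as a derivation.
  have key : ∀ x y : ⋀[K]^2 V, -(curryAlt s.br x ∘ₗ curryAlt s.br y)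
      + (curryAlt s.br y ∘ₗ curryAlt s.br x + curryAlt s.br (derivExt (curryAlt s.br x) y)) = 0 := by
    intro x y
    induction x using wedge_induction with
    | h0 => simp
    | hadd a b ha hb =>
      have := congrArg₂ (· + ·) ha hb
      simp only [add_zero] at this
      rw [← this]
      simp only [map_add, LinearMap.add_apply, LinearMap.comp_add, LinearMap.add_comp]
      abel
    | hsmul c a ha =>
      have := congrArg (c • ·) ha
      simp only [smul_zero] at this
      rw [← this]
      simp only [map_smul, LinearMap.smul_apply, LinearMap.comp_smul, LinearMap.smul_comp,
        smul_add, smul_neg]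
    | hw a b =>
      induction y using wedge_induction with
      | h0 => simp
      | hadd c d hc hd =>
        have := congrArg₂ (· + ·) hc hd
        simp only [add_zero] at this
        rw [← this]
        simp only [map_add, LinearMap.comp_add, LinearMap.add_comp]
        abel
      | hsmul t c hc =>
        have := congrArg (t • ·) hc
        simp only [smul_zero] at this
        rw [← this]
        simp only [map_smul, LinearMap.comp_smul, LinearMap.smul_comp, smul_add, smul_neg]
      | hw c d =>
        ext e
        simp only [derivExt_wedge, map_add, LinearMap.add_apply, LinearMap.neg_apply,
          LinearMap.comp_apply, curryAlt_wedge, s.fundamental_identity a b c d e,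
          LinearMap.zero_apply]
        abel
  have h0 : circT K V Δ Δ = 0 := by
    refine eq_zero_of_contract (n := 1) (circT_mem hΔ hΔ) fun x => ?_
    have hx : contract V V x Δ ∈ homog K V V 0 := contract_mem_homog x hΔ
    have hm : contract V V x (circT K V Δ Δ) ∈ homog K V V 1 :=
      contract_mem_homog (n := 1) x (circT_mem hΔ hΔ)
    refine eq_zero_of_contract (n := 0) hm fun y => ?_
    -- The first contraction makes one factor a cochain of degree 0, so the second one produces the
    -- correction term of `contract_circT_ofLinear`; this is the third summand of `key`.
    rw [contract_circT_succ (q := 0) x Δ hΔ, map_add, map_units_smul,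
      contract_circT_succ (q := 0) y _ hΔ, contract_eq_zero y hx, hΔdef, contract_ofAlternating,
      contract_ofAlternating, contract_circT_ofLinear, contract_ofAlternating,
      contract_ofAlternating, circT_ofLinear, circT_ofLinear, map_zero, LinearMap.zero_apply,
      smul_zero, zero_add, zero_add, pow_one, Units.neg_smul, one_smul, lof_ofLinear_add,
      lof_ofLinear_neg, lof_ofLinear_add, key, lof_ofLinear_zero]
  rw [lieBracket_eq hΔ hΔ, h0, smul_zero, sub_zero]

end AlternatingThree

/-! ### The semidirect product 3-Lie algebra -/

section Semidirect

variable {g h : Type*} [AddCommGroup g] [Module K g] [AddCommGroup h] [Module K h]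

lemma semidirect_apply (π : Bracket K g) (μ : Bracket K h) (ρ : g [⋀^Fin 2]→ₗ[K] Module.End K h)
    (lam : K) (a b c : g × h) : semidirect π μ ρ lam ![a, b, c] =
      (π.br ![a.1, b.1, c.1], ρ ![a.1, b.1] c.2 + ρ ![b.1, c.1] a.2
        + ρ ![c.1, a.1] b.2 + lam • μ.br ![a.2, b.2, c.2]) := rfl

/-- The semidirect product 3-Lie algebra. -/
def semidirectBracket {π : Bracket K g} {μ : Bracket K h} {ρ : g [⋀^Fin 2]→ₗ[K] Module.End K h}
    (hρ : IsAction π μ ρ) (lam : K) : Bracket K (g × h) where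
  br := semidirect π μ ρ lam
  fundamental_identity := by
    rintro ⟨x₁, u₁⟩ ⟨x₂, u₂⟩ ⟨x₃, u₃⟩ ⟨x₄, u₄⟩ ⟨x₅, u₅⟩
    simp only [semidirect_apply, Prod.mk_add_mk]
    refine Prod.ext (π.fundamental_identity x₁ x₂ x₃ x₄ x₅) ?_
    -- All mixed terms in ρ and μ vanish: the values of ρ are central, and ρ annihilates brackets.
    have hc₀ : ∀ x y u v w, μ.br ![ρ ![x, y] u, v, w] = 0 := fun x y u v w => hρ.mem_center x y u v w
    have hc₁ : ∀ x y u v w, μ.br ![v, ρ ![x, y] u, w] = 0 := fun x y u v w => by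
      rw [alt₃_swap₀₁, hc₀, neg_zero]
    have hc₂ : ∀ x y u v w, μ.br ![v, w, ρ ![x, y] u] = 0 := fun x y u v w => by
      rw [alt₃_swap₁₂, hc₁, neg_zero]
    simp only [map_add, map_smul, alt₃_add₀, alt₃_add₁, alt₃_add₂, alt₃_smul₀, alt₃_smul₁,
      alt₃_smul₂, hc₀, hc₁, hc₂, hρ.apply_bracket, smul_zero, add_zero, zero_add]
    have r₁ : ∀ x₁ x₂ x₃ x₄ u, ρ ![x₁, x₂] (ρ ![x₃, x₄] u) = ρ ![π.br ![x₁, x₂, x₃], x₄] u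
        + ρ ![x₃, π.br ![x₁, x₂, x₄]] u + ρ ![x₃, x₄] (ρ ![x₁, x₂] u) :=
      fun x₁ x₂ x₃ x₄ u => LinearMap.congr_fun (hρ.rep₁ x₁ x₂ x₃ x₄) u
    have r₂ : ∀ x₁ x₂ x₃ x₄ u, ρ ![x₁, π.br ![x₂, x₃, x₄]] u = ρ ![x₃, x₄] (ρ ![x₁, x₂] u)
        - ρ ![x₂, x₄] (ρ ![x₁, x₃] u) + ρ ![x₂, x₃] (ρ ![x₁, x₄] u) :=
      fun x₁ x₂ x₃ x₄ u => LinearMap.congr_fun (hρ.rep₂ x₁ x₂ x₃ x₄) u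
    have sw : ∀ x y u, ρ ![x, y] u = -ρ ![y, x] u := fun x y u => by
      rw [alt₂_swap]; rfl
    -- The remaining terms are sorted by the single argument taken from h: in one of the last three
    -- places the first representation identity applies, in one of the first two places the second.
    rw [r₁ x₁ x₂ x₃ x₄ u₅, r₁ x₁ x₂ x₄ x₅ u₃, r₁ x₁ x₂ x₅ x₃ u₄, r₂ x₂ x₃ x₄ x₅ u₁,
      sw _ x₁ u₂, r₂ x₁ x₃ x₄ x₅ u₂, μ.fundamental_identity u₁ u₂ u₃ u₄ u₅, sw x₃ x₁ u₂,
      sw x₄ x₁ u₂, sw x₅ x₁ u₂, sw x₅ x₃]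
    simp only [sw x₅ x₃, map_neg, smul_add]
    abel

end Semidirect

/-! ### A scaling automorphism that separates the brackets -/

section Scaling

lemma listBracket_smul {L F : Type*} [AddCommGroup L] [Module K L] [AddCommGroup F] [Module K F]
    (br : L →ₗ[K] L →ₗ[K] L) (ι : F →ₗ[K] L) (c : K) (A : L) (xs : List F) :
    listBracket br ι (c • A) xs = c • listBracket br ι A xs := by
  induction xs generalizing A with
  | nil => rfl
  | cons x xs ih => simp only [listBracket_cons, map_smul, LinearMap.smul_apply, ih]

variable {g h : Type*} [AddCommGroup g] [Module K g] [AddCommGroup h] [Module K h]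

variable (K g h) in
/-- The map `(x, u) ↦ (x, c u)` of `g ⊕ h`. -/
def stretch (c : K) : g × h →ₗ[K] g × h := LinearMap.prodMap LinearMap.id (c • LinearMap.id)

lemma stretch_apply (c : K) (a : g × h) : stretch K g h c a = (a.1, c • a.2) := rfl

lemma map_smul_exteriorPower {V W : Type*} [AddCommGroup V] [Module K V] [AddCommGroup W]
    [Module K W] (c : K) (j : V →ₗ[K] W) (x : ⋀[K]^2 V) :
    exteriorPower.map 2 (c • j) x = (c * c) • exteriorPower.map 2 j x := by
  induction x using wedge_induction with
  | hw x y =>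
    simp only [map_wedge, LinearMap.smul_apply, wedge_smul_left, wedge_smul_right, smul_smul]
  | h0 => simp
  | hadd a b ha hb => simp only [map_add, ha, hb, smul_add]
  | hsmul t a ha => rw [map_smul, map_smul, ha, smul_comm]

lemma map_map_exteriorPower {U V W : Type*} [AddCommGroup U] [Module K U] [AddCommGroup V]
    [Module K V] [AddCommGroup W] [Module K W] (i : V →ₗ[K] W) (j : U →ₗ[K] V) (x : ⋀[K]^2 U) :
    exteriorPower.map 2 i (exteriorPower.map 2 j x) = exteriorPower.map 2 (i ∘ₗ j) x := by
  rw [exteriorPower.map_comp]; rfl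

lemma evalSeq_smul {V W : Type*} [AddCommGroup V] [Module K V] [AddCommGroup W] [Module K W]
    {n : ℕ} (f : PreCochain K V W n) (c : K) (X : ℕ → ⋀[K]^2 V) :
    evalSeq f (fun i => c • X i) = c ^ n • evalSeq f X := by
  simp only [evalSeq]
  rw [f.map_smul_univ (fun _ => c) fun i : Fin n => X i]
  simp

variable (K g h) in
/-- The automorphism of `C^*(g ⊕ h, g ⊕ h)` that is induced by the automorphism
`(x, u) ↦ (x, u / 2)` of `g ⊕ h` and divided by `4ⁿ` in degree `n`. -/
def scaling : CochainSpace K (g × h) (g × h) →ₗ[K] CochainSpace K (g × h) (g × h) :=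
  DirectSum.lmap fun n => ((4 : K) ^ n)⁻¹ • transport (stretch K g h 2) (stretch K g h 2⁻¹) n

lemma scaling_lof {n : ℕ} (f : Cochain K (g × h) (g × h) n) :
    scaling K g h (DirectSum.lof K ℕ _ n f) = ((4 : K) ^ n)⁻¹ •
      DirectSum.lof K ℕ _ n (transport (stretch K g h 2) (stretch K g h 2⁻¹) n f) := by
  rw [scaling, DirectSum.lmap_lof, LinearMap.smul_apply, map_smul]

lemma scaling_mem {n : ℕ} {f : CochainSpace K (g × h) (g × h)}
    (hf : f ∈ homog K (g × h) (g × h) n) : scaling K g h f ∈ homog K (g × h) (g × h) n := by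
  obtain ⟨f, rfl⟩ := hf
  rw [scaling_lof]
  exact Submodule.smul_mem _ _ (lof_mem_homog _)

variable [CharZero K]

lemma stretch_stretch (a : g × h) : stretch K g h 2 (stretch K g h 2⁻¹ a) = a := by
  rw [stretch_apply, stretch_apply, smul_smul, mul_inv_cancel₀ two_ne_zero, one_smul]

/-- Conjugation by an automorphism of g ⊕ h respects the circle product by naturality, and the
factor 4⁻ⁿ is multiplicative in the degree. -/
lemma scaling_circT (P Q : CochainSpace K (g × h) (g × h)) :
    scaling K g h (circT K (g × h) P Q) =
      circT K (g × h) (scaling K g h P) (scaling K g h Q) := by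
  induction P using DirectSum.induction_on with
  | zero => simp
  | add a a' ha ha' => simp only [map_add, LinearMap.add_apply, ha, ha']
  | of p P =>
    induction Q using DirectSum.induction_on with
    | zero => simp
    | add b b' hb hb' => simp only [map_add, hb, hb']
    | of q Q =>
      change scaling K g h (circT K (g × h) (DirectSum.lof K ℕ _ p P) (DirectSum.lof K ℕ _ q Q)) =
        circT K (g × h) (scaling K g h (DirectSum.lof K ℕ _ p P))
          (scaling K g h (DirectSum.lof K ℕ _ q Q))
      rw [circT_lof, scaling_lof, scaling_lof, scaling_lof, map_smul (circT K (g × h)),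
        LinearMap.smul_apply, map_smul, circT_lof, smul_smul, pow_add, mul_inv]
      congr 1
      refine lof_eq_lof rfl fun X z => ?_
      refine evalSeq_circ_map (stretch K g h 2) (stretch K g h 2⁻¹) (fun X z => rfl)
        (fun X z => ?_) X z
      rw [evalSeq_transport, stretch_stretch]

lemma scaling_lieBracket (P Q : CochainSpace K (g × h) (g × h)) :
    scaling K g h (lieBracket K (g × h) P Q) =
      lieBracket K (g × h) (scaling K g h P) (scaling K g h Q) := by
  induction P using DirectSum.induction_on with
  | zero => simp
  | add a a' ha ha' => simp only [map_add, LinearMap.add_apply, ha, ha']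
  | of p P =>
    induction Q using DirectSum.induction_on with
    | zero => simp
    | add b b' hb hb' => simp only [map_add, hb, hb']
    | of q Q =>
      have hP : DirectSum.of (Cochain K (g × h) (g × h)) p P ∈ homog K (g × h) (g × h) p :=
        lof_mem_homog P
      have hQ : DirectSum.of (Cochain K (g × h) (g × h)) q Q ∈ homog K (g × h) (g × h) q :=
        lof_mem_homog Q
      generalize DirectSum.of (Cochain K (g × h) (g × h)) p P = a at hP ⊢
      generalize DirectSum.of (Cochain K (g × h) (g × h)) q Q = b at hQ ⊢
      rw [lieBracket_eq hP hQ, lieBracket_eq (scaling_mem hP) (scaling_mem hQ), map_sub,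
        map_units_smul, scaling_circT, scaling_circT]

lemma four_pow_inv_smul {M : Type*} [AddCommGroup M] [Module K M] (n : ℕ) (x : M) :
    ((4 : K) ^ n)⁻¹ • (2 * 2 : K) ^ n • x = x := by
  rw [smul_smul, show (2 * 2 : K) = 4 by norm_num, inv_mul_cancel₀ (pow_ne_zero n (by norm_num)), one_smul]

/-- A cochain of degree n on h has 2n + 1 vector arguments, each stretched by 2. The factor 4⁻ⁿ
cancels those in the n bivectors, and one factor 2 remains in every degree. -/
lemma scaling_inclF (a : CochainSpace K h g) :
    scaling K g h (inclF K g h a) = (2 : K) • inclF K g h a := by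
  induction a using DirectSum.induction_on with
  | zero => simp
  | add a a' ha ha' => simp only [map_add, ha, ha', smul_add]
  | of n f =>
    change scaling K g h (inclF K g h (DirectSum.lof K ℕ _ n f)) =
      (2 : K) • inclF K g h (DirectSum.lof K ℕ _ n f)
    rw [inclF_eq, transportT_lof, scaling_lof,
      ← map_smul (DirectSum.lof K ℕ (Cochain K (g × h) (g × h)) n),
      ← map_smul (DirectSum.lof K ℕ (Cochain K (g × h) (g × h)) n)]
    refine lof_eq_lof rfl fun X z => ?_
    have hj : LinearMap.snd K g h ∘ₗ stretch K g h 2 = (2 : K) • LinearMap.snd K g h := rfl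
    change ((4 : K) ^ n)⁻¹ • evalSeq (transport (stretch K g h 2) (stretch K g h 2⁻¹) n
      (transport (LinearMap.snd K g h) (LinearMap.inl K g h) n f)).1 X z =
      (2 : K) • evalSeq (transport (LinearMap.snd K g h) (LinearMap.inl K g h) n f).1 X z
    simp only [evalSeq_transport, map_map_exteriorPower, hj, map_smul_exteriorPower, evalSeq_smul,
      LinearMap.smul_apply, map_smul, four_pow_inv_smul, stretch_apply]
    simp

lemma projF_scaling (a : CochainSpace K (g × h) (g × h)) :
    projF K g h (scaling K g h a) = (2 : K) • projF K g h a := by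
  induction a using DirectSum.induction_on with
  | zero => simp
  | add a a' ha ha' => simp only [map_add, ha, ha', smul_add]
  | of n f =>
    change projF K g h (scaling K g h (DirectSum.lof K ℕ _ n f)) =
      (2 : K) • projF K g h (DirectSum.lof K ℕ _ n f)
    rw [projF_eq, scaling_lof, map_smul, transportT_lof, transportT_lof,
      ← map_smul (DirectSum.lof K ℕ (Cochain K h g) n),
      ← map_smul (DirectSum.lof K ℕ (Cochain K h g) n)]
    refine lof_eq_lof rfl fun X z => ?_
    have hj : stretch K g h 2 ∘ₗ LinearMap.inr K g h = (2 : K) • LinearMap.inr K g h := by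
      ext x <;> simp [stretch_apply]
    have hz : stretch K g h 2 (LinearMap.inr K g h z) = (2 : K) • LinearMap.inr K g h z :=
      LinearMap.congr_fun hj z
    change ((4 : K) ^ n)⁻¹ • evalSeq (transport (LinearMap.inr K g h) (LinearMap.fst K g h) n
      (transport (stretch K g h 2) (stretch K g h 2⁻¹) n f)).1 X z =
      (2 : K) • evalSeq (transport (LinearMap.inr K g h) (LinearMap.fst K g h) n f).1 X z
    simp only [evalSeq_transport, map_map_exteriorPower, hj, map_smul_exteriorPower, evalSeq_smul,
      LinearMap.smul_apply, map_smul, hz, LinearMap.fst_apply, stretch_apply]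
    rw [smul_comm, four_pow_inv_smul]

lemma scaling_listBracket (A : CochainSpace K (g × h) (g × h)) (xs : List (CochainSpace K h g)) :
    scaling K g h (listBracket (lieBracket K (g × h)) (inclF K g h) A xs) =
      (2 : K) ^ xs.length •
        listBracket (lieBracket K (g × h)) (inclF K g h) (scaling K g h A) xs := by
  induction xs generalizing A with
  | nil => simp [listBracket_nil]
  | cons x xs ih =>
    rw [listBracket_cons, ih, scaling_lieBracket, scaling_inclF, map_smul, listBracket_smul,
      smul_smul, List.length_cons, pow_succ, listBracket_cons]

/-- If `Δ` is an eigenvector of the scaling, then at most one higher derived bracket is nonzero. -/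
lemma projF_listBracket_eq_zero {A : CochainSpace K (g × h) (g × h)} {c : K}
    (hA : scaling K g h A = c • A) (xs : List (CochainSpace K h g))
    (hc : (2 : K) ^ xs.length * c ≠ 2) :
    projF K g h (listBracket (lieBracket K (g × h)) (inclF K g h) A xs) = 0 := by
  -- The scaling multiplies the projected bracket by 2, but also by 2^k c, with k the number of
  -- entries.
  have h1 := projF_scaling (listBracket (lieBracket K (g × h)) (inclF K g h) A xs)
  rw [scaling_listBracket, hA, listBracket_smul, smul_smul, map_smul, ← sub_eq_zero,
    ← sub_smul] at h1
  exact (smul_eq_zero.mp h1).resolve_left (sub_ne_zero.mpr hc)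

lemma scaling_ofAlternating (s s' : (g × h) [⋀^Fin 3]→ₗ[K] (g × h))
    (hs : ∀ a b c, stretch K g h 2⁻¹ (s ![stretch K g h 2 a, stretch K g h 2 b,
      stretch K g h 2 c]) = (4 : K) • s' ![a, b, c]) :
    scaling K g h (DirectSum.lof K ℕ _ 1 (ofAlternating s)) =
      DirectSum.lof K ℕ _ 1 (ofAlternating s') := by
  rw [scaling_lof, ← map_smul]
  refine lof_eq_lof rfl fun X z => ?_
  change ((4 : K) ^ 1)⁻¹ • stretch K g h 2⁻¹ (curryAlt s (exteriorPower.map 2 (stretch K g h 2)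
    (X 0)) (stretch K g h 2 z)) = curryAlt s' (X 0) z
  induction X 0 using wedge_induction with
  | hw a b =>
    rw [map_wedge, curryAlt_wedge, curryAlt_wedge, hs, smul_smul, pow_one,
      inv_mul_cancel₀ (by norm_num), one_smul]
  | h0 => simp
  | hadd a b ha hb => simp only [map_add, LinearMap.add_apply, smul_add, ha, hb]
  | hsmul t a ha => simp only [map_smul, LinearMap.smul_apply, ← ha, smul_comm t]

end Scaling

/-! ### Only l₁ and l₃ survive -/

section DerivedBrackets

variable {V W : Type*} [AddCommGroup V] [Module K V] [AddCommGroup W] [Module K W]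

lemma curryAlt_add (f f' : V [⋀^Fin 3]→ₗ[K] W) : curryAlt (f + f') = curryAlt f + curryAlt f' := by
  refine LinearMap.ext fun x => LinearMap.ext fun z => ?_
  induction x using wedge_induction with
  | hw a b => simp only [curryAlt_wedge, LinearMap.add_apply, AlternatingMap.add_apply]
  | h0 => simp
  | hadd a b ha hb => simp only [map_add, LinearMap.add_apply, ha, hb]
  | hsmul t a ha => simp only [map_smul, LinearMap.smul_apply, ha]

lemma curryAlt_smul (c : K) (f : V [⋀^Fin 3]→ₗ[K] W) : curryAlt (c • f) = c • curryAlt f := by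
  refine LinearMap.ext fun x => LinearMap.ext fun z => ?_
  induction x using wedge_induction with
  | hw a b => simp only [curryAlt_wedge, LinearMap.smul_apply, AlternatingMap.smul_apply]
  | h0 => simp
  | hadd a b ha hb => simp only [map_add, LinearMap.add_apply, ha, hb]
  | hsmul t a ha => simp only [map_smul, LinearMap.smul_apply, ha]

lemma ofAlternating_add (f f' : V [⋀^Fin 3]→ₗ[K] W) :
    ofAlternating (f + f') = ofAlternating f + ofAlternating f' := by
  refine Subtype.ext (MultilinearMap.ext fun X => ?_)
  change curryAlt (f + f') (X 0) = curryAlt f (X 0) + curryAlt f' (X 0)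
  rw [curryAlt_add]; rfl

lemma ofAlternating_smul (c : K) (f : V [⋀^Fin 3]→ₗ[K] W) :
    ofAlternating (c • f) = c • ofAlternating f := by
  refine Subtype.ext (MultilinearMap.ext fun X => ?_)
  change curryAlt (c • f) (X 0) = c • curryAlt f (X 0)
  rw [curryAlt_smul]; rfl

variable {g h : Type*} [AddCommGroup g] [Module K g] [AddCommGroup h] [Module K h]
  (π : Bracket K g) (μ : Bracket K h) (ρ : g [⋀^Fin 2]→ₗ[K] Module.End K h) (lam : K)

lemma derivedBracket_apply (k : ℕ) (x : Fin k → CochainSpace K h g) :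
    derivedBracket π μ ρ lam k x = projF K g h (listBracket (lieBracket K (g × h)) (inclF K g h)
      (DirectSum.lof K ℕ _ 1 (ofAlternating (semidirect π μ ρ lam))) (List.ofFn x)) := by
  refine congrArg (projF K g h) ?_
  induction k with
  | zero => rfl
  | succ k ih =>
    rw [List.ofFn_succ', List.concat_eq_append, listBracket_concat, ← ih fun i => x i.castSucc]
    rfl

/-- The element Δ splits into two eigenvectors of the scaling. For π + ρ the eigenvalue is 1/4, so
2^k / 4 = 2 forces k = 3; for λμ it is 1, so 2^k = 2 forces k = 1. Characteristic 0 makes the powers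
of 2 distinct in K. -/
lemma derivedBracket_eq_zero [CharZero K] {k : ℕ} (h1 : k ≠ 1) (h3 : k ≠ 3) :
    derivedBracket π μ ρ lam k = 0 := by
  refine MultilinearMap.ext fun x => ?_
  set s := semidirect π μ ρ lam with hs
  -- Weight 0 isolates π + ρ, and the difference `s - s₀` is λμ.
  set s₀ := semidirect π μ ρ 0 with hs₀
  have e₀ : ∀ a b c, s₀ ![a, b, c] = (π.br ![a.1, b.1, c.1],
      ρ ![a.1, b.1] c.2 + ρ ![b.1, c.1] a.2 + ρ ![c.1, a.1] b.2) := fun a b c => by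
    rw [hs₀, semidirect_apply, zero_smul, add_zero]
  have e₁ : ∀ a b c, (s - s₀) ![a, b, c] = (0, lam • μ.br ![a.2, b.2, c.2]) := fun a b c => by
    rw [AlternatingMap.sub_apply, e₀, hs, semidirect_apply]
    simp
  have hdec : s = s₀ + (s - s₀) := by abel
  have h4 : (2 : K) ^ k * 4⁻¹ ≠ 2 := by
    intro h
    have h8 : ((2 ^ k : ℕ) : K) = ((2 ^ 3 : ℕ) : K) := by
      push_cast
      field_simp at h
      rw [h]; norm_num
    exact h3 (Nat.pow_right_injective le_rfl (Nat.cast_injective h8))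
  have h5 : (2 : K) ^ k * 1 ≠ 2 := by
    intro h
    have h8 : ((2 ^ k : ℕ) : K) = ((2 ^ 1 : ℕ) : K) := by
      push_cast
      rw [← mul_one ((2 : K) ^ k), h]
    exact h1 (Nat.pow_right_injective le_rfl (Nat.cast_injective h8))
  rw [derivedBracket_apply, ← hs, hdec, ofAlternating_add, map_add, listBracket_add, map_add,
    projF_listBracket_eq_zero (c := 4⁻¹), projF_listBracket_eq_zero (c := 1)]
  · simp
  · rw [one_smul]
    refine scaling_ofAlternating _ _ fun a b c => ?_
    simp only [e₁, stretch_apply, alt₃_smul₀, alt₃_smul₁, alt₃_smul₂, Prod.smul_mk, smul_zero,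
      smul_smul]
    congr 2
    field_simp
    ring
  · rwa [List.length_ofFn]
  · rw [← map_smul, ← ofAlternating_smul]
    refine scaling_ofAlternating _ _ fun a b c => ?_
    simp only [AlternatingMap.smul_apply, e₀, stretch_apply, map_smul, smul_smul, ← smul_add]
    rw [inv_mul_cancel₀ two_ne_zero, mul_inv_cancel₀ (by norm_num), one_smul, one_smul]
  · rwa [List.length_ofFn]

/-- On arguments from h the g-component of Δ is π(0, 0, 0) = 0. -/
lemma projF_semidirect :
    projF K g h (DirectSum.lof K ℕ _ 1 (ofAlternating (semidirect π μ ρ lam))) = 0 := by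
  rw [projF_eq, transportT_lof]
  refine lof_eq_zero fun X z => ?_
  change (curryAlt (semidirect π μ ρ lam) (exteriorPower.map 2 (LinearMap.inr K g h) (X 0))
    (LinearMap.inr K g h z)).1 = 0
  induction X 0 using wedge_induction with
  | hw a b =>
    rw [map_wedge, curryAlt_wedge, semidirect_apply]
    exact alt₃_zero₀ _ _ _
  | h0 => simp
  | hadd a b ha hb => simp only [map_add, LinearMap.add_apply, Prod.fst_add, ha, hb, add_zero]
  | hsmul t a ha => simp only [map_smul, LinearMap.smul_apply, Prod.smul_fst, ha, smul_zero]

end DerivedBrackets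

/-! ### The Maurer-Cartan equation and relative Rota-Baxter operators -/

section MaurerCartan

variable {V : Type*} [AddCommGroup V] [Module K V]

/-- The map `x ↦ D(x) S + D(S ⋆ x) - S D(x)` from bivectors to endomorphisms. -/
def commOp (S : V →ₗ[K] V) (D : ⋀[K]^2 V → V →ₗ[K] V) : ⋀[K]^2 V → V →ₗ[K] V := fun x =>
  D x ∘ₗ S + D (derivExt S x) - S ∘ₗ D x

/-- Bracketing with a map of degree 0 preserves degree 1, so repeated brackets amount to iterating
`commOp` on operators indexed by bivectors. -/
lemma contract_lieBracket_ofLinear {A : CochainSpace K V V} (hA : A ∈ homog K V V 1)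
    (S : V →ₗ[K] V) {D : ⋀[K]^2 V → V →ₗ[K] V}
    (hD : ∀ x, contract V V x A = DirectSum.lof K ℕ _ 0 (ofLinear (D x))) (x : ⋀[K]^2 V) :
    contract V V x (lieBracket K V A (DirectSum.lof K ℕ _ 0 (ofLinear S))) =
      DirectSum.lof K ℕ _ 0 (ofLinear (commOp S D x)) := by
  rw [lieBracket_eq hA (lof_mem_homog _), map_sub, map_units_smul, contract_circT_ofLinear,
    contract_circT_succ (q := 0) x _ hA, contract_lof_zero, hD, hD, circT_ofLinear, circT_ofLinear,
    map_zero, LinearMap.zero_apply, smul_zero, zero_add, mul_zero, pow_zero, one_smul,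
    lof_ofLinear_add, lof_ofLinear_sub]
  rfl

variable {g h : Type*} [AddCommGroup g] [Module K g] [AddCommGroup h] [Module K h]

lemma transportT_ofLinear {V' W W' : Type*} [AddCommGroup V'] [Module K V'] [AddCommGroup W]
    [Module K W] [AddCommGroup W'] [Module K W'] (j : V' →ₗ[K] V) (r : W →ₗ[K] W')
    (T : V →ₗ[K] W) :
    transportT K j r (DirectSum.lof K ℕ _ 0 (ofLinear T)) =
      DirectSum.lof K ℕ _ 0 (ofLinear (r ∘ₗ T ∘ₗ j)) := by
  rw [transportT_lof]
  exact lof_eq_lof rfl fun X z => rfl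

lemma eq_zero_iff_contract_wedge {n : ℕ} {W : Type*} [AddCommGroup W] [Module K W]
    {f : CochainSpace K V W} (hf : f ∈ homog K V W (n + 1)) :
    f = 0 ↔ ∀ x y, contract V W (wedge x y) f = 0 := by
  refine ⟨fun h x y => by rw [h, map_zero], fun h => eq_zero_of_contract hf fun x => ?_⟩
  obtain ⟨f, rfl⟩ := hf
  rw [contract_lof_succ]
  refine lof_eq_zero fun X z => ?_
  rw [evalSeq_contractC]
  induction x using wedge_induction with
  | hw x y =>
    have h1 := h x y
    rw [contract_lof_succ] at h1
    have h2 := DirectSum.of_injective (β := Cochain K V W) n (h1.trans (map_zero _).symm)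
    rw [← evalSeq_contractC, h2]
    rfl
  | h0 => rw [← evalSeq_curryLeft, map_zero]; rfl
  | hadd a b ha hb =>
    rw [← evalSeq_curryLeft] at ha hb ⊢
    rw [map_add]
    exact (congrArg₂ (· + ·) ha hb).trans (add_zero 0)
  | hsmul c a ha =>
    rw [← evalSeq_curryLeft] at ha ⊢
    rw [map_smul]
    exact (congrArg (c • ·) ha).trans (smul_zero c)

/-- The Maurer-Cartan equation of `l₁` and `l₃`. -/
lemma maurerCartan_iff [CharZero K] (π : Bracket K g) (μ : Bracket K h)
    (ρ : g [⋀^Fin 2]→ₗ[K] Module.End K h) (lam : K) (T : h →ₗ[K] g) :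
    derivedBracket π μ ρ lam 1 (fun _ => DirectSum.lof K ℕ _ 0 (ofLinear T)) +
        (6 : K)⁻¹ • derivedBracket π μ ρ lam 3 (fun _ => DirectSum.lof K ℕ _ 0 (ofLinear T)) = 0 ↔
      IsRelativeRotaBaxter π μ ρ lam T := by
  set s := semidirect π μ ρ lam with hs
  set Δ := DirectSum.lof K ℕ (Cochain K (g × h) (g × h)) 1 (ofAlternating s) with hΔ
  set S := LinearMap.inl K g h ∘ₗ T ∘ₗ LinearMap.snd K g h with hS
  set τ := DirectSum.lof K ℕ (Cochain K (g × h) (g × h)) 0 (ofLinear S) with hτ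
  have hτ0 : τ ∈ homog K (g × h) (g × h) 0 := lof_mem_homog _
  have hι : inclF K g h (DirectSum.lof K ℕ _ 0 (ofLinear T)) = τ := transportT_ofLinear _ _ _
  set A₁ := lieBracket K (g × h) Δ τ with hA₁
  set A₂ := lieBracket K (g × h) A₁ τ with hA₂
  set A₃ := lieBracket K (g × h) A₂ τ with hA₃
  have m₀ : Δ ∈ homog K (g × h) (g × h) 1 := lof_mem_homog _
  have m₁ : A₁ ∈ homog K (g × h) (g × h) 1 := lieBracket_mem m₀ hτ0
  have m₂ : A₂ ∈ homog K (g × h) (g × h) 1 := lieBracket_mem m₁ hτ0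
  have m₃ : A₃ ∈ homog K (g × h) (g × h) 1 := lieBracket_mem m₂ hτ0
  have c₁ := contract_lieBracket_ofLinear m₀ S (contract_ofAlternating s)
  have c₂ := contract_lieBracket_ofLinear m₁ S c₁
  have c₃ := contract_lieBracket_ofLinear m₂ S c₂
  have l₁ : derivedBracket π μ ρ lam 1 (fun _ => DirectSum.lof K ℕ _ 0 (ofLinear T)) =
      projF K g h A₁ := by
    rw [derivedBracket_apply, ← hs, ← hΔ]
    simp [listBracket_cons, listBracket_nil, hι, hA₁]
  have l₃ : derivedBracket π μ ρ lam 3 (fun _ => DirectSum.lof K ℕ _ 0 (ofLinear T)) =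
      projF K g h A₃ := by
    rw [derivedBracket_apply, ← hs, ← hΔ]
    simp [listBracket_cons, listBracket_nil, hι, hA₁, hA₂, hA₃]
  have hS1 : ∀ u, S (0, u) = (T u, 0) := fun u => rfl
  have hS2 : ∀ a, S a = (T a.2, 0) := fun u => rfl
  rw [l₁, l₃, eq_zero_iff_contract_wedge (n := 0)
    (add_mem (projF_mem m₁) (Submodule.smul_mem _ _ (projF_mem m₃)))]
  refine forall_congr' fun u => forall_congr' fun v => ?_
  rw [map_add, map_smul, projF_eq, contract_transportT, contract_transportT, c₁, c₃,
    transportT_ofLinear, transportT_ofLinear, lof_ofLinear_smul, lof_ofLinear_add,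
    ← lof_ofLinear_zero, ofLinear_injective.eq_iff, LinearMap.ext_iff]
  refine forall_congr' fun w => ?_
  rw [← sub_eq_zero (a := π.br _)]
  -- Of the first-order term only -λ T[u, v, w] remains. In the third-order term each surviving
  -- summand occurs 3! = 6 times, once for each order of applying the three copies of S, and this is
  -- cancelled by the coefficient 1/6.
  have key : (LinearMap.fst K g h ∘ₗ commOp S (⇑(curryAlt s))
        (exteriorPower.map 2 (LinearMap.inr K g h) (wedge u v)) ∘ₗ LinearMap.inr K g h +
      (6 : K)⁻¹ • LinearMap.fst K g h ∘ₗ commOp S (commOp S (commOp S ⇑(curryAlt s)))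
        (exteriorPower.map 2 (LinearMap.inr K g h) (wedge u v)) ∘ₗ LinearMap.inr K g h) w =
      π.br ![T u, T v, T w] -
        T (ρ ![T u, T v] w + ρ ![T v, T w] u + ρ ![T w, T u] v + lam • μ.br ![u, v, w]) := by
    simp only [commOp, map_wedge, derivExt_wedge, map_add, LinearMap.add_apply, LinearMap.sub_apply,
      LinearMap.smul_apply, LinearMap.comp_apply, curryAlt_wedge, LinearMap.inr_apply, hS1, hS2,
      hs, semidirect_apply, alt₃_zero₀, alt₃_zero₁, alt₃_zero₂, alt₂_zero_left,
      alt₂_zero_right, LinearMap.zero_apply, map_zero, LinearMap.fst_apply, Prod.fst_add,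
      Prod.fst_sub, Prod.snd_add, Prod.snd_sub, smul_zero, add_zero, zero_add, sub_zero, zero_sub]
    module
  rw [key]
  rfl

lemma isMaurerCartan_iff [CharZero K] (π : Bracket K g) (μ : Bracket K h)
    (ρ : g [⋀^Fin 2]→ₗ[K] Module.End K h) (lam : K) (α : CochainSpace K h g) :
    IsMaurerCartan (gradingF K g h) (derivedBracket π μ ρ lam) α ↔
      ∃ T : h →ₗ[K] g, IsRelativeRotaBaxter π μ ρ lam T ∧
        α = DirectSum.lof K ℕ (Cochain K h g) 0 (ofLinear T) := by
  -- The sum is indexed by n = k - 1, so the indices 0 and 2 stand for l₁ and l₃.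
  have hsupp : Function.support (fun n : ℕ => ((n + 1).factorial : K)⁻¹ •
      derivedBracket π μ ρ lam (n + 1) fun _ => α) ⊆ (({0, 2} : Finset ℕ) : Set ℕ) := by
    intro n hn
    by_contra hmem
    simp only [Finset.coe_insert, Finset.coe_singleton, Set.mem_insert_iff,
      Set.mem_singleton_iff, not_or] at hmem
    apply hn
    simp only
    rw [derivedBracket_eq_zero π μ ρ lam (by omega) (by omega), zero_apply,
      smul_zero]
  have hsum : ∑ᶠ n : ℕ, ((n + 1).factorial : K)⁻¹ •
      derivedBracket π μ ρ lam (n + 1) (fun _ => α) =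
      derivedBracket π μ ρ lam 1 (fun _ => α) +
        (6 : K)⁻¹ • derivedBracket π μ ρ lam 3 (fun _ => α) := by
    rw [finsum_eq_sum_of_support_subset _ hsupp, Finset.sum_pair (by decide)]
    simp [Nat.factorial]
  rw [IsMaurerCartan, hsum]
  constructor
  · rintro ⟨hα, -, hmc⟩
    obtain ⟨T, rfl⟩ := exists_ofLinear (hα : α ∈ homog K h g 0)
    exact ⟨T, (maurerCartan_iff π μ ρ lam T).mp hmc, rfl⟩
  · rintro ⟨T, hT, rfl⟩
    exact ⟨lof_mem_homog (ofLinear T), (Finset.finite_toSet _).subset hsupp,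
      (maurerCartan_iff π μ ρ lam T).mpr hT⟩

lemma isLInfinityAlgebra_derivedBracket [CharZero K] {π : Bracket K g} {μ : Bracket K h}
    {ρ : g [⋀^Fin 2]→ₗ[K] Module.End K h} (hρ : IsAction π μ ρ) (lam : K) :
    IsLInfinityAlgebra (gradingF K g h) (derivedBracket π μ ρ lam) := by
  rw [gradingF_eq]
  exact (isVData K g h).isLInfinityAlgebra (isInternal_gradingZ K h g)
    (lof_mem_homog (ofAlternating (semidirect π μ ρ lam)))
    (lieBracket_self_ofAlternating (semidirectBracket hρ lam)) (projF_semidirect π μ ρ lam) _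
    fun k x => derivedBracket_apply π μ ρ lam k x

end MaurerCartan

end ThreeLie

end

theorem mainTheorem3 {K : Type*} [Field K] [CharZero K]
    {g h : Type*} [AddCommGroup g] [Module K g] [AddCommGroup h] [Module K h]
    (π : ThreeLie.Bracket K g) (μ : ThreeLie.Bracket K h)
    (ρ : g [⋀^Fin 2]→ₗ[K] Module.End K h) (hρ : ThreeLie.IsAction π μ ρ) (lam : K) :
    ThreeLie.IsLInfinityAlgebra (ThreeLie.gradingF K g h) (ThreeLie.derivedBracket π μ ρ lam) ∧
    (∀ k : ℕ, k ≠ 1 → k ≠ 3 → ThreeLie.derivedBracket π μ ρ lam k = 0) ∧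
    ∀ α : ThreeLie.CochainSpace K h g,
      ThreeLie.IsMaurerCartan (ThreeLie.gradingF K g h) (ThreeLie.derivedBracket π μ ρ lam) α ↔
        ∃ T : h →ₗ[K] g, ThreeLie.IsRelativeRotaBaxter π μ ρ lam T ∧
          α = DirectSum.lof K ℕ (ThreeLie.Cochain K h g) 0 (ThreeLie.ofLinear T) :=
  ⟨ThreeLie.isLInfinityAlgebra_derivedBracket hρ lam,
    fun _ h1 h3 => ThreeLie.derivedBracket_eq_zero π μ ρ lam h1 h3,
    fun α => ThreeLie.isMaurerCartan_iff π μ ρ lam α⟩
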